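/- **Games.** There are two players, the machine $\top$ and the environment $\bot$; $\neg\wp$ is the adversary of $\wp$. A move is a finite string over the (finite) keyboard alphabet, a labmove is a move labeled with a player, a run is a finite or infinite sequence of labmoves, a position is a finite run, and $\neg\Gamma$ is $\Gamma$ with all labels switched. A game $A$ consists of a set $\mathbf{Lr}^A$ of legal runs, such that a run is legal iff all its nonempty finite initial segments are, and a function $\mathbf{Wn}^A$ from runs to players, such that if the last move of the shortest illegal initial segment of $\Gamma$ is by $\wp$ ("$\Gamma$ is $\wp$-illegal"), then $\mathbf{Wn}^A\langle\Gamma\rangle=\neg\wp$. A run $\Omega$ is a $\wp$-delay of $\Gamma$ if both have the same subsequence of $\wp'$-labeled moves for each player $\wp'$, and whenever the $n$-th $\wp$-move comes later than the $k$-th $\neg\wp$-move in $\Gamma$, it does so in $\Omega$. $A$ is static if, whenever $\Omega$ is a $\wp$-delay of $\Gamma$: if $\Gamma$ is not $\wp$-illegal, neither is $\Omega$; if $\mathbf{Wn}^A\langle\Gamma\rangle=\wp$, then $\mathbf{Wn}^A\langle\Omega\rangle=\wp$. **Operations.** $\Gamma^{i.}$ is obtained from $\Gamma$ by keeping the moves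 of the form $i.\beta$ only and deleting the prefix "$i.$"; for an infinite bitstring $x$, $\Gamma^{\preceq x}$ is obtained by keeping the moves $u.\beta$ with $u$ a finite initial segment of $x$ only and deleting the prefix "$u.$". A bitstring is essentially finite if it has finitely many 1s. Winners are specified for legal runs (for illegal ones they are determined). - $\neg A$: $\Gamma$ is legal iff $\neg\Gamma\in\mathbf{Lr}^A$; $\top$ wins $\Gamma$ iff $\mathbf{Wn}^A\langle\neg\Gamma\rangle=\bot$. - $A_1\wedge A_2$, $A_1\vee A_2$: $\Gamma$ is legal iff every move is $i.\alpha$ with $i\in\{1,2\}$ and $\Gamma^{i.}\in\mathbf{Lr}^{A_i}$ for both $i$; $\top$ wins iff $\mathbf{Wn}^{A_i}\langle\Gamma^{i.}\rangle=\top$ for both $i$ (resp. for some $i$). - ${\circ}A$, ${\bullet}A$ (uncountable branching recurrence and corecurrence), and the new countable branching recurrence $\mathsf{C}_LA$ and corecurrence $\mathsf{D}_LA$: $\Gamma$ is legal iff every move is $w.\alpha$ for a finite bitstring $w$ and $\Gamma^{\preceq x}\in\mathbf{Lr}^A$ for all infinite $x$; $\top$ wins iff $\mathbf{Wn}^A\langle\Gamma^{\preceq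 x}\rangle=\top$ for all $x$ (for ${\circ}A$), for some $x$ (for ${\bullet}A$), for all essentially finite infinite $x$ (for $\mathsf{C}_LA$), for some essentially finite infinite $x$ (for $\mathsf{D}_LA$). - The old countable branching recurrence $\mathsf{C}_TA$: the nodes of a position $\Phi$ are the empty bitstring and all $u0,u1$ such that $\Phi$ contains the move "$u{:}$"; a leaf is a node that is not a proper prefix of another node. The legal moves in a legal position $\Phi$ are the moves "$w{:}$" by $\bot$ with $w$ a leaf, and the moves $w.\alpha$ by a player $\wp$ with $w$ a node such that, for every infinite extension $v$ of $w$, $\langle\Phi^{\preceq v},\wp\alpha\rangle\in\mathbf{Lr}^A$. A run is legal iff each of its moves is legal in the position in which it is made; $\top$ wins a legal $\Gamma$ iff $\mathbf{Wn}^A\langle\Gamma^{\preceq v}\rangle=\top$ for every essentially finite infinite $v$. The old corecurrence is $\mathsf{D}_TA=\neg\mathsf{C}_T\neg A$. **Formulas and machines.** Formulas are built from atoms and negated atoms with $\wedge,\vee,{\circ},{\bullet},\mathsf{C}_T,\mathsf{D}_T,\mathsf{C}_L,\mathsf{D}_L$; the negation of an arbitrary formula is defined by duality ($\neg\neg P=P$,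 and $\wedge/\vee$, ${\circ}/{\bullet}$, $\mathsf{C}_T/\mathsf{D}_T$, $\mathsf{C}_L/\mathsf{D}_L$ are interchanged), and $F\to G$ abbreviates $\neg F\vee G$. An interpretation $^*$ sends every atom to a static game, and extends to formulas through the game operations. An easy-play machine (EPM) is a deterministic Turing machine with a read/write work tape and a read-only run tape that at any time spells the current position; in a clock cycle it may make one move (spelled on its work tape) or grant permission, in which case the environment may make one move or none; the moves made are appended to the position. A computation branch is an infinite sequence of configurations, starting from the initial one with empty tapes, each a possible successor of the previous one; it is fair if permission is granted infinitely often. An EPM wins a game $A$ if every computation branch spells a run won by $\top$ and is fair unless that run is $\bot$-illegal. A formula is uniformly valid if there is one EPM that wins $F^*$ for every interpretation $^*$. **Theorem.** For every formula $F$, both $\mathsf{C}_TF\to\mathsf{C}_LF$ and $\mathsf{C}_LF\to\mathsf{C}_TF$ are uniformly valid. -/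

import Mathlib

noncomputable section

namespace CoL

/-! ### Players, moves, runs -/

/-- The two players: the machine `top` and its environment `bot`. -/
inductive Player where
  | top
  | bot
  deriving DecidableEq

instance : Fintype Player := ⟨{.top, .bot}, by rintro (_ | _) <;> simp⟩

/-- The adversary of a player. -/
def Player.neg : Player → Player
  | .top => .bot
  | .bot => .top

/-- The keyboard alphabet, with 95 symbols like the printable ASCII characters. The symbols that
play a role in the game operations are named: the digits 0, 1, 2, the period and the colon. -/
inductive Key where
  | zero
  | one
  | two
  | dot
  | colon
  | other (k : Fin 90)
  deriving DecidableEq, Fintype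

/-- A move is a finite string over the keyboard alphabet. -/
abbrev Move := List Key

/-- A labmove is a move together with the player who makes it. -/
abbrev Labmove := Player × Move

/-- A position is a finite sequence of labmoves. -/
abbrev Position := List Labmove

/-- A run is a finite or infinite sequence of labmoves; positions are coerced to runs. -/
abbrev Run := Stream'.Seq Labmove

/-- The position `Φ` is an initial segment of the run `Γ`. -/
def IsInitial (Φ : Position) (Γ : Run) : Prop := ∃ n, Γ.take n = Φ

open Classical in
/-- The limit of a sequence of positions in which each is an initial segment of the next one:
the run whose `k`-th labmove is the `k`-th labmove of any of the positions that has one. -/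
def limitRun (P : ℕ → Position) : Run :=
  ⟨fun k => if h : ∃ n, k < (P n).length then (P (Nat.find h))[k]? else none, by
    intro k hk
    have h1 : ¬ ∃ n, k < (P n).length := by
      intro h
      have hk' : (if h : ∃ n, k < (P n).length then (P (Nat.find h))[k]? else none) = none := hk
      rw [dif_pos h, List.getElem?_eq_none_iff] at hk'
      exact absurd (Nat.find_spec h) (by omega)
    have h2 : ¬ ∃ n, k + 1 < (P n).length := fun ⟨n, hn⟩ => h1 ⟨n, by omega⟩
    exact dif_neg h2⟩

/-- Apply a partial function to the labmoves of a run, deleting those on which it is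
undefined. -/
def Run.filterMap (g : Labmove → Option Labmove) (Γ : Run) : Run :=
  limitRun fun n => (Γ.take n).filterMap g

/-- The same run with every label changed to the adversary. -/
def Run.neg (Γ : Run) : Run := Γ.map fun a => (a.1.neg, a.2)

/-- Remove the prefix `p` from `m`; undefined if `p` is not a prefix of `m`. -/
def dropPre (p m : Move) : Option Move :=
  if p <+: m then some (m.drop p.length) else none

/-- `Γ^p`: keep only the moves that begin with the string `p`, and delete that prefix. -/
def Run.sub (p : Move) (Γ : Run) : Run :=
  Γ.filterMap fun a => (dropPre p a.2).map fun β => (a.1, β)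

/-! ### Bitstrings and threads -/

/-- A bit as a keyboard symbol. -/
def bitKey : Bool → Key
  | false => .zero
  | true => .one

/-- A finite bitstring as a string of keyboard symbols. -/
def bits (w : List Bool) : Move := w.map bitKey

/-- The move `w.β`. -/
def addrMove (w : List Bool) (β : Move) : Move := bits w ++ Key.dot :: β

/-- The replicative move `w:`. -/
def replMove (w : List Bool) : Move := bits w ++ [Key.colon]

/-- Read a move as `w.β` (see `parseAddr_eq_some_iff`); undefined if it is not of this form. -/
def parseAddr : Move → Option (List Bool × Move)
  | [] => none
  | .zero :: m => (parseAddr m).map fun p => (false :: p.1, p.2)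
  | .one :: m => (parseAddr m).map fun p => (true :: p.1, p.2)
  | .dot :: m => some ([], m)
  | .two :: _ => none
  | .colon :: _ => none
  | .other _ :: _ => none

theorem parseAddr_addrMove (w : List Bool) (β : Move) :
    parseAddr (addrMove w β) = some (w, β) := by
  induction w with
  | nil => rfl
  | cons b w ih =>
    cases b <;> simpa [addrMove, bits, bitKey, parseAddr] using ih

theorem parseAddr_eq_some_iff (m : Move) (w : List Bool) (β : Move) :
    parseAddr m = some (w, β) ↔ m = addrMove w β := by
  refine ⟨fun h => ?_, fun h => h ▸ parseAddr_addrMove w β⟩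
  induction m generalizing w with
  | nil => simp [parseAddr] at h
  | cons a m ih =>
    cases a with
    | zero =>
      simp only [parseAddr, Option.map_eq_some_iff] at h
      obtain ⟨⟨w', β'⟩, h1, h2⟩ := h
      cases h2
      simpa [addrMove, bits, bitKey] using ih _ h1
    | one =>
      simp only [parseAddr, Option.map_eq_some_iff] at h
      obtain ⟨⟨w', β'⟩, h1, h2⟩ := h
      cases h2
      simpa [addrMove, bits, bitKey] using ih _ h1
    | dot =>
      simp only [parseAddr, Option.some.injEq] at h
      cases h
      rfl
    | two => simp [parseAddr] at h
    | colon => simp [parseAddr] at h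
    | other k => simp [parseAddr] at h

/-- Infinite bitstrings. -/
abbrev Bitstream := ℕ → Bool

/-- `w ≼ x`: the finite bitstring `w` is an initial segment of the infinite bitstring `x`. -/
def IsPre (w : List Bool) (x : Bitstream) : Prop := ∀ i, ∀ h : i < w.length, w[i] = x i

/-- An infinite bitstring is essentially finite if it contains only finitely many 1s. -/
def EssFin (x : Bitstream) : Prop := {i | x i = true}.Finite

open Classical in
/-- The labmove `℘u.β` becomes `℘β` if `u ≼ x`; everything else is deleted. -/
def threadMap (x : Bitstream) (a : Labmove) : Option Labmove :=
  match parseAddr a.2 with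
  | some (u, β) => if IsPre u x then some (a.1, β) else none
  | none => none

/-- `Γ^{≼x}`: the run taking place in the thread `x`. -/
def Run.thread (x : Bitstream) (Γ : Run) : Run := Γ.filterMap (threadMap x)

/-! ### Games -/

/-- The last move of the shortest initial segment of `Γ` outside `L` is made by `p`. -/
def IllegalBy (L : Set Run) (p : Player) (Γ : Run) : Prop :=
  ∃ (Φ : Position) (α : Move),
    IsInitial (Φ ++ [(p, α)]) Γ ∧ (∀ Ψ, Ψ <+: Φ → (Ψ : Run) ∈ L) ∧ ((Φ ++ [(p, α)] : Position) : Run) ∉ L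

/-- A run is in `L` iff so are all of its nonempty finite initial segments. -/
def PrefixDetermined (L : Set Run) : Prop :=
  ∀ Γ : Run, Γ ∈ L ↔ ∀ Φ : Position, IsInitial Φ Γ → Φ ≠ [] → (Φ : Run) ∈ L

/-- Games: a set of legal runs and a function naming the winner of every run. -/
@[ext]
structure Game where
  Lr : Set Run
  Wn : Run → Player
  prefixDetermined : PrefixDetermined Lr
  wn_of_illegalBy : ∀ p Γ, IllegalBy Lr p Γ → Wn Γ = p.neg

/-! ### Basic facts on runs, needed to see that the game operations produce games -/

theorem take_prefix_take (Γ : Run) {m n : ℕ} (h : m ≤ n) : Γ.take m <+: Γ.take n := by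
  rw [List.prefix_iff_getElem?]
  intro i hi
  have h1 : (Γ.take m)[i]? = some (Γ.take m)[i] := List.getElem?_eq_getElem hi
  rw [← h1, Stream'.Seq.getElem?_take, Stream'.Seq.getElem?_take]
  have : i < m := lt_of_lt_of_le hi Stream'.Seq.length_take_le
  rw [if_pos this, if_pos (by omega)]

theorem take_ofList (Φ : Position) (n : ℕ) : (Φ : Run).take n = Φ.take n := by
  apply List.ext_getElem?
  intro i
  rw [Stream'.Seq.getElem?_take, List.getElem?_take]
  simp

theorem isInitial_ofList (Φ Ψ : Position) : IsInitial Φ (Ψ : Run) ↔ Φ <+: Ψ := by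
  constructor
  · rintro ⟨n, rfl⟩
    rw [take_ofList]
    exact List.take_prefix _ _
  · intro h
    exact ⟨Φ.length, by rw [take_ofList, ← List.prefix_iff_eq_take.1 h]⟩

theorem IsInitial.get? {Φ : Position} {Γ : Run} (h : IsInitial Φ Γ) {i : ℕ}
    (hi : i < Φ.length) : Γ.get? i = Φ[i]? := by
  obtain ⟨n, rfl⟩ := h
  have : i < n := lt_of_lt_of_le hi Stream'.Seq.length_take_le
  rw [Stream'.Seq.getElem?_take, if_pos this]

theorem isInitial_iff {Φ : Position} {Γ : Run} :
    IsInitial Φ Γ ↔ ∀ i < Φ.length, Γ.get? i = Φ[i]? := by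
  refine ⟨fun h i hi => h.get? hi, fun h => ⟨Φ.length, ?_⟩⟩
  apply List.ext_getElem?
  intro i
  rw [Stream'.Seq.getElem?_take]
  split_ifs with hi
  · exact h i hi
  · exact (List.getElem?_eq_none (by omega)).symm

theorem IsInitial.trans {Φ Ψ : Position} {Γ : Run} (h : Φ <+: Ψ) (h' : IsInitial Ψ Γ) :
    IsInitial Φ Γ := by
  rw [isInitial_iff]
  intro i hi
  rw [h'.get? (lt_of_lt_of_le hi h.length_le), List.prefix_iff_getElem?.1 h i hi,
    List.getElem?_eq_getElem hi]

theorem isInitial_take (Γ : Run) (n : ℕ) : IsInitial (Γ.take n) Γ := ⟨n, rfl⟩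

theorem IsInitial.prefix_total {Φ Ψ : Position} {Γ : Run} (h : IsInitial Φ Γ)
    (h' : IsInitial Ψ Γ) : Φ <+: Ψ ∨ Ψ <+: Φ := by
  obtain ⟨m, rfl⟩ := h
  obtain ⟨n, rfl⟩ := h'
  rcases le_total m n with h | h
  · exact Or.inl (take_prefix_take Γ h)
  · exact Or.inr (take_prefix_take Γ h)

theorem limitRun_get? {P : ℕ → Position} (hP : ∀ m n, m ≤ n → P m <+: P n) {n k : ℕ}
    (hk : k < (P n).length) : (limitRun P).get? k = (P n)[k]? := by
  classical
  have h : ∃ n, k < (P n).length := ⟨n, hk⟩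
  have h1 : (limitRun P).get? k = (P (Nat.find h))[k]? := dif_pos h
  have h2 : k < (P (Nat.find h)).length := Nat.find_spec h
  have h3 := hP _ _ (Nat.find_min' h hk)
  rw [h1, List.prefix_iff_getElem?.1 h3 k h2, List.getElem?_eq_getElem h2]

theorem limitRun_get?_none {P : ℕ → Position} {k : ℕ} (hk : ∀ n, (P n).length ≤ k) :
    (limitRun P).get? k = none :=
  dif_neg fun ⟨n, hn⟩ => absurd (hk n) (by omega)

theorem isInitial_limitRun {P : ℕ → Position} (hP : ∀ m n, m ≤ n → P m <+: P n) (n : ℕ) :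
    IsInitial (P n) (limitRun P) :=
  isInitial_iff.2 fun _ hi => limitRun_get? hP hi

theorem prefix_of_isInitial_limitRun {P : ℕ → Position} (hP : ∀ m n, m ≤ n → P m <+: P n)
    {Φ : Position} (h : IsInitial Φ (limitRun P)) : ∃ n, Φ <+: P n := by
  rcases Nat.eq_zero_or_pos Φ.length with h0 | h0
  · exact ⟨0, by rw [List.length_eq_zero_iff.1 h0]; exact List.nil_prefix⟩
  · by_cases hn : ∃ n, Φ.length ≤ (P n).length
    · obtain ⟨n, hn⟩ := hn
      refine ⟨n, ?_⟩
      rcases h.prefix_total (isInitial_limitRun hP n) with h' | h'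
      · exact h'
      · exact (h'.eq_of_length_le hn) ▸ List.prefix_rfl
    · exfalso
      push Not at hn
      have h1 := h.get? (i := Φ.length - 1) (by omega)
      rw [limitRun_get?_none (fun n => by have := hn n; omega)] at h1
      have := List.getElem?_eq_none_iff.1 h1.symm
      omega

theorem filterMap_take_mono (g : Labmove → Option Labmove) (Γ : Run) (m n : ℕ) (h : m ≤ n) :
    (Γ.take m).filterMap g <+: (Γ.take n).filterMap g :=
  (take_prefix_take Γ h).filterMap g

theorem Run.filterMap_ofList (g : Labmove → Option Labmove) (Φ : Position) :
    Run.filterMap g (Φ : Run) = ((Φ.filterMap g : Position) : Run) := by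
  have hP := filterMap_take_mono g (Φ : Run)
  have hfull : ∀ n, Φ.length ≤ n → (Φ : Run).take n = Φ := fun n hn => by
    rw [take_ofList, List.take_of_length_le hn]
  apply Stream'.Seq.ext
  intro k
  rw [Stream'.Seq.ofList_get?]
  by_cases hk : k < (Φ.filterMap g).length
  · have h := limitRun_get? hP (n := Φ.length) (k := k) (by rw [hfull _ le_rfl]; exact hk)
    rw [hfull _ le_rfl] at h
    exact h
  · rw [List.getElem?_eq_none (by omega)]
    apply limitRun_get?_none
    intro n
    have h := (hP n (max n Φ.length) (le_max_left _ _)).length_le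
    rw [hfull _ (le_max_right _ _)] at h
    omega

theorem PrefixDetermined.of_prefix {L : Set Run} (hL : PrefixDetermined L) {Φ Ψ : Position}
    (h : Φ <+: Ψ) (hΨ : (Ψ : Run) ∈ L) : (Φ : Run) ∈ L :=
  (hL _).2 fun Θ hΘ hne =>
    (hL _).1 hΨ Θ ((isInitial_ofList _ _).2 (((isInitial_ofList _ _).1 hΘ).trans h)) hne

theorem PrefixDetermined.nil_mem {L : Set Run} (hL : PrefixDetermined L) :
    (([] : Position) : Run) ∈ L :=
  (hL _).2 fun _ h hne => absurd (List.prefix_nil.1 ((isInitial_ofList _ _).1 h)) hne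

theorem PrefixDetermined.inter {ι : Sort*} {L : ι → Set Run}
    (hL : ∀ i, PrefixDetermined (L i)) : PrefixDetermined {Γ | ∀ i, Γ ∈ L i} := fun Γ =>
  ⟨fun h Φ h1 h2 i => (hL i Γ).1 (h i) Φ h1 h2, fun h i => (hL i Γ).2 fun Φ h1 h2 => h Φ h1 h2 i⟩

theorem PrefixDetermined.and {L L' : Set Run} (hL : PrefixDetermined L)
    (hL' : PrefixDetermined L') : PrefixDetermined {Γ | Γ ∈ L ∧ Γ ∈ L'} := fun Γ =>
  ⟨fun h Φ h1 h2 => ⟨(hL Γ).1 h.1 Φ h1 h2, (hL' Γ).1 h.2 Φ h1 h2⟩,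
    fun h => ⟨(hL Γ).2 fun Φ h1 h2 => (h Φ h1 h2).1, (hL' Γ).2 fun Φ h1 h2 => (h Φ h1 h2).2⟩⟩

theorem prefixDetermined_forall_moves (p : Move → Prop) :
    PrefixDetermined {Γ | ∀ a ∈ Γ, p a.2} := by
  intro Γ
  simp only [Set.mem_ofPred_eq, Stream'.Seq.mem_iff_exists_get?]
  constructor
  · rintro h Φ hΦ - a ⟨i, hi⟩
    rw [Stream'.Seq.ofList_get?] at hi
    have hlt : i < Φ.length := by
      by_contra hc
      rw [List.getElem?_eq_none (by omega)] at hi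
      exact absurd hi (by simp)
    exact h a ⟨i, by rw [hΦ.get? hlt, ← hi]⟩
  · rintro h a ⟨i, hi⟩
    have hi' : (Γ.take (i + 1))[i]? = some a := by
      rw [Stream'.Seq.getElem?_take, if_pos (by omega), ← hi]
    refine h _ (isInitial_take Γ (i + 1)) ?_ a ⟨i, ?_⟩
    · intro hc
      rw [hc] at hi'
      simp at hi'
    · rw [Stream'.Seq.ofList_get?, hi']

theorem PrefixDetermined.filterMap {L : Set Run} (hL : PrefixDetermined L)
    (g : Labmove → Option Labmove) : PrefixDetermined {Γ | Run.filterMap g Γ ∈ L} := by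
  intro Γ
  have hP := filterMap_take_mono g Γ
  simp only [Set.mem_ofPred_eq, Run.filterMap_ofList]
  constructor
  · rintro h Φ ⟨n, rfl⟩ -
    by_cases h0 : (Γ.take n).filterMap g = []
    · rw [h0]
      exact hL.nil_mem
    · exact (hL _).1 h _ (isInitial_limitRun hP n) h0
  · intro h
    refine (hL _).2 fun Ψ hΨ _ => ?_
    obtain ⟨n, hn⟩ := prefix_of_isInitial_limitRun hP hΨ
    refine hL.of_prefix hn ?_
    by_cases h0 : Γ.take n = []
    · rw [h0]
      exact hL.nil_mem
    · exact h _ (isInitial_take Γ n) h0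

/-- A set of runs given by a condition on every single move in the position where it is made. -/
theorem prefixDetermined_forall_steps (q : Position → Labmove → Prop) :
    PrefixDetermined {Γ | ∀ Φ a, IsInitial (Φ ++ [a]) Γ → q Φ a} := by
  intro Γ
  constructor
  · intro h Ψ hΨ _ Φ a ha
    exact h Φ a (IsInitial.trans ((isInitial_ofList _ _).1 ha) hΨ)
  · intro h Φ a ha
    exact h _ ha (by simp) Φ a ((isInitial_ofList _ _).2 List.prefix_rfl)

theorem IllegalBy.not_mem {L : Set Run} (hL : PrefixDetermined L) {p : Player} {Γ : Run}
    (h : IllegalBy L p Γ) : Γ ∉ L := by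
  obtain ⟨Φ, α, h1, -, h3⟩ := h
  exact fun hΓ => h3 ((hL Γ).1 hΓ _ h1 (by simp))

theorem IllegalBy.unique {L : Set Run} {p q : Player} {Γ : Run}
    (h : IllegalBy L p Γ) (h' : IllegalBy L q Γ) : p = q := by
  obtain ⟨Φ, α, h1, h2, h3⟩ := h
  obtain ⟨Ψ, β, h1', h2', h3'⟩ := h'
  have key : ∀ {Φ Ψ : Position} {a b : Labmove}, Φ ++ [a] <+: Ψ ++ [b] →
      ((Φ ++ [a] : Position) : Run) ∉ L → (∀ Θ, Θ <+: Ψ → (Θ : Run) ∈ L) → a = b := by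
    intro Φ Ψ a b hp hn hl
    rcases List.prefix_concat_iff.1 hp with h | h
    · exact (List.append_inj' h rfl).2 |> fun h => by simpa using h
    · exact absurd (hl _ h) hn
  rcases h1.prefix_total h1' with h | h
  · exact congrArg Prod.fst (key h h3 h2')
  · exact (congrArg Prod.fst (key h h3' h2)).symm

/-! ### Game operations -/

open Classical in
/-- The game with the set `L` of legal runs in which a legal run is won by the machine iff `W`
holds of it; an illegal run is lost by the player who made it illegal. -/
def Game.ofLegal (L : Set Run) (hL : PrefixDetermined L) (W : Run → Prop) : Game where
  Lr := L
  Wn Γ :=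
    if Γ ∈ L then (if W Γ then .top else .bot)
    else if IllegalBy L .bot Γ then .top else .bot
  prefixDetermined := hL
  wn_of_illegalBy p Γ h := by
    rw [if_neg (h.not_mem hL)]
    cases p with
    | bot => rw [if_pos h]; rfl
    | top =>
      rw [if_neg fun h' => absurd (h.unique h') (by decide)]
      rfl

theorem Player.neg_neg (p : Player) : p.neg.neg = p := by cases p <;> rfl

theorem Run.neg_neg (Γ : Run) : Γ.neg.neg = Γ := by
  apply Stream'.Seq.ext
  intro n
  simp only [Run.neg, Stream'.Seq.map_get?, Option.map_map]
  cases Γ.get? n <;> simp [Player.neg_neg]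

/-- Negation on positions. -/
def Position.neg (Φ : Position) : Position := Φ.map fun a => (a.1.neg, a.2)

theorem Run.neg_ofList (Φ : Position) : Run.neg (Φ : Run) = ((Position.neg Φ : Position) : Run) := by
  apply Stream'.Seq.ext
  intro n
  simp [Run.neg, Position.neg]

theorem Position.neg_neg (Φ : Position) : Position.neg (Position.neg Φ) = Φ := by
  simp [Position.neg, Function.comp_def, Player.neg_neg]

theorem IsInitial.neg {Φ : Position} {Γ : Run} (h : IsInitial Φ Γ) :
    IsInitial (Position.neg Φ) Γ.neg := by
  rw [isInitial_iff]
  intro i hi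
  rw [Position.neg, List.length_map] at hi
  simp [Run.neg, Position.neg, h.get? hi]

theorem PrefixDetermined.neg {L : Set Run} (hL : PrefixDetermined L) :
    PrefixDetermined {Γ | Γ.neg ∈ L} := by
  intro Γ
  simp only [Set.mem_ofPred_eq, Run.neg_ofList]
  constructor
  · intro h Φ h1 h2
    exact (hL _).1 h _ h1.neg (by simpa [Position.neg] using h2)
  · intro h
    refine (hL _).2 fun Ψ h1 h2 => ?_
    have h3 := h (Position.neg Ψ) (by simpa only [Run.neg_neg] using h1.neg)
      (by simpa [Position.neg] using h2)
    rwa [Position.neg_neg] at h3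

theorem IllegalBy.neg {L : Set Run} {p : Player} {Γ : Run}
    (h : IllegalBy {Γ | Γ.neg ∈ L} p Γ) : IllegalBy L p.neg Γ.neg := by
  obtain ⟨Φ, α, h1, h2, h3⟩ := h
  have e : Position.neg Φ ++ [(p.neg, α)] = Position.neg (Φ ++ [(p, α)]) := by simp [Position.neg]
  refine ⟨Position.neg Φ, α, ?_, ?_, ?_⟩
  · rw [e]
    exact h1.neg
  · intro Ψ hΨ
    have h4 : Position.neg Ψ <+: Φ := by
      have h5 := hΨ.map fun a : Labmove => (a.1.neg, a.2)
      have h6 : Position.neg Ψ <+: Position.neg (Position.neg Φ) := h5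
      rwa [Position.neg_neg] at h6
    have h7 : Run.neg ((Position.neg Ψ : Position) : Run) ∈ L := h2 _ h4
    rwa [Run.neg_ofList, Position.neg_neg] at h7
  · rw [e, ← Run.neg_ofList]
    exact h3

/-- Negation. -/
def Game.neg (A : Game) : Game where
  Lr := {Γ | Γ.neg ∈ A.Lr}
  Wn Γ := (A.Wn Γ.neg).neg
  prefixDetermined := A.prefixDetermined.neg
  wn_of_illegalBy p Γ h := by
    rw [A.wn_of_illegalBy _ _ h.neg, Player.neg_neg]

/-- The prefix `1.` or `2.` of the moves in the left or right component. -/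
def compPre : Bool → Move
  | false => [.one, .dot]
  | true => [.two, .dot]

/-- The legal runs of a parallel combination: every move is `i.α` for some `i ∈ {1, 2}`, and the
moves in either component form a legal run of it. -/
def parLr (A : Bool → Game) : Set Run :=
  {Γ | (∀ a ∈ Γ, ∃ i α, a.2 = compPre i ++ α) ∧ ∀ i, Γ.sub (compPre i) ∈ (A i).Lr}

theorem parLr_prefixDetermined (A : Bool → Game) : PrefixDetermined (parLr A) :=
  (prefixDetermined_forall_moves fun m => ∃ i α, m = compPre i ++ α).and
    (PrefixDetermined.inter fun i => (A i).prefixDetermined.filterMap _)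

/-- Parallel conjunction. -/
def Game.and (A B : Game) : Game :=
  Game.ofLegal (parLr fun i => if i then B else A) (parLr_prefixDetermined _) fun Γ =>
    A.Wn (Γ.sub (compPre false)) = .top ∧ B.Wn (Γ.sub (compPre true)) = .top

/-- Parallel disjunction. -/
def Game.or (A B : Game) : Game :=
  Game.ofLegal (parLr fun i => if i then B else A) (parLr_prefixDetermined _) fun Γ =>
    A.Wn (Γ.sub (compPre false)) = .top ∨ B.Wn (Γ.sub (compPre true)) = .top

/-- The legal runs of the simplified branching (co)recurrences: every move is `w.α` for some
finite bitstring `w`, and every thread is a legal run of `A`. -/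
def branchLr (A : Game) : Set Run :=
  {Γ | (∀ a ∈ Γ, ∃ w α, a.2 = addrMove w α) ∧ ∀ x : Bitstream, Γ.thread x ∈ A.Lr}

theorem branchLr_prefixDetermined (A : Game) : PrefixDetermined (branchLr A) :=
  (prefixDetermined_forall_moves fun m => ∃ w α, m = addrMove w α).and
    (PrefixDetermined.inter fun _ => A.prefixDetermined.filterMap _)

/-- Uncountable branching recurrence. -/
def Game.st (A : Game) : Game :=
  Game.ofLegal (branchLr A) (branchLr_prefixDetermined A) fun Γ =>
    ∀ x : Bitstream, A.Wn (Γ.thread x) = .top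

/-- Uncountable branching corecurrence. -/
def Game.cost (A : Game) : Game :=
  Game.ofLegal (branchLr A) (branchLr_prefixDetermined A) fun Γ =>
    ∃ x : Bitstream, A.Wn (Γ.thread x) = .top

/-- The new version of countable branching recurrence. -/
def Game.cstL (A : Game) : Game :=
  Game.ofLegal (branchLr A) (branchLr_prefixDetermined A) fun Γ =>
    ∀ v : Bitstream, EssFin v → A.Wn (Γ.thread v) = .top

/-- The new version of countable branching corecurrence. -/
def Game.ccostL (A : Game) : Game :=
  Game.ofLegal (branchLr A) (branchLr_prefixDetermined A) fun Γ =>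
    ∃ v : Bitstream, EssFin v ∧ A.Wn (Γ.thread v) = .top

/-- `w` is a node of the underlying BT-structure of the position `Φ`: it is empty, or it is `u0`
or `u1` for some `u` such that `Φ` contains the move `u:`. -/
def IsNode (Φ : Position) (w : List Bool) : Prop :=
  w = [] ∨ ∃ (u : List Bool) (b : Bool), w = u ++ [b] ∧ ∃ a ∈ Φ, a.2 = replMove u

/-- A leaf is a node that is not a proper prefix of any other node. -/
def IsLeaf (Φ : Position) (w : List Bool) : Prop :=
  IsNode Φ w ∧ ∀ w', IsNode Φ w' → w <+: w' → w' = w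

/-- The labmove `a` is legal in the position `Φ` of the old countable branching recurrence:
either it is a replicative move `w:` by the environment, where `w` is a leaf, or it is a move
`w.α` by either player, where `w` is a node and `α` is a legal move of that player in all the
threads that extend `w`. -/
def OldLegalMove (A : Game) (Φ : Position) (a : Labmove) : Prop :=
  (a.1 = .bot ∧ ∃ w, IsLeaf Φ w ∧ a.2 = replMove w) ∨
    ∃ w α, a.2 = addrMove w α ∧ IsNode Φ w ∧
      ∀ v : Bitstream, IsPre w v →
        ((Φ.filterMap (threadMap v) ++ [(a.1, α)] : Position) : Run) ∈ A.Lr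

/-- The old version of countable branching recurrence. -/
def Game.cstT (A : Game) : Game :=
  Game.ofLegal {Γ | ∀ Φ a, IsInitial (Φ ++ [a]) Γ → OldLegalMove A Φ a}
    (prefixDetermined_forall_steps _) fun Γ =>
      ∀ v : Bitstream, EssFin v → A.Wn (Γ.thread v) = .top

/-- The old version of countable branching corecurrence. -/
def Game.ccostT (A : Game) : Game := A.neg.cstT.neg

/-! ### Static games -/

/-- The labmove number `i` (counting from 0) of `Γ` is the `n`-th (counting from 1) labmove of the
player `p` in it. -/
def IsNthOf (Γ : Run) (p : Player) (n i : ℕ) : Prop :=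
  (∃ α, Γ.get? i = some (p, α)) ∧ ((Γ.take (i + 1)).filter fun a => a.1 = p).length = n

/-- In `Γ`, the `n`-th move of `p` is made later than the `k`-th move of the adversary. -/
def Later (Γ : Run) (p : Player) (n k : ℕ) : Prop :=
  ∃ i j, IsNthOf Γ p n i ∧ IsNthOf Γ p.neg k j ∧ j < i

/-- The subsequence of the labmoves of the player `q`. -/
def Run.movesOf (q : Player) (Γ : Run) : Run :=
  Γ.filterMap fun a => if a.1 = q then some a else none

/-- `Ω` is a `p`-delay of `Γ`. -/
def IsDelay (p : Player) (Ω Γ : Run) : Prop :=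
  (∀ q, Ω.movesOf q = Γ.movesOf q) ∧ ∀ n k, 1 ≤ n → 1 ≤ k → Later Γ p n k → Later Ω p n k

/-- Static games. -/
def Game.Static (A : Game) : Prop :=
  ∀ (p : Player) (Ω Γ : Run), IsDelay p Ω Γ →
    (¬ IllegalBy A.Lr p Γ → ¬ IllegalBy A.Lr p Ω) ∧ (A.Wn Γ = p → A.Wn Ω = p)

/-! ### Easy-play machines -/

/-- The symbols on the run tape: the labels of the players, and the keyboard symbols. -/
inductive RunSym where
  | label (p : Player)
  | key (c : Key)
  deriving DecidableEq, Fintype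

/-- The string that spells a position on the run tape: every move is preceded by its label. -/
def spell (Φ : Position) : List RunSym :=
  Φ.flatMap fun a => RunSym.label a.1 :: a.2.map RunSym.key

/-- What a machine can do in one clock cycle: write a symbol in the scanned cell of the work
tape, move the head of the work tape or of the run tape by one cell, make the move that is
spelled on the work tape, or grant permission to the environment. -/
inductive Instr (W : Type) where
  | write (a : W)
  | moveWork (d : Turing.Dir)
  | moveRun (d : Turing.Dir)
  | makeMove
  | grant

/-- An easy-play machine: a deterministic Turing machine with a read/write work tape and a
read-only run tape. The blank of the work tape is the default symbol. Some nonblank work tape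
symbols stand for keyboard symbols, as told by `key`. The transition function depends on the
state and the symbols scanned on the work tape and on the run tape (`none` is a blank). -/
structure EPM where
  State : Type
  Work : Type
  [finState : Finite State]
  [finWork : Finite Work]
  [blank : Inhabited Work]
  key : Work → Option Key
  key_blank : key default = none
  start : State
  trans : State → Work → Option RunSym → State × Instr Work

attribute [instance] EPM.finState EPM.finWork EPM.blank

namespace EPM

/-- A configuration: the state, the work tape with its head, the position spelled on the run
tape, and the location of the head of the run tape (the spelling starts in the cell 0). -/
structure Cfg (M : EPM) where
  state : M.State
  work : Turing.Tape M.Work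
  pos : Position
  runHead : ℤ

/-- The initial configuration: start state and empty tapes. -/
def init (M : EPM) : M.Cfg := ⟨M.start, default, [], 0⟩

/-- The symbol scanned on the run tape; `none` is a blank. -/
def Cfg.scanned {M : EPM} (C : M.Cfg) : Option RunSym :=
  if 0 ≤ C.runHead then (spell C.pos)[C.runHead.toNat]? else none

/-- The next state and the current instruction. -/
def Cfg.instr {M : EPM} (C : M.Cfg) : M.State × Instr M.Work :=
  M.trans C.state C.work.head C.scanned

/-- The keyboard symbols at the beginning of a string of work tape symbols. -/
def leading (M : EPM) : List M.Work → Move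
  | [] => []
  | a :: l => match M.key a with
    | some c => c :: leading M l
    | none => []

theorem leading_append_blank (M : EPM) (l : List M.Work) (n : ℕ) :
    M.leading (l ++ List.replicate n default) = M.leading l := by
  induction l with
  | nil => cases n <;> simp [leading, List.replicate_succ, M.key_blank]
  | cons a l ih =>
    simp only [List.cons_append, leading]
    cases M.key a <;> simp [ih]

/-- The move spelled on the work tape: the longest string of keyboard symbols that begins in the
scanned cell and extends to the right. -/
def spelledMove (M : EPM) (T : Turing.Tape M.Work) : Move :=
  T.right₀.liftOn M.leading fun a b h => by
    obtain ⟨n, rfl⟩ := h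
    exact (M.leading_append_blank a n).symm

/-- A move of a head on a two-way infinite tape. -/
def shift (h : ℤ) : Turing.Dir → ℤ
  | .left => h - 1
  | .right => h + 1

/-- The next configuration, where `e` is what the environment does if permission is granted:
make one move or none. -/
def Cfg.next {M : EPM} (C : M.Cfg) (e : Option Move) : M.Cfg :=
  match C.instr with
  | (q, .write a) => { C with state := q, work := C.work.write a }
  | (q, .moveWork d) => { C with state := q, work := C.work.move d }
  | (q, .moveRun d) => { C with state := q, runHead := shift C.runHead d }
  | (q, .makeMove) => { C with state := q, pos := C.pos ++ [(.top, M.spelledMove C.work)] }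
  | (q, .grant) => { C with
      state := q
      pos := C.pos ++ e.toList.map fun α => (Player.bot, α) }

/-- A computation branch. -/
def IsBranch (M : EPM) (B : ℕ → M.Cfg) : Prop :=
  B 0 = M.init ∧ ∀ n, ∃ e : Option Move, B (n + 1) = (B n).next e

/-- A branch is fair if permission is granted infinitely many times in it. -/
def Fair (M : EPM) (B : ℕ → M.Cfg) : Prop :=
  ∀ N, ∃ n ≥ N, (B n).instr.2 = .grant

/-- The run spelled by a branch. -/
def runOf (M : EPM) (B : ℕ → M.Cfg) : Run := limitRun fun n => (B n).pos

/-- The machine wins the game: the run spelled by any branch is won by the machine, and the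
branch is fair unless the environment made the run illegal. -/
def Wins (M : EPM) (A : Game) : Prop :=
  ∀ B, M.IsBranch B →
    A.Wn (M.runOf B) = .top ∧ (M.Fair B ∨ IllegalBy A.Lr .bot (M.runOf B))

end EPM

/-! ### Formulas -/

/-- Formulas over a set of atoms, with negation applied to atoms only. Both versions of countable
branching recurrence and corecurrence may occur. -/
inductive Formula (Atom : Type*) where
  | atom (P : Atom)
  | natom (P : Atom)
  | and (F G : Formula Atom)
  | or (F G : Formula Atom)
  | st (F : Formula Atom)
  | cost (F : Formula Atom)
  | cstT (F : Formula Atom)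
  | ccostT (F : Formula Atom)
  | cstL (F : Formula Atom)
  | ccostL (F : Formula Atom)

namespace Formula

universe u

variable {Atom : Type u}

/-- The negation of a formula, an abbreviation defined by duality. -/
def neg : Formula Atom → Formula Atom
  | atom P => natom P
  | natom P => atom P
  | and F G => or F.neg G.neg
  | or F G => and F.neg G.neg
  | st F => cost F.neg
  | cost F => st F.neg
  | cstT F => ccostT F.neg
  | ccostT F => cstT F.neg
  | cstL F => ccostL F.neg
  | ccostL F => cstL F.neg

/-- `F → G` abbreviates `¬F ∨ G`. -/
def imp (F G : Formula Atom) : Formula Atom := or F.neg G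

/-- The game that interprets a formula, given the games that interpret the atoms. -/
def interp (I : Atom → Game) : Formula Atom → Game
  | atom P => I P
  | natom P => (I P).neg
  | and F G => (F.interp I).and (G.interp I)
  | or F G => (F.interp I).or (G.interp I)
  | st F => (F.interp I).st
  | cost F => (F.interp I).cost
  | cstT F => (F.interp I).cstT
  | ccostT F => (F.interp I).ccostT
  | cstL F => (F.interp I).cstL
  | ccostL F => (F.interp I).ccostL

/-- A formula is uniformly valid if a single machine wins it under every interpretation of the
atoms as static games. -/
def UniformlyValid (F : Formula Atom) : Prop :=
  ∃ M : EPM, ∀ I : Atom → Game, (∀ P, (I P).Static) → M.Wins (F.interp I)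

end Formula

end CoL

end

/-! Negation of formulas is interpreted as negation of games (`Formula.interp_neg`), so it is enough
to exhibit, for each direction, one machine that wins the implication between the two recurrences of
an arbitrary game `A`. Both machines copy moves between antecedent and consequent so that each
essentially finite thread of the consequent proceeds exactly like some essentially finite thread of
the antecedent. By `wn_imp_limitRun` this decides the play in favour of the machine.

From the old recurrence to the new one, moves are copied with their addresses, and every thread
corresponds to itself. The only obstacle is that a move `w.α` is legal in the old recurrence only if
`w` is a node. The machine plays the environment's role in the antecedent, so it may replicate
there, and it splits leaves until `w` is a node. Replicative moves leave no trace in any thread, so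
the threads stay equal (`OldToNewInv`, `Tree.expand`).

From the new recurrence to the old one, the tree of the consequent is in the hands of the adversary,
whereas a move `w.α` in the antecedent may use an address longer than any node. So each leaf is
assigned an address in the antecedent, and all threads through that address imitate all threads
through the leaf. When `w.α` arrives, each address is prolonged by 0s until it extends `w` or is
incompatible with it; `α` is then made in the leaves of the first kind. Narrowing an address only
discards threads, so the imitation survives (`NewToOldInv`). When a leaf is split by a bit, that bit
is appended to its address. Along an essentially finite thread of the consequent the addresses
increase to an infinite bitstring, and since padding contributes no 1s, leaf and address always have
equally many of them (`Entry.count_addr`). Hence the limit is essentially finite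
(`exists_essFin_thread`).

The strategies must be carried out by Turing machines. They are programmed for a machine with three
stacks, which is compiled to an easy-play machine (`Rep.step`). Then `wins_of_invariant` reduces
winning to answering single legal moves while keeping an invariant. -/

noncomputable section

namespace CoL

/-! ### Stack machines -/

/-- The stacks of a stack machine. The stack `out` holds the move under construction. -/
inductive Reg where
  | out
  | tab
  | new
  deriving DecidableEq

instance : Fintype Reg := ⟨{.out, .tab, .new}, by rintro (_ | _ | _) <;> simp⟩

/-- Stack symbols: the keyboard symbols, and a padding symbol that is spelled as 0. -/
inductive Sym where
  | key (c : Key)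
  | pad
  deriving DecidableEq, Fintype

def Sym.toKey : Sym → Key
  | .key c => c
  | .pad => .zero

/-- The contents of the three stacks, top first. -/
structure Regs where
  out : List Sym
  tab : List Sym
  new : List Sym

def Regs.get (R : Regs) : Reg → List Sym
  | .out => R.out
  | .tab => R.tab
  | .new => R.new

def Regs.set (R : Regs) : Reg → List Sym → Regs
  | .out, s => { R with out := s }
  | .tab, s => { R with tab := s }
  | .new, s => { R with new := s }

theorem Regs.get_set (R : Regs) (k j : Reg) (s : List Sym) :
    (R.set k s).get j = if j = k then s else R.get j := by
  cases k <;> cases j <;> rfl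

/-- What a stack machine can do in one step. -/
inductive StackOp (S : Type) where
  | push (k : Reg) (a : Sym) (s : S)
  | pop (k : Reg) (f : Option Sym → S)
  | run (d : Turing.Dir) (s : S)
  | emit (s : S)
  | jump (s : S)
  | grant (s : S)

/-- A machine with three stacks and a read-only run tape. -/
structure StackMachine where
  State : Type
  [finState : Finite State]
  start : State
  op : State → Option RunSym → StackOp State

attribute [instance] StackMachine.finState

namespace StackMachine

/-- A configuration; `left` is the part of the run tape to the left of its head, in reverse. -/
structure Cfg (M : StackMachine) where
  state : M.State
  regs : Regs
  left : List RunSym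
  right : List RunSym
  pos : Position

variable {M : StackMachine}

/-- The labmove made by emitting the stack `out`. -/
def emitted (o : List Sym) : Labmove := (.top, o.reverse.map Sym.toKey)

/-- A step other than granting permission. -/
def Cfg.step (c : M.Cfg) : Option M.Cfg :=
  match M.op c.state c.right.head? with
  | .push k a s => some { c with state := s, regs := c.regs.set k (a :: c.regs.get k) }
  | .pop k f => some { c with
      state := f (c.regs.get k).head?
      regs := c.regs.set k (c.regs.get k).tail }
  -- Stepping off the spelled part of the run tape counts as a crash, so that `left` and `right`
  -- always recombine to the spelling of the position.
  | .run .left s => match c.left with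
    | [] => none
    | a :: l => some { c with state := s, left := l, right := a :: c.right }
  | .run .right s => match c.right with
    | [] => none
    | a :: r => some { c with state := s, left := a :: c.left, right := r }
  | .emit s => some { c with
      state := s
      right := c.right ++ spell [emitted c.regs.out]
      pos := c.pos ++ [emitted c.regs.out] }
  | .jump s => some { c with state := s }
  | .grant _ => none

/-- The configuration after permission was granted and the environment did `e`. -/
def Cfg.grantNext (c : M.Cfg) (s : M.State) (e : Option Move) : M.Cfg :=
  { c with
    state := s
    right := c.right ++ spell (e.toList.map fun α => (Player.bot, α))
    pos := c.pos ++ e.toList.map fun α => (Player.bot, α) }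

/-- Since `step` is undefined at a grant, this is the deterministic part of a play, between two
interactions with the environment. -/
def Reaches (c c' : M.Cfg) : Prop := Relation.ReflTransGen (fun a b => a.step = some b) c c'

theorem Reaches.trans {a b c : M.Cfg} (h : Reaches a b) (h' : Reaches b c) : Reaches a c :=
  Relation.ReflTransGen.trans h h'

theorem Reaches.refl (a : M.Cfg) : Reaches a a := Relation.ReflTransGen.refl

def init (M : StackMachine) : M.Cfg := ⟨M.start, ⟨[], [], []⟩, [], [], []⟩

/-! ### Compilation to easy-play machines

The stacks are the tracks of the work tape, with their bottoms in the cell 0, where the head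
rests between the steps. -/

/-- The states of the compiled machine. -/
inductive EState (S : Type) where
  | main (s : S)
  | seek (k : Reg) (a : Sym) (s : S)
  | back (k : Reg) (s : S)
  | home (k : Reg) (s : S)
  | probe (k : Reg) (f : Option Sym → S)
  | top (k : Reg) (f : Option Sym → S)
  | take (k : Reg) (f : Option Sym → S)

/-- The states carry the whole continuation of a pop; there are only finitely many functions from
`Option Sym` to a finite type. -/
instance (S : Type) [Finite S] : Finite (EState S) := by
  let g : (S ⊕ (Reg × Sym × S)) ⊕ (Bool × Reg × S) ⊕ (Option Bool × Reg × (Option Sym → S)) →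
      EState S
    | .inl (.inl s) => .main s
    | .inl (.inr (k, a, s)) => .seek k a s
    | .inr (.inl (false, k, s)) => .back k s
    | .inr (.inl (true, k, s)) => .home k s
    | .inr (.inr (none, k, f)) => .probe k f
    | .inr (.inr (some false, k, f)) => .top k f
    | .inr (.inr (some true, k, f)) => .take k f
  refine Finite.of_surjective g ?_
  rintro (s | ⟨k, a, s⟩ | ⟨k, s⟩ | ⟨k, s⟩ | ⟨k, f⟩ | ⟨k, f⟩ | ⟨k, f⟩)
  · exact ⟨.inl (.inl s), rfl⟩
  · exact ⟨.inl (.inr (k, a, s)), rfl⟩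
  · exact ⟨.inr (.inl (false, k, s)), rfl⟩
  · exact ⟨.inr (.inl (true, k, s)), rfl⟩
  · exact ⟨.inr (.inr (none, k, f)), rfl⟩
  · exact ⟨.inr (.inr (some false, k, f)), rfl⟩
  · exact ⟨.inr (.inr (some true, k, f)), rfl⟩

/-- A cell of the work tape of the compiled machine. -/
abbrev Cell := Reg → Option Sym

/-- The blank is empty on all tracks, so a blank tape represents three empty stacks and spells the
empty move. -/
instance : Inhabited Cell := ⟨fun _ => none⟩

/-- The transition function of the compiled machine. -/
def etrans (M : StackMachine) :
    EState M.State → Cell → Option RunSym → EState M.State × Instr Cell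
  | .main s, w, r => match M.op s r with
    -- Each clock cycle carries an instruction; rewriting the scanned symbol serves as the idle one.
    | .push k a s' => (.seek k a s', .write w)
    | .pop k f => (.probe k f, .write w)
    | .run d s' => (.main s', .moveRun d)
    | .emit s' => (.main s', .makeMove)
    | .jump s' => (.main s', .write w)
    | .grant s' => (.main s', .grant)
  | .seek k a s, w, _ => match w k with
    | some _ => (.seek k a s, .moveWork .right)
    | none => (.back k s, .write (Function.update w k (some a)))
  -- The cell just changed is full after a push and empty after a pop, so it is left untested; only
  -- the cells below it guide the walk to the bottom.
  | .back k s, _, _ => (.home k s, .moveWork .left)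
  | .home k s, w, _ => match w k with
    | some _ => (.home k s, .moveWork .left)
    | none => (.main s, .moveWork .right)
  | .probe k f, w, _ => match w k with
    | some _ => (.top k f, .moveWork .right)
    | none => (.main (f none), .write w)
  | .top k f, w, _ => match w k with
    | some _ => (.top k f, .moveWork .right)
    | none => (.take k f, .moveWork .left)
  | .take k f, w, _ => (.back k (f (w k)), .write (Function.update w k none))

/-- The compiled machine. -/
def toEPM (M : StackMachine) : EPM where
  State := EState M.State
  Work := Cell
  key w := (w .out).map Sym.toKey
  key_blank := rfl
  start := .main M.start
  trans := M.etrans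

end StackMachine

/-- Steps of an easy-play machine other than granting permission. -/
def EPM.Reaches (M : EPM) (C C' : M.Cfg) : Prop :=
  Relation.ReflTransGen (fun a b => a.instr.2 ≠ .grant ∧ b = a.next none) C C'

theorem EPM.Cfg.next_eq_of_ne_grant {M : EPM} {C : M.Cfg} (h : C.instr.2 ≠ .grant)
    (e : Option Move) : C.next e = C.next none := by
  unfold EPM.Cfg.next
  rcases hC : C.instr with ⟨q, _ | _ | _ | _ | _⟩ <;> simp_all

/-- The environment influences a branch only where permission is granted, so a branch must follow
any chain of other steps. -/
theorem EPM.Reaches.exists_index {M : EPM} {B : ℕ → M.Cfg} (hB : M.IsBranch B) {C' : M.Cfg} {n : ℕ}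
    (h : M.Reaches (B n) C') : ∃ m ≥ n, B m = C' := by
  induction h with
  | refl => exact ⟨n, le_rfl, rfl⟩
  | tail _ h ih =>
    obtain ⟨m, hm, rfl⟩ := ih
    obtain ⟨e, he⟩ := hB.2 m
    exact ⟨m + 1, by omega, by rw [he, EPM.Cfg.next_eq_of_ne_grant h.1, h.2]⟩

namespace StackMachine

variable {M : StackMachine}

/-- The tape `T` has the contents `W` and its head is in the cell `h`. -/
def TapeAt (T : Turing.Tape Cell) (W : ℤ → Cell) (h : ℤ) : Prop := ∀ i, T.nth i = W (h + i)

theorem TapeAt.head {T : Turing.Tape Cell} {W : ℤ → Cell} {h : ℤ} (H : TapeAt T W h) :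
    T.head = W h := by
  simpa using H 0

theorem TapeAt.moveRight {T : Turing.Tape Cell} {W : ℤ → Cell} {h : ℤ} (H : TapeAt T W h) :
    TapeAt (T.move .right) W (h + 1) := fun i => by
  rw [Turing.Tape.move_right_nth, H, add_assoc, add_comm 1 i]

theorem TapeAt.moveLeft {T : Turing.Tape Cell} {W : ℤ → Cell} {h : ℤ} (H : TapeAt T W h) :
    TapeAt (T.move .left) W (h - 1) := fun i => by
  rw [Turing.Tape.move_left_nth, H]
  congr 1
  ring

theorem TapeAt.write {T : Turing.Tape Cell} {W : ℤ → Cell} {h : ℤ} (H : TapeAt T W h) (a : Cell) :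
    TapeAt (T.write a) (Function.update W h a) h := fun i => by
  rw [Turing.Tape.write_nth, H]
  by_cases hi : i = 0
  · simp [hi]
  · simp [hi, Function.update_of_ne]

/-- The contents of the work tape when the stacks hold `R`. -/
def cells (R : Regs) (i : ℤ) : Cell := fun k =>
  if 0 ≤ i then (R.get k).reverse[i.toNat]? else none

/-- The bottom of a stack lies in cell 0, so a push changes only the first empty cell of its track.
-/
theorem cells_push (R : Regs) (k : Reg) (a : Sym) :
    Function.update (cells R) (R.get k).length
      (Function.update (cells R (R.get k).length) k (some a)) =
    cells (R.set k (a :: R.get k)) := by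
  funext i j
  by_cases hi : i = ((R.get k).length : ℤ)
  · subst hi
    rw [Function.update_self]
    by_cases hj : j = k
    · subst hj
      simp [cells, Regs.get_set]
    · simp [cells, Regs.get_set, hj]
  · rw [Function.update_of_ne hi]
    by_cases hj : j = k
    · subst hj
      simp only [cells, Regs.get_set, if_true, List.reverse_cons]
      split_ifs with h0
      · rcases lt_or_ge i.toNat (R.get j).length with h | h
        · rw [List.getElem?_append_left (by simpa using h)]
        · rw [List.getElem?_eq_none (by simpa using h), List.getElem?_eq_none]
          simp only [List.length_append, List.length_reverse, List.length_singleton]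
          omega
      · rfl
    · simp [cells, Regs.get_set, hj]

theorem cells_pop (R : Regs) (k : Reg) (a : Sym) (s : List Sym) (h : R.get k = a :: s) :
    Function.update (cells R) s.length (Function.update (cells R s.length) k none) =
    cells (R.set k s) := by
  funext i j
  by_cases hi : i = (s.length : ℤ)
  · subst hi
    rw [Function.update_self]
    by_cases hj : j = k
    · subst hj
      simp [cells, Regs.get_set]
    · simp [cells, Regs.get_set, hj]
  · rw [Function.update_of_ne hi]
    by_cases hj : j = k
    · subst hj
      simp only [cells, Regs.get_set, if_true, h, List.reverse_cons]
      split_ifs with h0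
      · rcases lt_or_ge i.toNat s.length with h | h
        · rw [List.getElem?_append_left (by simpa using h)]
        · rw [List.getElem?_eq_none (l := s.reverse) (by simpa using h), List.getElem?_eq_none]
          simp only [List.length_append, List.length_reverse, List.length_singleton]
          omega
      · rfl
    · simp [cells, Regs.get_set, hj]

theorem cells_isSome {R : Regs} {k : Reg} {n : ℕ} (h : n < (R.get k).length) :
    ∃ a, cells R n k = some a := by
  refine ⟨(R.get k).reverse[n]'(by simpa using h), ?_⟩
  simp [cells, h]

theorem cells_length (R : Regs) (k : Reg) : cells R (R.get k).length k = none := by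
  simp [cells]

/-- The blank to the left of cell 0 is the sentinel that stops the head on its way back. -/
theorem cells_neg (R : Regs) (k : Reg) : cells R (-1) k = none := by
  simp [cells]

/-! #### Routines of the compiled machine -/

/-- A configuration of the compiled machine. -/
def ecfg (M : StackMachine) (q : EState M.State) (T : Turing.Tape Cell) (p : Position) (r : ℤ) :
    M.toEPM.Cfg := ⟨q, T, p, r⟩

section Routines

variable {p : Position} {r : ℤ}

theorem reaches_of_move {q q' : EState M.State} {T : Turing.Tape Cell} {d : Turing.Dir}
    (h : ∀ x, M.etrans q T.head x = (q', .moveWork d)) :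
    M.toEPM.Reaches (M.ecfg q T p r) (M.ecfg q' (T.move d) p r) := by
  have hi : (M.ecfg q T p r).instr = (q', .moveWork d) := h _
  refine Relation.ReflTransGen.single ⟨by rw [hi]; exact nofun, ?_⟩
  unfold EPM.Cfg.next
  rw [hi]
  rfl

theorem reaches_of_write {q q' : EState M.State} {T : Turing.Tape Cell} {a : Cell}
    (h : ∀ x, M.etrans q T.head x = (q', .write a)) :
    M.toEPM.Reaches (M.ecfg q T p r) (M.ecfg q' (T.write a) p r) := by
  have hi : (M.ecfg q T p r).instr = (q', .write a) := h _
  refine Relation.ReflTransGen.single ⟨by rw [hi]; exact nofun, ?_⟩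
  unfold EPM.Cfg.next
  rw [hi]
  rfl

/-- Starting in cell `n - 1` makes the base case the sentinel in cell -1, from which one step to the
right ends in cell 0. -/
theorem reaches_home (k : Reg) (s : M.State) (W : ℤ → Cell) (n : ℕ) :
    ∀ T : Turing.Tape Cell, TapeAt T W (n - 1) → W (-1) k = none →
      (∀ i : ℕ, i < n → ∃ a, W i k = some a) →
      ∃ T', TapeAt T' W 0 ∧ M.toEPM.Reaches (M.ecfg (.home k s) T p r) (M.ecfg (.main s) T' p r) := by
  induction n with
  | zero =>
    intro T hT h0 _
    have hh : T.head k = none := by rw [hT.head]; simpa using h0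
    exact ⟨T.move .right, by simpa using hT.moveRight, reaches_of_move fun x => by simp [etrans, hh]⟩
  | succ n ih =>
    intro T hT h0 hn
    obtain ⟨a, ha⟩ := hn n (by omega)
    have hh : T.head k = some a := by rw [hT.head]; simpa using ha
    obtain ⟨T', h1, h2⟩ := ih (T.move .left) (by simpa using hT.moveLeft) h0
      fun i hi => hn i (by omega)
    exact ⟨T', h1, (reaches_of_move fun x => by simp [etrans, hh]).trans h2⟩

/-- Only the cells below the current one are assumed to be full, so this serves both after a push
and after a pop. -/
theorem reaches_back (k : Reg) (s : M.State) (W : ℤ → Cell) (n : ℕ)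
    (T : Turing.Tape Cell) (hT : TapeAt T W n) (h0 : W (-1) k = none)
    (hn : ∀ i : ℕ, i < n → ∃ a, W i k = some a) :
    ∃ T', TapeAt T' W 0 ∧ M.toEPM.Reaches (M.ecfg (.back k s) T p r) (M.ecfg (.main s) T' p r) := by
  obtain ⟨T', h1, h2⟩ := reaches_home (p := p) (r := r) k s W n _ hT.moveLeft h0 hn
  exact ⟨T', h1, (reaches_of_move fun x => by simp [etrans]).trans h2⟩

/-- The induction is on the distance from the head to the first empty cell of the track. -/
theorem reaches_seek (R : Regs) (k : Reg) (a : Sym) (s : M.State) (n : ℕ) :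
    ∀ (m : ℕ) (T : Turing.Tape Cell), m + n = (R.get k).length → TapeAt T (cells R) m →
      ∃ T', TapeAt T' (cells (R.set k (a :: R.get k))) 0 ∧
        M.toEPM.Reaches (M.ecfg (.seek k a s) T p r) (M.ecfg (.main s) T' p r) := by
  induction n with
  | zero =>
    intro m T hm hT
    obtain rfl : m = (R.get k).length := by omega
    have hh : T.head k = none := by rw [hT.head]; exact cells_length R k
    have hw := hT.write (Function.update T.head k (some a))
    rw [hT.head, cells_push, ← hT.head] at hw
    obtain ⟨T', h1, h2⟩ := reaches_back (M := M) (p := p) (r := r) k s _ _ _ hw (cells_neg _ k)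
      (fun i hi => cells_isSome (by rw [Regs.get_set, if_pos rfl, List.length_cons]; omega))
    exact ⟨T', h1, (reaches_of_write fun x => by simp [etrans, hh]).trans h2⟩
  | succ n ih =>
    intro m T hm hT
    obtain ⟨b, hb⟩ := cells_isSome (R := R) (k := k) (n := m) (by omega)
    have hh : T.head k = some b := by rw [hT.head]; exact hb
    obtain ⟨T', h1, h2⟩ := ih (m + 1) (T.move .right) (by omega) (by exact_mod_cast hT.moveRight)
    exact ⟨T', h1, (reaches_of_move fun x => by simp [etrans, hh]).trans h2⟩

theorem reaches_top (R : Regs) (k : Reg) (f : Option Sym → M.State) (b : Sym) (l : List Sym)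
    (hb : R.get k = b :: l) (n : ℕ) :
    ∀ (m : ℕ) (T : Turing.Tape Cell), m + n = (R.get k).length → TapeAt T (cells R) m →
      ∃ T', TapeAt T' (cells (R.set k l)) 0 ∧
        M.toEPM.Reaches (M.ecfg (.top k f) T p r) (M.ecfg (.main (f (some b))) T' p r) := by
  induction n with
  | zero =>
    intro m T hm hT
    obtain rfl : m = (R.get k).length := by omega
    have hh : T.head k = none := by rw [hT.head]; exact cells_length R k
    have hT1 : TapeAt (T.move .left) (cells R) l.length := by
      have := hT.moveLeft
      rw [hb, List.length_cons] at this
      simpa using this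
    have hh1 : (T.move .left).head k = some b := by
      rw [hT1.head]
      simp [cells, hb]
    have hw := hT1.write (Function.update (T.move .left).head k none)
    rw [hT1.head, cells_pop R k b l hb, ← hT1.head] at hw
    obtain ⟨T', h1, h2⟩ := reaches_back (M := M) (p := p) (r := r) k (f (some b)) _ _ _ hw
      (cells_neg _ k)
      (fun i hi => cells_isSome (by rw [Regs.get_set, if_pos rfl]; omega))
    exact ⟨T', h1, ((reaches_of_move fun x => by simp [etrans, hh]; rfl).trans
      (reaches_of_write fun x => by rw [← hh1, etrans])).trans h2⟩
  | succ n ih =>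
    intro m T hm hT
    obtain ⟨c, hc⟩ := cells_isSome (R := R) (k := k) (n := m) (by omega)
    have hh : T.head k = some c := by rw [hT.head]; exact hc
    obtain ⟨T', h1, h2⟩ := ih (m + 1) (T.move .right) (by omega) (by exact_mod_cast hT.moveRight)
    exact ⟨T', h1, (reaches_of_move fun x => by simp [etrans, hh]).trans h2⟩

/-- An empty stack has to be recognized in cell 0: for a nonempty one, the top is found by
overshooting to the first empty cell and stepping back. -/
theorem reaches_probe (R : Regs) (k : Reg) (f : Option Sym → M.State) (T : Turing.Tape Cell)
    (hT : TapeAt T (cells R) 0) :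
    ∃ T', TapeAt T' (cells (R.set k (R.get k).tail)) 0 ∧
      M.toEPM.Reaches (M.ecfg (.probe k f) T p r) (M.ecfg (.main (f (R.get k).head?)) T' p r) := by
  rcases hb : R.get k with _ | ⟨b, l⟩
  · have hh : T.head k = none := by
      rw [hT.head]
      simp [cells, hb]
    have hR : R.set k [] = R := by cases k <;> cases R <;> simp_all [Regs.get, Regs.set]
    refine ⟨T, by simpa [hR] using hT, ?_⟩
    have h := reaches_of_write (M := M) (p := p) (r := r) (q := .probe k f) (T := T)
      (q' := .main (f none)) (a := T.head) fun x => by simp [etrans, hh]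
    rwa [Turing.Tape.write_self] at h
  · obtain ⟨c, hc⟩ := cells_isSome (R := R) (k := k) (n := 0) (by simp [hb])
    have hh : T.head k = some c := by rw [hT.head]; exact hc
    obtain ⟨T', h1, h2⟩ := reaches_top (M := M) (p := p) (r := r) R k f b l hb l.length 1 (T.move .right)
      (by rw [hb, List.length_cons, add_comm]) (by exact_mod_cast hT.moveRight)
    exact ⟨T', h1, (reaches_of_move fun x => by simp [etrans, hh]).trans h2⟩

end Routines

/-! ### Reading a move off the work tape -/

theorem leading_of_nth (E : EPM) (m : Move) :
    ∀ L : List E.Work, (∀ i, (h : i < m.length) → E.key (L.getI i) = some m[i]) →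
      E.key (L.getI m.length) = none → E.leading L = m := by
  induction m with
  | nil =>
    intro L _ h
    cases L with
    | nil => rfl
    | cons a L =>
      have h' : E.key a = none := h
      simp [EPM.leading, h']
  | cons c m ih =>
    intro L h h'
    cases L with
    | nil =>
      have h0 := h 0 (by simp)
      have h1 : E.key default = some c := h0
      rw [E.key_blank] at h1
      exact absurd h1 (by simp)
    | cons a L =>
      have h0 : E.key a = some c := h 0 (by simp)
      simp only [EPM.leading, h0, List.cons.injEq, true_and]
      exact ih L (fun i hi => h (i + 1) (by simpa using hi)) h'

/-- The right half of a tape is a list only up to trailing blanks, so the spelled move is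
characterized by individual cells: keyboard symbols along its length, then a cell that holds none.
-/
theorem spelledMove_of_nth (E : EPM) (T : Turing.Tape E.Work) (m : Move)
    (h : ∀ i : ℕ, (h : i < m.length) → E.key (T.nth i) = some m[i])
    (h' : E.key (T.nth m.length) = none) : E.spelledMove T = m := by
  unfold EPM.spelledMove
  simp only [← Turing.Tape.right₀_nth] at h h'
  generalize T.right₀ = L at h h'
  induction L using Turing.ListBlank.induction_on with
  | _ L => exact leading_of_nth E m L h h'

theorem spelledMove_cells (R : Regs) (T : Turing.Tape Cell) (hT : TapeAt T (cells R) 0) :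
    M.toEPM.spelledMove T = (emitted R.out).2 := by
  refine spelledMove_of_nth M.toEPM T _ (fun i hi => ?_) ?_
  · have hi' : i < R.out.length := by simpa [emitted] using hi
    have h : T.nth i = cells R i := by simpa using hT i
    change Option.map Sym.toKey (T.nth i .out) = _
    rw [h]
    simp [cells, Regs.get, emitted, hi']
  · have h : T.nth ((emitted R.out).2.length : ℕ) = cells R R.out.length := by
      simpa [emitted] using hT R.out.length
    change Option.map Sym.toKey (T.nth _ .out) = _
    rw [h]
    simp [cells, Regs.get]

/-! ### Simulation of a stack machine -/

/-- The configuration `C` of the compiled machine represents the configuration `c`. -/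
def Rep (C : M.toEPM.Cfg) (c : M.Cfg) : Prop :=
  ∃ T, TapeAt T (cells c.regs) 0 ∧ C = M.ecfg (.main c.state) T c.pos c.left.length ∧
    spell c.pos = c.left.reverse ++ c.right

theorem scanned_ecfg {q : EState M.State} {T : Turing.Tape Cell} {p : Position}
    {l r : List RunSym} (h : spell p = l.reverse ++ r) :
    (M.ecfg q T p l.length).scanned = r.head? := by
  change (if (0 : ℤ) ≤ (l.length : ℤ) then (spell p)[(l.length : ℤ).toNat]? else none) = _
  rw [if_pos (by positivity), h, Int.toNat_natCast, List.getElem?_append_right (by simp)]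
  cases r <;> simp

theorem spell_append (Φ Ψ : Position) : spell (Φ ++ Ψ) = spell Φ ++ spell Ψ := by
  simp [spell]

/-- Pushes and pops become walks of the work head that end in cell 0 again; every other step is a
single instruction. No permission is granted on the way, so the position changes only by what the
stack machine emits. -/
theorem Rep.step {C : M.toEPM.Cfg} {c c' : M.Cfg} (h : Rep C c) (hc : c.step = some c') :
    ∃ C', M.toEPM.Reaches C C' ∧ Rep C' c' := by
  obtain ⟨T, hT, rfl, hs⟩ := h
  have hsc := scanned_ecfg (M := M) (q := .main c.state) (T := T) hs
  have hi : (M.ecfg (.main c.state) T c.pos c.left.length).instr =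
      M.etrans (.main c.state) T.head c.right.head? := by
    rw [← hsc]
    rfl
  have single : ∀ (q : EState M.State) (i : Instr Cell),
      M.etrans (.main c.state) T.head c.right.head? = (q, i) → i ≠ .grant →
      M.toEPM.Reaches (M.ecfg (.main c.state) T c.pos c.left.length)
        ((M.ecfg (.main c.state) T c.pos c.left.length).next none) := fun q i h h' =>
    Relation.ReflTransGen.single ⟨by rw [hi, h]; exact h', rfl⟩
  unfold Cfg.step at hc
  rcases ho : M.op c.state c.right.head? with ⟨k, a, s⟩ | ⟨k, f⟩ | ⟨d, s⟩ | s | s | s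
  all_goals rw [ho] at hc
  · have he : M.etrans (.main c.state) T.head c.right.head? = (.seek k a s, .write T.head) := by
      simp [etrans, ho]
    have h1 := single _ _ he nofun
    unfold EPM.Cfg.next at h1
    rw [hi, he] at h1
    have h1' : M.toEPM.Reaches (M.ecfg (.main c.state) T c.pos c.left.length)
      (M.ecfg (.seek k a s) (T.write T.head) c.pos c.left.length) := h1
    rw [Turing.Tape.write_self] at h1'
    obtain ⟨T', h2, h3⟩ := reaches_seek (M := M) (p := c.pos) (r := c.left.length) c.regs k a s
      (c.regs.get k).length 0 T (by simp) (by simpa using hT)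
    simp only [Option.some.injEq] at hc
    subst hc
    exact ⟨_, h1'.trans h3, T', h2, rfl, hs⟩
  · have he : M.etrans (.main c.state) T.head c.right.head? = (.probe k f, .write T.head) := by
      simp [etrans, ho]
    have h1 := single _ _ he nofun
    unfold EPM.Cfg.next at h1
    rw [hi, he] at h1
    have h1' : M.toEPM.Reaches (M.ecfg (.main c.state) T c.pos c.left.length)
      (M.ecfg (.probe k f) (T.write T.head) c.pos c.left.length) := h1
    rw [Turing.Tape.write_self] at h1'
    obtain ⟨T', h2, h3⟩ := reaches_probe (M := M) (p := c.pos) (r := c.left.length) c.regs k f T hT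
    simp only [Option.some.injEq] at hc
    subst hc
    exact ⟨_, h1'.trans h3, T', h2, rfl, hs⟩
  · have he : M.etrans (.main c.state) T.head c.right.head? = (.main s, .moveRun d) := by
      simp [etrans, ho]
    have h1 := single _ _ he nofun
    unfold EPM.Cfg.next at h1
    rw [hi, he] at h1
    refine ⟨_, h1, ?_⟩
    cases d with
    | left =>
      rcases hl : c.left with _ | ⟨a, l⟩
      · simp [hl] at hc
      · simp only [hl, Option.some.injEq] at hc
        subst hc
        refine ⟨T, hT, ?_, by simpa [hl] using hs⟩
        simp [ecfg, EPM.shift]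
    | right =>
      rcases hr : c.right with _ | ⟨a, r⟩
      · simp [hr] at hc
      · simp only [hr, Option.some.injEq] at hc
        subst hc
        refine ⟨T, hT, ?_, by simpa [hr] using hs⟩
        simp [ecfg, EPM.shift]
  · have he : M.etrans (.main c.state) T.head c.right.head? = (.main s, .makeMove) := by
      simp [etrans, ho]
    have h1 := single _ _ he nofun
    unfold EPM.Cfg.next at h1
    rw [hi, he] at h1
    refine ⟨_, h1, ?_⟩
    simp only [Option.some.injEq] at hc
    subst hc
    refine ⟨T, hT, ?_, by simp [spell_append, hs]⟩
    have hm := spelledMove_cells (M := M) _ T hT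
    change M.ecfg (.main s) T (c.pos ++ [(.top, M.toEPM.spelledMove T)]) _ = _
    rw [hm]
    rfl
  · have he : M.etrans (.main c.state) T.head c.right.head? = (.main s, .write T.head) := by
      simp [etrans, ho]
    have h1 := single _ _ he nofun
    unfold EPM.Cfg.next at h1
    rw [hi, he] at h1
    have h1' : M.toEPM.Reaches (M.ecfg (.main c.state) T c.pos c.left.length)
      (M.ecfg (.main s) (T.write T.head) c.pos c.left.length) := h1
    rw [Turing.Tape.write_self] at h1'
    simp only [Option.some.injEq] at hc
    subst hc
    exact ⟨_, h1', T, hT, rfl, hs⟩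
  · simp at hc

theorem Rep.reaches {C : M.toEPM.Cfg} {c c' : M.Cfg} (h : Rep C c) (hc : Reaches c c') :
    ∃ C', M.toEPM.Reaches C C' ∧ Rep C' c' := by
  induction hc with
  | refl => exact ⟨C, .refl, h⟩
  | tail _ h' ih =>
    obtain ⟨C', h1, h2⟩ := ih
    obtain ⟨C'', h3, h4⟩ := h2.step h'
    exact ⟨C'', h1.trans h3, h4⟩

/-- A grant is one instruction on both sides, so the representation persists whatever the
environment does. -/
theorem Rep.grant {C : M.toEPM.Cfg} {c : M.Cfg} {s : M.State} (h : Rep C c)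
    (hc : M.op c.state c.right.head? = .grant s) :
    C.instr.2 = .grant ∧ ∀ e, Rep (C.next e) (c.grantNext s e) := by
  obtain ⟨T, hT, rfl, hs⟩ := h
  have hi : (M.ecfg (.main c.state) T c.pos c.left.length).instr = (.main s, .grant) := by
    have hsc := scanned_ecfg (M := M) (q := .main c.state) (T := T) hs
    have : (M.ecfg (.main c.state) T c.pos c.left.length).instr =
        M.etrans (.main c.state) T.head c.right.head? := by
      rw [← hsc]
      rfl
    rw [this]
    simp [etrans, hc]
    rfl
  refine ⟨by rw [hi], fun e => ?_⟩
  unfold EPM.Cfg.next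
  rw [hi]
  exact ⟨T, hT, rfl, by simp [Cfg.grantNext, spell_append, hs]⟩

theorem rep_init (M : StackMachine) : Rep M.toEPM.init M.init := by
  refine ⟨default, fun i => ?_, rfl, rfl⟩
  have h : ∀ i : ℤ, cells M.init.regs i = fun _ => none := fun i => by
    funext k
    cases k <;> simp [cells, init, Regs.get]
  rw [h]
  rcases i with (_ | i) | i
  · rfl
  · change (default : Turing.ListBlank Cell).nth i = _
    cases i <;> rfl
  · change (default : Turing.ListBlank Cell).nth i = _
    cases i <;> rfl

end StackMachine

/-! ### A sufficient condition for winning -/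

/-- Mutually cofinal increasing sequences have the same limit; this allows a run to be computed from
selected moments of a branch only. -/
theorem limitRun_ext {P Q : ℕ → Position} (hP : ∀ m n, m ≤ n → P m <+: P n)
    (hQ : ∀ m n, m ≤ n → Q m <+: Q n) (h : ∀ n, ∃ m, P n <+: Q m) (h' : ∀ n, ∃ m, Q n <+: P m) :
    limitRun P = limitRun Q := by
  have key : ∀ {P Q : ℕ → Position}, (∀ m n, m ≤ n → P m <+: P n) →
      (∀ m n, m ≤ n → Q m <+: Q n) → (∀ n, ∃ m, P n <+: Q m) → ∀ k n, k < (P n).length →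
      (limitRun P).get? k = (limitRun Q).get? k := by
    intro P Q hP hQ h k n hk
    obtain ⟨m, hm⟩ := h n
    rw [limitRun_get? hP hk, limitRun_get? hQ (lt_of_lt_of_le hk hm.length_le),
      List.prefix_iff_getElem?.1 hm k hk, List.getElem?_eq_getElem hk]
  apply Stream'.Seq.ext
  intro k
  by_cases h1 : ∃ n, k < (P n).length
  · exact key hP hQ h k _ h1.choose_spec
  · by_cases h2 : ∃ n, k < (Q n).length
    · exact (key hQ hP h' k _ h2.choose_spec).symm
    · push Not at h1 h2
      rw [limitRun_get?_none h1, limitRun_get?_none h2]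

theorem EPM.Cfg.pos_prefix_next {M : EPM} (C : M.Cfg) (e : Option Move) :
    C.pos <+: (C.next e).pos := by
  unfold EPM.Cfg.next
  rcases C.instr with ⟨q, _ | _ | _ | _ | _⟩ <;> simp

theorem EPM.IsBranch.pos_mono {M : EPM} {B : ℕ → M.Cfg} (hB : M.IsBranch B) (m n : ℕ)
    (h : m ≤ n) : (B m).pos <+: (B n).pos := by
  induction n, h using Nat.le_induction with
  | base => exact List.prefix_rfl
  | succ n _ ih =>
    obtain ⟨e, he⟩ := hB.2 n
    rw [he]
    exact ih.trans ((B n).pos_prefix_next e)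

/-- A stack machine wins a game if, whenever it is idle in a legal position, it answers every
legal move of the environment so that an invariant is restored, and the invariant along a play
guarantees that the run is won. -/
theorem StackMachine.wins_of_invariant (M : StackMachine) (A : Game) {D : Type*}
    (idle : D → Position → M.Cfg) (s : M.State) (hpos : ∀ d Φ, (idle d Φ).pos = Φ)
    (hgrant : ∀ d Φ, M.op (idle d Φ).state (idle d Φ).right.head? = .grant s)
    (hnone : ∀ d Φ, Reaches ((idle d Φ).grantNext s none) (idle d Φ))
    (Inv : D → Position → Prop) (Next : D → D → Prop) (hrefl : ∀ d, Next d d)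
    (d₀ : D) (hinit : Reaches M.init (idle d₀ [])) (hinv : Inv d₀ [])
    (hlegal : ∀ d Φ, Inv d Φ → (Φ : Run) ∈ A.Lr)
    (hstep : ∀ d Φ, Inv d Φ → ∀ m, ((Φ ++ [(.bot, m)] : Position) : Run) ∈ A.Lr →
      ∃ d' Φ', Reaches ((idle d Φ).grantNext s (some m)) (idle d' Φ') ∧ Inv d' Φ' ∧ Next d d')
    (hwin : ∀ (d : ℕ → D) (P : ℕ → Position), (∀ n, Inv (d n) (P n)) →
      (∀ n, Next (d n) (d (n + 1))) → (∀ m n, m ≤ n → P m <+: P n) →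
      A.Wn (limitRun P) = .top) :
    M.toEPM.Wins A := by
  intro B hB
  by_cases hill : IllegalBy A.Lr .bot (M.toEPM.runOf B)
  · exact ⟨A.wn_of_illegalBy _ _ hill, Or.inr hill⟩
  have hmono := hB.pos_mono
  -- The good moments of the branch: the machine is idle and the invariant holds.
  let G := { x : ℕ × D × Position // Rep (B x.1) (idle x.2.1 x.2.2) ∧ Inv x.2.1 x.2.2 }
  have hBpos : ∀ x : G, (B x.1.1).pos = x.1.2.2 := fun x => by
    obtain ⟨T, -, h, -⟩ := x.2.1
    rw [h]
    exact hpos _ _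
  -- After a good moment comes a grant; a legal answer or none leads to a later good moment.
  have hnext : ∀ x : G, ∃ y : G, x.1.1 < y.1.1 ∧ Next x.1.2.1 y.1.2.1 := by
    intro x
    obtain ⟨⟨n, d, Φ⟩, hr, hi⟩ := x
    have hp := hBpos ⟨⟨n, d, Φ⟩, hr, hi⟩
    simp only at hr hi hp
    obtain ⟨hg1, hg2⟩ := hr.grant (hgrant d Φ)
    obtain ⟨e, he⟩ := hB.2 n
    have hr' := hg2 e
    rw [← he] at hr'
    have go : ∀ d', ∀ Φ', Reaches ((idle d Φ).grantNext s e) (idle d' Φ') → Inv d' Φ' →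
        Next d d' → ∃ y : G, n < y.1.1 ∧ Next d y.1.2.1 := by
      intro d' Φ' h1 h2 h3
      obtain ⟨C', h4, h5⟩ := hr'.reaches h1
      obtain ⟨m, hm, rfl⟩ := h4.exists_index hB
      exact ⟨⟨⟨m, d', Φ'⟩, h5, h2⟩, by simp only; omega, h3⟩
    cases e with
    | none => exact go d Φ (hnone d Φ) hi (hrefl d)
    | some m =>
      by_cases hm : ((Φ ++ [(.bot, m)] : Position) : Run) ∈ A.Lr
      · obtain ⟨d', Φ', h1, h2, h3⟩ := hstep d Φ hi m hm
        exact go d' Φ' h1 h2 h3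
      -- The position at a good moment is legal, so an illegal answer would make the run illegal by
      -- the environment, which was excluded at the start.
      · refine absurd ⟨Φ, m, ?_, fun Ψ hΨ => A.prefixDetermined.of_prefix hΨ (hlegal d Φ hi), hm⟩ hill
        have h1 : (B (n + 1)).pos = Φ ++ [(.bot, m)] := by
          obtain ⟨T, -, h, -⟩ := hr'
          rw [h]
          change (idle d Φ).pos ++ _ = _
          rw [hpos]
          rfl
        rw [← h1]
        exact isInitial_limitRun hmono (n + 1)
  choose f hf using hnext
  obtain ⟨C₀, h1, h2⟩ := (rep_init M).reaches hinit
  rw [← hB.1] at h1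
  obtain ⟨n₀, -, rfl⟩ := h1.exists_index hB
  -- Iterating yields good moments at strictly increasing times. They are cofinal in the branch, and
  -- permission is granted at each of them, which gives fairness.
  let x : ℕ → G := fun k => f^[k] ⟨⟨n₀, d₀, []⟩, h2, hinv⟩
  have hx : ∀ k, x (k + 1) = f (x k) := fun k => Function.iterate_succ_apply' f k _
  have hlt : StrictMono fun k => (x k).1.1 := strictMono_nat_of_lt_succ fun k => by
    rw [hx]
    exact (hf (x k)).1
  have hge : ∀ k, k ≤ (x k).1.1 := fun k => hlt.le_apply
  have hP : ∀ m n, m ≤ n → (x m).1.2.2 <+: (x n).1.2.2 := fun m n h => by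
    rw [← hBpos, ← hBpos]
    exact hmono _ _ (hlt.monotone h)
  have hrun : M.toEPM.runOf B = limitRun fun k => (x k).1.2.2 := by
    refine limitRun_ext hmono hP (fun n => ⟨n, ?_⟩) fun n => ⟨(x n).1.1, ?_⟩
    · rw [← hBpos]
      exact hmono _ _ (hge n)
    · rw [← hBpos]
  refine ⟨?_, Or.inl fun N => ⟨(x N).1.1, hge N, ((x N).2.1.grant (hgrant _ _)).1⟩⟩
  rw [hrun]
  exact hwin (fun k => (x k).1.2.1) _ (fun n => (x n).2.2) (fun n => by rw [hx]; exact (hf (x n)).2)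
    hP

end CoL

namespace CoL

open StackMachine

/-! ### The program

Both strategies keep a table of entries on the stack `tab`. An entry is a string over the bits
and the padding symbol; deleting the padding gives a leaf of the tree of the old recurrence, and
reading the padding as 0 gives an address in the new recurrence. -/

/-- How the entries of the table are processed: `expand` makes the address of the last move a
node of the tree of the left component, `left` and `right` deal with a move in the left or right
component when the old recurrence is the right component. -/
inductive Kind where
  | expand
  | left
  | right
  deriving DecidableEq

instance : Finite Kind := by
  refine Finite.of_surjective (fun b : Option Bool => match b with
    | none => Kind.expand
    | some false => Kind.left
    | some true => Kind.right) ?_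
  rintro (_ | _ | _)
  · exact ⟨none, rfl⟩
  · exact ⟨some false, rfl⟩
  · exact ⟨some true, rfl⟩

/-- The component in which the moves prompted by the table are made. -/
def Kind.digit : Kind → Key
  | .expand => .one
  | .left => .two
  | .right => .one

/-- Elementary actions without branching. -/
inductive Micro where
  | push (k : Reg) (a : Sym)
  | drop
  | left
  | right
  | emit

instance : Finite Micro := by
  refine Finite.of_surjective (fun b : (Reg × Sym) ⊕ (Bool × Bool) => match b with
    | .inl (k, a) => Micro.push k a
    | .inr (false, false) => .drop
    | .inr (false, true) => .left
    | .inr (true, false) => .right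
    | .inr (true, true) => .emit) ?_
  rintro (⟨k, a⟩ | _ | _ | _ | _)
  · exact ⟨.inl (k, a), rfl⟩
  · exact ⟨.inr (false, false), rfl⟩
  · exact ⟨.inr (false, true), rfl⟩
  · exact ⟨.inr (true, false), rfl⟩
  · exact ⟨.inr (true, true), rfl⟩

/-- The control states. -/
inductive Ctl where
  | start
  | look
  | dig
  | entry (κ : Kind)
  | loop (κ : Kind)
  | got (κ : Kind) (c : Sym)
  | skip (κ : Kind)
  | copy (ν : Option Kind)
  | clear (ν : Option Kind)
  | rewind (κ : Kind)
  | split (κ : Kind)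
  | finish (κ : Kind)
  | pour (κ : Kind)
  | fin

instance : Finite Ctl := by
  refine Finite.of_surjective
    (fun b : Fin 4 ⊕ (Kind × Sym) ⊕ (Bool × Option Kind) ⊕ (Fin 7 × Kind) => match b with
    | .inl 0 => Ctl.start
    | .inl 1 => .look
    | .inl 2 => .dig
    | .inl 3 => .fin
    | .inr (.inl (κ, c)) => .got κ c
    | .inr (.inr (.inl (false, ν))) => .copy ν
    | .inr (.inr (.inl (true, ν))) => .clear ν
    | .inr (.inr (.inr (0, κ))) => .entry κ
    | .inr (.inr (.inr (1, κ))) => .loop κ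
    | .inr (.inr (.inr (2, κ))) => .skip κ
    | .inr (.inr (.inr (3, κ))) => .rewind κ
    | .inr (.inr (.inr (4, κ))) => .split κ
    | .inr (.inr (.inr (5, κ))) => .finish κ
    | .inr (.inr (.inr (6, κ))) => .pour κ) ?_
  rintro (_ | _ | _ | κ | κ | ⟨κ, c⟩ | κ | ν | ν | κ | κ | κ | κ | _)
  · exact ⟨.inl 0, rfl⟩
  · exact ⟨.inl 1, rfl⟩
  · exact ⟨.inl 2, rfl⟩
  · exact ⟨.inr (.inr (.inr (0, κ))), rfl⟩
  · exact ⟨.inr (.inr (.inr (1, κ))), rfl⟩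
  · exact ⟨.inr (.inl (κ, c)), rfl⟩
  · exact ⟨.inr (.inr (.inr (2, κ))), rfl⟩
  · exact ⟨.inr (.inr (.inl (false, ν))), rfl⟩
  · exact ⟨.inr (.inr (.inl (true, ν))), rfl⟩
  · exact ⟨.inr (.inr (.inr (3, κ))), rfl⟩
  · exact ⟨.inr (.inr (.inr (4, κ))), rfl⟩
  · exact ⟨.inr (.inr (.inr (5, κ))), rfl⟩
  · exact ⟨.inr (.inr (.inr (6, κ))), rfl⟩
  · exact ⟨.inl 3, rfl⟩

/-- The symbol that ends an entry of the table. -/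
def sep : Sym := .key .two

/-- Action on reaching the end of an entry. -/
def Kind.actSep : Kind → Option RunSym → List Micro × Ctl
  -- The entry is a leaf `l` and the address goes on with 0: replicate `l`, store `l1` as finished,
  -- and put `l0` back on `tab` so that it is compared with the address next. `split` recovers the
  -- bits of `l` from the stack `out`.
  | .expand, some (.key .zero) =>
    ([.push .out (.key .colon), .emit, .drop, .push .new (.key .one), .push .new sep,
      .push .tab sep, .push .tab (.key .zero)], .split .expand)
  | .expand, some (.key .one) =>
    ([.push .out (.key .colon), .emit, .drop, .push .new (.key .zero), .push .new sep,
      .push .tab sep, .push .tab (.key .one)], .split .expand)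
  | .expand, _ => ([.push .new sep], .clear (some .expand))
  | .left, some (.key .dot) => ([.push .new sep], .copy (some .left))
  -- The end of the entry is processed again after padding, until the address is used up or a 1 is
  -- met; one more padding symbol then makes the entry incompatible.
  | .left, some (.key .zero) => ([.push .new .pad, .right], .got .left sep)
  | .left, _ => ([.push .new .pad, .push .new sep], .clear (some .left))
  | .right, some (.key .dot) => ([.push .new sep], .copy (some .right))
  -- The half ending in 0 goes to `new`; the half ending in 1 returns to `tab` and passes through
  -- the scan once more, unchanged.
  | .right, some (.key .colon) =>
    ([.push .new (.key .zero), .push .new sep, .push .tab sep, .push .tab (.key .one)],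
      .split .right)
  | .right, _ => ([.push .new sep], .clear (some .right))

/-- Action on a padding symbol. -/
def Kind.actPad : Kind → Option RunSym → List Micro × Ctl
  -- Here the entry is compared as an address, where padding counts as 0, but the move is emitted at
  -- the leaf, so padding is not copied to `out`.
  | .left, some (.key .zero) => ([.push .new .pad, .right], .loop .left)
  | .left, some (.key .dot) => ([.push .new .pad], .loop .left)
  | .left, _ => ([.push .new .pad], .skip .left)
  -- Here the entry is compared as a leaf, so padding consumes no scanned symbol, but the move is
  -- emitted at the address, so padding is copied to `out`.
  | κ, _ => ([.push .new .pad, .push .out .pad], .loop κ)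

/-- Action on a bit of an entry. -/
def Kind.actBit (κ : Kind) (c : Key) (r : Option RunSym) : List Micro × Ctl :=
  if r = some (.key c) then ([.push .new (.key c), .push .out (.key c), .right], .loop κ)
  -- The address is exhausted before the entry. For `expand` nothing is left to do with such an
  -- entry, whereas the other kinds still collect its symbols for the emitted move.
  else if κ ≠ .expand ∧ r = some (.key .dot) then
    ([.push .new (.key c), .push .out (.key c)], .loop κ)
  else ([.push .new (.key c)], .skip κ)

/-- Action on a symbol of an entry. -/
def Kind.act (κ : Kind) : Sym → Option RunSym → List Micro × Ctl
  | .pad, r => κ.actPad r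
  | .key .two, r => κ.actSep r
  | .key c, r => κ.actBit c r

/-- The actions assigned to the control states. -/
inductive Act where
  | exec (x : List Micro × Ctl)
  | pop (k : Reg) (f : Option Sym → List Micro × Ctl)
  | grant (q : Ctl)

/-- The program; `dir` tells whether the old recurrence is the right component. -/
def prog (dir : Bool) : Ctl → Option RunSym → Act
  | .start, _ => .exec ([.push .tab sep], .look)
  | .look, none => .grant .look
  | .look, some _ => .exec ([.right], .dig)
  | .dig, some (.key .one) => .exec (if dir then ([.right, .right], .entry .left)
      else ([.push .out (.key .two), .right], .copy none))
  | .dig, _ => .exec ([.right, .right], .entry (if dir then .right else .expand))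
  | .entry κ, _ => .exec ([.push .out (.key κ.digit), .push .out (.key .dot)], .loop κ)
  | .loop κ, _ => .pop .tab fun a => match a with
    | none => ([], .finish κ)
    | some c => ([], .got κ c)
  | .got κ c, r => .exec (κ.act c r)
  | .skip κ, _ => .pop .tab fun a => match a with
    | none => ([], .fin)
    | some c => ([.push .new c], if c = sep then .clear (some κ) else .skip κ)
  | .copy ν, some (.key c) => .exec ([.push .out (.key c), .right], .copy ν)
  | .copy ν, _ => .exec ([.emit], .clear ν)
  | .clear ν, _ => .pop .out fun a => match a, ν with
    | some _, _ => ([], .clear ν)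
    -- The head may already be on the label of the next move; one step back first makes `rewind`
    -- stop at the right label.
    | none, some κ => ([.left], .rewind κ)
    | none, none => ([], .fin)
  | .rewind κ, some (.label _) => .exec ([.right, .right, .right], .entry κ)
  | .rewind κ, _ => .exec ([.left], .rewind κ)
  | .split κ, _ => .pop .out fun a => match a with
    | none => ([], .fin)
    | some (.key .dot) => ([], .clear (some κ))
    | some c => ([.push .tab c], .split κ)
  | .finish κ, _ => .pop .out fun a => match a with
    | none => ([], .pour κ)
    | some _ => ([], .finish κ)
  | .pour κ, _ => .pop .new fun a => match a with
    | some c => ([.push .tab c], .pour κ)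
    -- The head stands just after `2.`. Stepping back onto the period and copying from there appends
    -- `.w.α` to the new component digit.
    | none => if κ = .expand then ([.push .out (.key .one), .left], .copy none) else ([], .fin)
  | .fin, some _ => .exec ([.right], .fin)
  | .fin, none => .exec ([], .look)

/-- A state: the elementary actions still to be performed, and the control state to follow. -/
abbrev PState := {l : List Micro // l.length ≤ 8} × Ctl

instance : Finite PState := by
  have : Finite {l : List Micro // l.length ≤ 8} := (List.finite_length_le Micro 8).to_subtype
  exact inferInstance

/-- The bound keeps the state set finite; no list in the program is longer than 7, so nothing is
ever cut off. -/
def PState.mk (x : List Micro × Ctl) : PState := (⟨x.1.take 8, by simp⟩, x.2)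

def Act.toOp : Act → StackOp PState
  | .exec x => .jump (PState.mk x)
  | .pop k f => .pop k fun a => PState.mk (f a)
  | .grant q => .grant (PState.mk ([], q))

/-- The machine that runs the program. -/
def machine (dir : Bool) : StackMachine where
  State := PState
  start := PState.mk ([], .start)
  op
    | (⟨[], _⟩, q), r => (prog dir q r).toOp
    | (⟨m :: l, h⟩, q), _ =>
      let s : PState := (⟨l, by simp at h; omega⟩, q)
      match m with
      | .push k a => .push k a s
      | .drop => .pop .out fun _ => s
      | .left => .run .left s
      | .right => .run .right s
      | .emit => .emit s

/-- A configuration of the machine between elementary actions. -/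
def cfg (dir : Bool) (x : List Micro × Ctl) (o t n : List Sym) (L R : List RunSym) (Φ : Position) :
    (machine dir).Cfg := ⟨PState.mk x, ⟨o, t, n⟩, L, R, Φ⟩

/-- The effect of elementary actions on the stacks, the run tape and the position. -/
def runMicros : List Micro → Regs → List RunSym → List RunSym → Position →
    Option (Regs × List RunSym × List RunSym × Position)
  | [], S, L, R, Φ => some (S, L, R, Φ)
  | .push k a :: l, S, L, R, Φ => runMicros l (S.set k (a :: S.get k)) L R Φ
  | .drop :: l, S, L, R, Φ => runMicros l { S with out := S.out.tail } L R Φ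
  | .left :: _, _, [], _, _ => none
  | .left :: l, S, a :: L, R, Φ => runMicros l S L (a :: R) Φ
  | .right :: _, _, _, [], _ => none
  | .right :: l, S, L, a :: R, Φ => runMicros l S (a :: L) R Φ
  | .emit :: l, S, L, R, Φ => runMicros l S L (R ++ spell [emitted S.out]) (Φ ++ [emitted S.out])

variable {dir : Bool}

theorem reaches_micros (q : Ctl) (l : List Micro) (hl : l.length ≤ 8) :
    ∀ (S : Regs) (L R : List RunSym) (Φ : Position) (S' : Regs) (L' R' : List RunSym)
      (Φ' : Position), runMicros l S L R Φ = some (S', L', R', Φ') →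
      Reaches (M := machine dir) ⟨(⟨l, hl⟩, q), S, L, R, Φ⟩ ⟨PState.mk ([], q), S', L', R', Φ'⟩ := by
  induction l with
  | nil =>
    intro S L R Φ S' L' R' Φ' h
    simp only [runMicros, Option.some.injEq, Prod.mk.injEq] at h
    obtain ⟨rfl, rfl, rfl, rfl⟩ := h
    exact .refl _
  | cons m l ih =>
    intro S L R Φ S' L' R' Φ' h
    have ih' := ih (by simp at hl; omega)
    cases m with
    | push k a => exact .head rfl (ih' _ _ _ _ _ _ _ _ h)
    | drop => exact .head rfl (ih' _ _ _ _ _ _ _ _ h)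
    | left =>
      cases L with
      | nil => simp [runMicros] at h
      | cons a L => exact .head rfl (ih' _ _ _ _ _ _ _ _ h)
    | right =>
      cases R with
      | nil => simp [runMicros] at h
      | cons a R => exact .head rfl (ih' _ _ _ _ _ _ _ _ h)
    | emit => exact .head rfl (ih' _ _ _ _ _ _ _ _ h)

variable {q : Ctl} {o t n : List Sym} {L R : List RunSym} {Φ : Position}

theorem cfg_op {a : Act} (h : prog dir q R.head? = a) :
    (machine dir).op (cfg dir ([], q) o t n L R Φ).state (cfg dir ([], q) o t n L R Φ).right.head? =
      a.toOp := by
  rw [← h]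
  rfl

theorem PState.mk_of_length_le {l : List Micro} (hl : l.length ≤ 8) (q : Ctl) :
    PState.mk (l, q) = (⟨l, hl⟩, q) := by
  simp [PState.mk, List.take_of_length_le hl]

/-- Turns one line of the program into an equation about `runMicros`, which in concrete cases holds
by computation. -/
theorem reaches_exec {l : List Micro} {q' : Ctl} {o' t' n' : List Sym} {L' R' : List RunSym}
    {Φ' : Position} (h : prog dir q R.head? = .exec (l, q')) (hl : l.length ≤ 8)
    (hr : runMicros l ⟨o, t, n⟩ L R Φ = some (⟨o', t', n'⟩, L', R', Φ')) :
    Reaches (cfg dir ([], q) o t n L R Φ) (cfg dir ([], q') o' t' n' L' R' Φ') := by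
  have hs : (cfg dir ([], q) o t n L R Φ).step = some (cfg dir (l, q') o t n L R Φ) := by
    rw [Cfg.step, cfg_op h]
    rfl
  refine .head hs ?_
  unfold cfg
  rw [PState.mk_of_length_le hl]
  exact reaches_micros q' l hl _ _ _ _ _ _ _ _ hr

theorem reaches_pop {k : Reg} {f : Option Sym → List Micro × Ctl} {l : List Micro} {q' : Ctl}
    {o' t' n' : List Sym} {L' R' : List RunSym} {Φ' : Position}
    (h : prog dir q R.head? = .pop k f) (hf : f ((⟨o, t, n⟩ : Regs).get k).head? = (l, q'))
    (hl : l.length ≤ 8)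
    (hr : runMicros l ((⟨o, t, n⟩ : Regs).set k ((⟨o, t, n⟩ : Regs).get k).tail) L R Φ =
      some (⟨o', t', n'⟩, L', R', Φ')) :
    Reaches (cfg dir ([], q) o t n L R Φ) (cfg dir ([], q') o' t' n' L' R' Φ') := by
  have hs : (cfg dir ([], q) o t n L R Φ).step = some ⟨PState.mk (l, q'),
      (⟨o, t, n⟩ : Regs).set k ((⟨o, t, n⟩ : Regs).get k).tail, L, R, Φ⟩ := by
    rw [Cfg.step, cfg_op h, ← hf]
    rfl
  refine .head hs ?_
  rw [PState.mk_of_length_le hl]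
  exact reaches_micros q' l hl _ _ _ _ _ _ _ _ hr

theorem reaches_popOut {f : Option Sym → List Micro × Ctl} {l : List Micro} {q' : Ctl}
    {o' t' n' : List Sym} {L' R' : List RunSym} {Φ' : Position}
    (h : prog dir q R.head? = .pop .out f) (hf : f o.head? = (l, q')) (hl : l.length ≤ 8)
    (hr : runMicros l ⟨o.tail, t, n⟩ L R Φ = some (⟨o', t', n'⟩, L', R', Φ')) :
    Reaches (cfg dir ([], q) o t n L R Φ) (cfg dir ([], q') o' t' n' L' R' Φ') :=
  reaches_pop h hf hl hr

theorem reaches_popTab {f : Option Sym → List Micro × Ctl} {l : List Micro} {q' : Ctl}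
    {o' t' n' : List Sym} {L' R' : List RunSym} {Φ' : Position}
    (h : prog dir q R.head? = .pop .tab f) (hf : f t.head? = (l, q')) (hl : l.length ≤ 8)
    (hr : runMicros l ⟨o, t.tail, n⟩ L R Φ = some (⟨o', t', n'⟩, L', R', Φ')) :
    Reaches (cfg dir ([], q) o t n L R Φ) (cfg dir ([], q') o' t' n' L' R' Φ') :=
  reaches_pop h hf hl hr

theorem reaches_popNew {f : Option Sym → List Micro × Ctl} {l : List Micro} {q' : Ctl}
    {o' t' n' : List Sym} {L' R' : List RunSym} {Φ' : Position}
    (h : prog dir q R.head? = .pop .new f) (hf : f n.head? = (l, q')) (hl : l.length ≤ 8)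
    (hr : runMicros l ⟨o, t, n.tail⟩ L R Φ = some (⟨o', t', n'⟩, L', R', Φ')) :
    Reaches (cfg dir ([], q) o t n L R Φ) (cfg dir ([], q') o' t' n' L' R' Φ') :=
  reaches_pop h hf hl hr

/-! ### The loops of the program -/

/-- A move as it appears on the run tape. -/
def keys (m : Move) : List RunSym := m.map RunSym.key

theorem keys_append (m m' : Move) : keys (m ++ m') = keys m ++ keys m' := by simp [keys]

/-- The configuration between two moves of the environment. -/
def restCfg (dir : Bool) (t : List Sym) (Φ : Position) : (machine dir).Cfg :=
  cfg dir ([], .look) [] t [] (spell Φ).reverse [] Φ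

theorem reaches_fin (R : List RunSym) : ∀ L,
    Reaches (cfg dir ([], .fin) o t n L R Φ) (cfg dir ([], .look) o t n (R.reverse ++ L) [] Φ) := by
  induction R with
  | nil => intro L; exact reaches_exec (l := []) rfl (by simp) rfl
  | cons a R ih =>
    intro L
    have h := ih (a :: L)
    rw [List.reverse_cons, List.append_assoc]
    exact (reaches_exec (l := [.right]) rfl (by simp) rfl).trans h

theorem reaches_clear (ν : Option Kind) (o : List Sym) :
    Reaches (cfg dir ([], .clear ν) o t n L R Φ) (cfg dir ([], .clear ν) [] t n L R Φ) := by
  induction o with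
  | nil => exact .refl _
  | cons a o ih => exact (reaches_popOut (l := []) rfl rfl (by simp) rfl).trans ih

theorem reaches_clear_none :
    Reaches (cfg dir ([], .clear none) o t n L R Φ)
      (cfg dir ([], .look) [] t n (R.reverse ++ L) [] Φ) :=
  (reaches_clear none o).trans
    ((reaches_popOut (l := []) (q' := .fin) rfl rfl (by simp) rfl).trans (reaches_fin R L))

theorem reaches_rewind (κ : Kind) (p : Player) (m : Move) : ∀ (R : List RunSym) (c : Key),
    Reaches (cfg dir ([], .rewind κ) o t n ((keys m).reverse ++ .label p :: L) (.key c :: R) Φ)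
      (cfg dir ([], .rewind κ) o t n L (.label p :: keys m ++ .key c :: R) Φ) := by
  induction m using List.reverseRecOn with
  | nil => exact fun R c => reaches_exec (l := [.left]) rfl (by simp) rfl
  | append_singleton m a ih =>
    intro R c
    have h := ih (.key c :: R) a
    refine (reaches_exec (l := [.left]) (q' := .rewind κ) rfl (by simp) ?_).trans
      (by simpa [keys] using h)
    simp [keys, runMicros]

/-- Brings the head back behind the two symbols of the component prefix, so that each entry is
compared with the address from its start. -/
theorem reaches_clear_some (κ : Kind) (p : Player) (d e : Key) (m : Move) :
    Reaches (cfg dir ([], .clear (some κ)) o t n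
        ((keys (d :: e :: m)).reverse ++ .label p :: L) R Φ)
      (cfg dir ([], .entry κ) [] t n (.key e :: .key d :: .label p :: L) (keys m ++ R) Φ) := by
  refine (reaches_clear _ o).trans ?_
  obtain ⟨m', c, hm⟩ : ∃ m' c, d :: e :: m = m' ++ [c] :=
    ⟨(d :: e :: m).dropLast, _, (List.dropLast_append_getLast (List.cons_ne_nil _ _)).symm⟩
  refine (reaches_popOut (l := [.left]) (q' := .rewind κ) (t' := t) (n' := n) (o' := [])
    (L' := (keys m').reverse ++ .label p :: L) (R' := .key c :: R) (Φ' := Φ) rfl rfl (by simp)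
    (by simp [hm, keys, runMicros])).trans ?_
  refine (reaches_rewind κ p m' R c).trans ?_
  have h : keys m' ++ .key c :: R = .key d :: .key e :: (keys m ++ R) := by
    have : keys (m' ++ [c]) ++ R = keys (d :: e :: m) ++ R := by rw [hm]
    simpa [keys] using this
  rw [List.cons_append, h]
  exact reaches_exec (l := [.right, .right, .right]) rfl (by simp) rfl

/-- Copying stops where `X` begins, which is a label or the blank end of the tape. The emitted move
lands behind `X` and does not disturb the copy. -/
theorem reaches_copy (ν : Option Kind) (X : List RunSym) (hX : ∀ c, X.head? ≠ some (.key c))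
    (m : Move) : ∀ (o : List Sym) (L : List RunSym),
    Reaches (cfg dir ([], .copy ν) o t n L (keys m ++ X) Φ)
      (cfg dir ([], .clear ν) ((m.map Sym.key).reverse ++ o) t n ((keys m).reverse ++ L)
        (X ++ spell [emitted ((m.map Sym.key).reverse ++ o)])
        (Φ ++ [emitted ((m.map Sym.key).reverse ++ o)])) := by
  induction m with
  | nil =>
    intro o L
    refine reaches_exec (l := [.emit]) ?_ (by simp) rfl
    rcases X with _ | ⟨_ | c, X⟩
    · rfl
    · rfl
    · exact absurd rfl (hX c)
  | cons c m ih =>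
    intro o L
    have h := ih (.key c :: o) (.key c :: L)
    refine (reaches_exec (l := [.push .out (.key c), .right]) (q' := .copy ν) rfl (by simp)
      rfl).trans (by simpa [keys, Regs.get] using h)

/-! ### The table and its encoding -/

/-- An entry of the table; `none` is padding. -/
abbrev Entry := List (Option Bool)

/-- The symbols of an entry. -/
def trit : Option Bool → Sym
  | none => .pad
  | some b => .key (bitKey b)

/-- An entry as it appears in the table. -/
def Entry.enc (e : Entry) : List Sym := e.map trit ++ [sep]

/-- The contents of the stack `tab` when the table is `E`. -/
def encTab (E : List Entry) : List Sym := E.flatMap Entry.enc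

theorem trit_ne_sep (x : Option Bool) : trit x ≠ sep := by
  rcases x with _ | _ | _ <;> simp [trit, sep, bitKey]

theorem reaches_skip (κ : Kind) (T : List Sym) (e : Entry) : ∀ n,
    Reaches (cfg dir ([], .skip κ) o (e.enc ++ T) n L R Φ)
      (cfg dir ([], .clear (some κ)) o T (e.enc.reverse ++ n) L R Φ) := by
  induction e with
  | nil =>
    intro n
    exact reaches_popTab (l := [.push .new sep]) rfl (by simp [Entry.enc]) (by simp) rfl
  | cons x e ih =>
    intro n
    have h := ih (trit x :: n)
    refine (reaches_popTab (l := [.push .new (trit x)]) (q' := .skip κ) rfl ?_ (by simp)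
      rfl).trans (by simpa [Entry.enc, Regs.get] using h)
    simp [Entry.enc, trit_ne_sep]

/-- Undoes the reading of an entry: its symbols move from `out` back to `tab`, down to the period
that ends the component prefix. -/
theorem reaches_split (κ : Kind) (o' : List Sym) (e : Entry) : ∀ t,
    Reaches (cfg dir ([], .split κ) ((e.map trit).reverse ++ .key .dot :: o') t n L R Φ)
      (cfg dir ([], .clear (some κ)) o' (e.map trit ++ t) n L R Φ) := by
  induction e using List.reverseRecOn with
  | nil => exact fun t => reaches_popOut (l := []) rfl rfl (by simp) rfl
  | append_singleton e x ih =>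
    intro t
    have h := ih (trit x :: t)
    simp only [List.map_append, List.map_cons, List.map_nil, List.reverse_append,
      List.reverse_cons, List.reverse_nil, List.nil_append, List.cons_append, List.append_assoc]
    refine (reaches_popOut (l := [.push .tab (trit x)]) (q' := .split κ) rfl ?_ (by simp)
      rfl).trans h
    rcases x with _ | _ | _ <;> rfl

theorem reaches_pour (κ : Kind) (n : List Sym) : ∀ t,
    Reaches (cfg dir ([], .pour κ) o t n L R Φ)
      (cfg dir ([], .pour κ) o (n.reverse ++ t) [] L R Φ) := by
  induction n with
  | nil => exact fun t => .refl _
  | cons a n ih =>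
    intro t
    have h := ih (a :: t)
    exact (reaches_popNew (l := [.push .tab a]) (q' := .pour κ) rfl rfl (by simp) rfl).trans
      (by simpa [Regs.get] using h)

/-- The new table was collected in reverse, and pouring it onto `tab` restores its order. -/
theorem reaches_finish (κ : Kind) (o : List Sym) :
    Reaches (cfg dir ([], .finish κ) o t n L R Φ)
      (cfg dir ([], .pour κ) [] (n.reverse ++ t) [] L R Φ) := by
  induction o with
  | nil =>
    exact (reaches_popOut (l := []) (q' := .pour κ) rfl rfl (by simp) rfl).trans
      (reaches_pour κ n t)
  | cons a o ih => exact (reaches_popOut (l := []) (q' := .finish κ) rfl rfl (by simp) rfl).trans ih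

theorem reaches_entry (κ : Kind) :
    Reaches (cfg dir ([], .entry κ) [] t n L R Φ)
      (cfg dir ([], .loop κ) [.key .dot, .key κ.digit] t n L R Φ) :=
  reaches_exec (l := [.push .out (.key κ.digit), .push .out (.key .dot)]) rfl (by simp) rfl

theorem reaches_loop (κ : Kind) (c : Sym) :
    Reaches (cfg dir ([], .loop κ) o (c :: t) n L R Φ)
      (cfg dir ([], .got κ c) o t n L R Φ) :=
  reaches_popTab (l := []) rfl rfl (by simp) rfl

theorem reaches_loop_nil (κ : Kind) :
    Reaches (cfg dir ([], .loop κ) o [] n L R Φ)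
      (cfg dir ([], .pour κ) [] n.reverse [] L R Φ) := by
  refine (reaches_popTab (l := []) (q' := .finish κ) rfl rfl (by simp) rfl).trans ?_
  simpa using reaches_finish (t := []) κ o

end CoL

namespace CoL

open StackMachine

/-! ### Processing an entry of the table -/

/-- The leaf of the tree that an entry stands for. -/
def Entry.leaf (e : Entry) : List Bool := e.filterMap id

/-- The address in the new recurrence that an entry stands for. -/
def Entry.addr (e : Entry) : List Bool := e.map fun x => x.getD false

/-- Pad an entry at its end, until the padded entry either has an address that extends `w`,
or has an address that is incompatible with `w`. -/
def padAlong : List Bool → Entry → Entry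
  | [], e => e
  | true :: _, [] => [none]
  | false :: w, [] => none :: padAlong w []
  | b :: w, x :: e => x :: if x.getD false = b then padAlong w e else e

theorem spell_head_ne_key (Ψ : Position) (c : Key) : (spell Ψ).head? ≠ some (.key c) := by
  cases Ψ <;> simp [spell]

theorem bitKey_inj {b b' : Bool} : bitKey b = bitKey b' ↔ b = b' := by
  cases b <;> cases b' <;> simp [bitKey]

theorem bitKey_ne_dot (b : Bool) : bitKey b ≠ .dot := by cases b <;> simp [bitKey]

theorem toKey_trit (x : Option Bool) : (trit x).toKey = bitKey (x.getD false) := by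
  rcases x with _ | b <;> rfl

variable {dir : Bool} {o t n : List Sym} {L : List RunSym} {Φ Ψ : Position} {d : Key}

/-- The configuration in which the next entry of the table is going to be processed; the
address of the move of the environment is at the beginning of `m`, and `Ψ` consists of the
moves made later. -/
def entryCfg (dir : Bool) (κ : Kind) (d : Key) (L : List RunSym) (t n : List Sym) (m : Move)
    (Ψ Φ : Position) : (machine dir).Cfg :=
  cfg dir ([], .entry κ) [] t n (.key .dot :: .key d :: .label .bot :: L) (keys m ++ spell Ψ) Φ

/-- The configuration in control state `q`, after the part `m₁` of the address was read. -/
def scanCfg (dir : Bool) (q : Ctl) (d : Key) (L : List RunSym) (o t n : List Sym) (m₁ m₂ : Move)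
    (Ψ Φ : Position) : (machine dir).Cfg :=
  cfg dir ([], q) o t n ((keys (d :: .dot :: m₁)).reverse ++ .label .bot :: L)
    (keys m₂ ++ spell Ψ) Φ

theorem entryCfg_reaches {κ : Kind} {m : Move} :
    Reaches (entryCfg dir κ d L t n m Ψ Φ)
      (scanCfg dir (.loop κ) d L [.key .dot, .key κ.digit] t n [] m Ψ Φ) :=
  reaches_entry κ

theorem scan_clear {κ : Kind} {m₁ m₂ : Move} :
    Reaches (scanCfg dir (.clear (some κ)) d L o t n m₁ m₂ Ψ Φ)
      (entryCfg dir κ d L t n (m₁ ++ m₂) Ψ Φ) := by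
  have h := reaches_clear_some (dir := dir) (o := o) (t := t) (n := n) (Φ := Φ) (L := L)
    (R := keys m₂ ++ spell Ψ) κ .bot d .dot m₁
  unfold scanCfg entryCfg
  rw [keys_append, List.append_assoc]
  exact h

/-- The rest of the scanned move completes the emitted one: the part of the address already read is
replaced by what `out` holds. -/
theorem scan_copy {κ : Kind} {m₁ m₂ : Move} :
    Reaches (scanCfg dir (.copy (some κ)) d L o t n m₁ m₂ Ψ Φ)
      (entryCfg dir κ d L t n (m₁ ++ m₂) (Ψ ++ [emitted ((m₂.map Sym.key).reverse ++ o)])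
        (Φ ++ [emitted ((m₂.map Sym.key).reverse ++ o)])) := by
  refine (reaches_copy _ _ (spell_head_ne_key Ψ) m₂ _ _).trans ?_
  have h := scan_clear (dir := dir) (κ := κ) (d := d) (L := L)
    (o := (m₂.map Sym.key).reverse ++ o) (t := t) (n := n)
    (m₁ := m₁ ++ m₂) (m₂ := []) (Ψ := Ψ ++ [emitted ((m₂.map Sym.key).reverse ++ o)])
    (Φ := Φ ++ [emitted ((m₂.map Sym.key).reverse ++ o)])
  unfold scanCfg at h
  rw [spell_append, List.append_nil] at h
  rw [show (keys (d :: .dot :: (m₁ ++ m₂))).reverse ++ RunSym.label .bot :: L =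
    (keys m₂).reverse ++ ((keys (d :: .dot :: m₁)).reverse ++ RunSym.label .bot :: L) by
    simp [keys]] at h
  exact h

theorem scan_exec {q q' : Ctl} {l : List Micro} {o' t' n' : List Sym} {m₁ m₂ m₁' m₂' : Move}
    (h : prog dir q (keys m₂ ++ spell Ψ).head? = .exec (l, q')) (hl : l.length ≤ 8)
    (hr : runMicros l ⟨o, t, n⟩ ((keys (d :: .dot :: m₁)).reverse ++ .label .bot :: L)
      (keys m₂ ++ spell Ψ) Φ = some (⟨o', t', n'⟩,
        (keys (d :: .dot :: m₁')).reverse ++ .label .bot :: L, keys m₂' ++ spell Ψ, Φ)) :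
    Reaches (scanCfg dir q d L o t n m₁ m₂ Ψ Φ) (scanCfg dir q' d L o' t' n' m₁' m₂' Ψ Φ) :=
  reaches_exec h hl hr

theorem scan_skip {κ : Kind} {T : List Sym} {m₁ m₂ : Move} (e : Entry) :
    Reaches (scanCfg dir (.skip κ) d L o (e.enc ++ T) n m₁ m₂ Ψ Φ)
      (entryCfg dir κ d L T (e.enc.reverse ++ n) (m₁ ++ m₂) Ψ Φ) :=
  (reaches_skip κ T e n).trans scan_clear

theorem act_bit (κ : Kind) (b : Bool) (r : Option RunSym) :
    κ.act (.key (bitKey b)) r = κ.actBit (bitKey b) r := by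
  cases b <;> rfl

section Scan

variable {κ : Kind} {T : List Sym} {e : Entry} {m₁ m₂ : Move}

/-- A bit of an entry agrees with the bit that is scanned. -/
theorem scan_bit_match (b : Bool) :
    Reaches (scanCfg dir (.loop κ) d L o (Entry.enc (some b :: e) ++ T) n m₁ (bitKey b :: m₂) Ψ Φ)
      (scanCfg dir (.loop κ) d L (trit (some b) :: o) (e.enc ++ T) (trit (some b) :: n)
        (m₁ ++ [bitKey b]) m₂ Ψ Φ) := by
  refine (reaches_loop κ _).trans (scan_exec
    (l := [.push .new (.key (bitKey b)), .push .out (.key (bitKey b)), .right])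
    ?_ (by simp) ?_)
  · change Act.exec (κ.act (.key (bitKey b)) (some (.key (bitKey b)))) = _
    simp [act_bit, Kind.actBit]
  · simp [runMicros, keys, Regs.set, Regs.get, trit, Entry.enc]

/-- A bit of an entry beyond the end of the address. -/
theorem scan_bit_dot (hκ : κ ≠ .expand) (b : Bool) :
    Reaches (scanCfg dir (.loop κ) d L o (Entry.enc (some b :: e) ++ T) n m₁ (.dot :: m₂) Ψ Φ)
      (scanCfg dir (.loop κ) d L (trit (some b) :: o) (e.enc ++ T) (trit (some b) :: n)
        m₁ (.dot :: m₂) Ψ Φ) := by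
  refine (reaches_loop κ _).trans (scan_exec
    (l := [.push .new (.key (bitKey b)), .push .out (.key (bitKey b))])
    ?_ (by simp) ?_)
  · change Act.exec (κ.act (.key (bitKey b)) (some (.key .dot))) = _
    simp [act_bit, Kind.actBit, hκ, (bitKey_ne_dot b).symm]
  · simp [runMicros, keys, Regs.set, Regs.get, trit, Entry.enc]

/-- A bit of an entry does not agree with what is scanned. -/
theorem scan_bit_mismatch (b : Bool) (c : Key) (hc : c ≠ bitKey b) (hκ : κ = .expand ∨ c ≠ .dot) :
    Reaches (scanCfg dir (.loop κ) d L o (Entry.enc (some b :: e) ++ T) n m₁ (c :: m₂) Ψ Φ)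
      (entryCfg dir κ d L T ((Entry.enc (some b :: e)).reverse ++ n) (m₁ ++ c :: m₂) Ψ Φ) := by
  have h := scan_skip (dir := dir) (d := d) (L := L) (o := o) (κ := κ) (T := T)
    (n := trit (some b) :: n) (m₁ := m₁) (m₂ := c :: m₂) (Ψ := Ψ) (Φ := Φ) e
  rw [show (Entry.enc (some b :: e)).reverse ++ n = e.enc.reverse ++ trit (some b) :: n by
    simp [Entry.enc]]
  refine (reaches_loop κ _).trans ((scan_exec
    (l := [.push .new (.key (bitKey b))]) (q' := .skip κ)
    ?_ (by simp) ?_).trans h)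
  · change Act.exec (κ.act (.key (bitKey b)) (some (.key c))) = _
    rw [act_bit, Kind.actBit, if_neg (by simpa using hc), if_neg]
    rintro ⟨h1, h2⟩
    simp only [Option.some.injEq, RunSym.key.injEq] at h2
    rcases hκ with h | h
    · exact h1 h
    · exact h h2
  · simp [runMicros, keys, Regs.set, Regs.get, trit, Entry.enc]

theorem scan_pad_right :
    Reaches (scanCfg dir (.loop .right) d L o (Entry.enc (none :: e) ++ T) n m₁ m₂ Ψ Φ)
      (scanCfg dir (.loop .right) d L (trit none :: o) (e.enc ++ T) (trit none :: n)
        m₁ m₂ Ψ Φ) := by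
  refine (reaches_loop .right _).trans (scan_exec (l := [.push .new .pad, .push .out .pad])
    ?_ (by simp) ?_)
  · rfl
  · simp [runMicros, keys, Regs.set, Regs.get, trit, Entry.enc]

end Scan

/-! #### Moves in the left component, when the old recurrence is on the right -/

theorem emitted_append (o : List Sym) (m : Move) :
    emitted ((m.map Sym.key).reverse ++ o) = (.top, (o.reverse.map Sym.toKey) ++ m) := by
  simp [emitted, Function.comp_def, Sym.toKey]

open Classical in
/-- The moves made for one entry after the move `w.α` in the left component. -/
def leftOuts (pre : Move) (w : List Bool) (α : Move) (e : Entry) : Position :=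
  if w <+: (padAlong w e).addr then [(.top, pre ++ bits e.leaf ++ .dot :: α)] else []

/-- Induction on the unread part of the address: each 0 is matched by padding, and a 1 is answered
by a single padding symbol, after which nothing is emitted. -/
theorem scan_left_sep {T : List Sym} (α : Move) (w : List Bool) : ∀ (n : List Sym) (m₁ : Move),
    Reaches (scanCfg dir (.got .left sep) d L o T n m₁ (bits w ++ .dot :: α) Ψ Φ)
      (entryCfg dir .left d L T ((padAlong w []).enc.reverse ++ n) (m₁ ++ (bits w ++ .dot :: α))
        (Ψ ++ leftOuts (o.reverse.map Sym.toKey) w α [])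
        (Φ ++ leftOuts (o.reverse.map Sym.toKey) w α [])) := by
  induction w with
  | nil =>
    intro n m₁
    have h := scan_copy (dir := dir) (d := d) (L := L) (o := o) (t := T) (n := sep :: n)
      (κ := .left) (m₁ := m₁) (m₂ := .dot :: α) (Ψ := Ψ) (Φ := Φ)
    rw [emitted_append] at h
    refine (scan_exec (l := [.push .new sep]) (q' := .copy (some .left)) rfl (by simp) rfl).trans ?_
    simpa [leftOuts, padAlong, Entry.enc, bits, Entry.leaf, Regs.get] using h
  | cons b w ih =>
    intro n m₁
    cases b with
    | false =>
      have h := ih (.pad :: n) (m₁ ++ [.zero])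
      have ho : leftOuts (o.reverse.map Sym.toKey) (false :: w) α [] =
          leftOuts (o.reverse.map Sym.toKey) w α [] := by
        simp [leftOuts, padAlong, Entry.addr]
      rw [ho, show m₁ ++ (bits (false :: w) ++ .dot :: α) = m₁ ++ [.zero] ++ (bits w ++ .dot :: α) by
        simp [bits, bitKey],
        show (padAlong (false :: w) []).enc.reverse ++ n =
          (padAlong w []).enc.reverse ++ .pad :: n by simp [padAlong, Entry.enc, trit]]
      refine (scan_exec (l := [.push .new .pad, .right]) (q' := .got .left sep) rfl (by simp)
        ?_).trans h
      simp [runMicros, keys, Regs.set, Regs.get, bits, bitKey]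
    | true =>
      have ho : leftOuts (o.reverse.map Sym.toKey) (true :: w) α [] = [] := by
        simp [leftOuts, padAlong, Entry.addr]
      rw [ho, List.append_nil, List.append_nil]
      exact (scan_exec (l := [.push .new .pad, .push .new sep]) (q' := .clear (some .left)) rfl
        (by simp) rfl).trans scan_clear

/-- The stack `out` is arbitrary because the recursion collects there the leaf bits of the part of
the entry already read. -/
theorem scan_left {T : List Sym} (α : Move) (e : Entry) :
    ∀ (w : List Bool) (o n : List Sym) (m₁ : Move),
    Reaches (scanCfg dir (.loop .left) d L o (e.enc ++ T) n m₁ (bits w ++ .dot :: α) Ψ Φ)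
      (entryCfg dir .left d L T ((padAlong w e).enc.reverse ++ n) (m₁ ++ (bits w ++ .dot :: α))
        (Ψ ++ leftOuts (o.reverse.map Sym.toKey) w α e)
        (Φ ++ leftOuts (o.reverse.map Sym.toKey) w α e)) := by
  induction e with
  | nil =>
    intro w o n m₁
    exact (reaches_loop .left _).trans (scan_left_sep α w n m₁)
  | cons x e ih =>
    intro w o n m₁
    cases x with
    | none =>
      cases w with
      | nil =>
        have h := ih [] o (.pad :: n) m₁
        rw [show leftOuts (o.reverse.map Sym.toKey) [] α (none :: e) =
          leftOuts (o.reverse.map Sym.toKey) [] α e by simp [leftOuts, Entry.leaf]]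
        rw [show (padAlong [] (none :: e)).enc.reverse ++ n =
          (padAlong [] e).enc.reverse ++ .pad :: n by simp [padAlong, Entry.enc, trit]]
        exact (reaches_loop .left _).trans ((scan_exec (l := [.push .new .pad])
          (q' := .loop .left) rfl (by simp) rfl).trans h)
      | cons b w =>
        cases b with
        | false =>
          have h := ih w o (.pad :: n) (m₁ ++ [.zero])
          rw [show leftOuts (o.reverse.map Sym.toKey) (false :: w) α (none :: e) =
            leftOuts (o.reverse.map Sym.toKey) w α e by
              simp [leftOuts, Entry.leaf, padAlong, Entry.addr]]
          rw [show (padAlong (false :: w) (none :: e)).enc.reverse ++ n =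
            (padAlong w e).enc.reverse ++ .pad :: n by simp [padAlong, Entry.enc, trit],
            show m₁ ++ (bits (false :: w) ++ .dot :: α) = m₁ ++ [.zero] ++ (bits w ++ .dot :: α) by
              simp [bits, bitKey]]
          refine (reaches_loop .left _).trans ((scan_exec (l := [.push .new .pad, .right])
            (q' := .loop .left) rfl (by simp) ?_).trans h)
          simp [runMicros, keys, Regs.set, Regs.get, bits, bitKey, Entry.enc]
        | true =>
          rw [show leftOuts (o.reverse.map Sym.toKey) (true :: w) α (none :: e) = [] by
              simp [leftOuts, padAlong, Entry.addr],
            show (padAlong (true :: w) (none :: e)).enc.reverse ++ n =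
              (Entry.enc e).reverse ++ .pad :: n by simp [padAlong, Entry.enc, trit],
            List.append_nil, List.append_nil]
          exact (reaches_loop .left _).trans ((scan_exec (l := [.push .new .pad])
            (q' := .skip .left) rfl (by simp) rfl).trans (scan_skip e))
    | some c =>
      cases w with
      | nil =>
        have h := ih [] (trit (some c) :: o) (trit (some c) :: n) m₁
        rw [show leftOuts (o.reverse.map Sym.toKey) [] α (some c :: e) =
          leftOuts ((trit (some c) :: o).reverse.map Sym.toKey) [] α e by
            simp [leftOuts, Entry.leaf, toKey_trit, bits]]
        rw [show (padAlong [] (some c :: e)).enc.reverse ++ n =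
          (padAlong [] e).enc.reverse ++ trit (some c) :: n by simp [padAlong, Entry.enc]]
        exact (scan_bit_dot (by simp) c).trans h
      | cons b w =>
        by_cases hb : c = b
        · subst hb
          have h := ih w (trit (some c) :: o) (trit (some c) :: n) (m₁ ++ [bitKey c])
          rw [show leftOuts (o.reverse.map Sym.toKey) (c :: w) α (some c :: e) =
            leftOuts ((trit (some c) :: o).reverse.map Sym.toKey) w α e by
              simp [leftOuts, Entry.leaf, toKey_trit, bits, padAlong, Entry.addr]]
          rw [show (padAlong (c :: w) (some c :: e)).enc.reverse ++ n =
            (padAlong w e).enc.reverse ++ trit (some c) :: n by simp [padAlong, Entry.enc],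
            show m₁ ++ (bits (c :: w) ++ .dot :: α) = m₁ ++ [bitKey c] ++ (bits w ++ .dot :: α) by
              simp [bits]]
          exact (scan_bit_match c).trans h
        · have h := scan_bit_mismatch (dir := dir) (d := d) (L := L) (o := o) (n := n) (Ψ := Ψ)
            (Φ := Φ) (κ := .left) (T := T) (e := e) (m₁ := m₁) (m₂ := bits w ++ .dot :: α) c (bitKey b)
            (fun h => hb (bitKey_inj.1 h).symm) (Or.inr (bitKey_ne_dot b))
          rw [show leftOuts (o.reverse.map Sym.toKey) (b :: w) α (some c :: e) = [] by
              simp [leftOuts, padAlong, Entry.addr, hb, Ne.symm hb],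
            List.append_nil, List.append_nil,
            show padAlong (b :: w) (some c :: e) = some c :: e by simp [padAlong, hb]]
          exact h

/-! #### Moves in the right component, when the old recurrence is on the right -/

open Classical in
/-- The moves made for one entry after the move `u.α` in the right component. -/
def rightOuts (pre : Move) (u : List Bool) (α : Move) (e : Entry) : Position :=
  if u <+: e.leaf then [(.top, pre ++ bits e.addr ++ .dot :: α)] else []

/-- The roles are exchanged in comparison with `scan_left`: the entry is matched by its leaf and the
move is made at its address. -/
theorem scan_right_dot {T : List Sym} (α : Move) (e : Entry) :
    ∀ (u : List Bool) (o n : List Sym) (m₁ : Move),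
    Reaches (scanCfg dir (.loop .right) d L o (e.enc ++ T) n m₁ (bits u ++ .dot :: α) Ψ Φ)
      (entryCfg dir .right d L T (e.enc.reverse ++ n) (m₁ ++ (bits u ++ .dot :: α))
        (Ψ ++ rightOuts (o.reverse.map Sym.toKey) u α e)
        (Φ ++ rightOuts (o.reverse.map Sym.toKey) u α e)) := by
  induction e with
  | nil =>
    intro u o n m₁
    refine (reaches_loop .right _).trans ?_
    cases u with
    | nil =>
      have h := scan_copy (dir := dir) (d := d) (L := L) (o := o) (t := T) (n := sep :: n)
        (κ := .right) (m₁ := m₁) (m₂ := .dot :: α) (Ψ := Ψ) (Φ := Φ)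
      rw [emitted_append] at h
      refine (scan_exec (l := [.push .new sep]) (q' := .copy (some .right)) rfl (by simp)
        rfl).trans ?_
      simpa [rightOuts, Entry.enc, bits, Entry.leaf, Entry.addr, Regs.get] using h
    | cons b u =>
      rw [show rightOuts (o.reverse.map Sym.toKey) (b :: u) α [] = [] by
        simp [rightOuts, Entry.leaf], List.append_nil, List.append_nil]
      refine (scan_exec (l := [.push .new sep]) (q' := .clear (some .right)) ?_ (by simp)
        rfl).trans scan_clear
      cases b <;> rfl
  | cons x e ih =>
    intro u o n m₁
    cases x with
    | none =>
      have h := ih u (trit none :: o) (trit none :: n) m₁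
      rw [show rightOuts (o.reverse.map Sym.toKey) u α (none :: e) =
        rightOuts ((trit none :: o).reverse.map Sym.toKey) u α e by
          simp [rightOuts, Entry.leaf, Entry.addr, toKey_trit, bits]]
      rw [show (Entry.enc (none :: e)).reverse ++ n =
        (Entry.enc e).reverse ++ trit none :: n by simp [Entry.enc]]
      exact scan_pad_right.trans h
    | some c =>
      cases u with
      | nil =>
        have h := ih [] (trit (some c) :: o) (trit (some c) :: n) m₁
        rw [show rightOuts (o.reverse.map Sym.toKey) [] α (some c :: e) =
          rightOuts ((trit (some c) :: o).reverse.map Sym.toKey) [] α e by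
            simp [rightOuts, Entry.addr, toKey_trit, bits]]
        rw [show (Entry.enc (some c :: e)).reverse ++ n =
          (Entry.enc e).reverse ++ trit (some c) :: n by simp [Entry.enc]]
        exact (scan_bit_dot (by simp) c).trans h
      | cons b u =>
        by_cases hb : c = b
        · subst hb
          have h := ih u (trit (some c) :: o) (trit (some c) :: n) (m₁ ++ [bitKey c])
          rw [show rightOuts (o.reverse.map Sym.toKey) (c :: u) α (some c :: e) =
            rightOuts ((trit (some c) :: o).reverse.map Sym.toKey) u α e by
              simp [rightOuts, Entry.leaf, toKey_trit, bits, Entry.addr]]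
          rw [show (Entry.enc (some c :: e)).reverse ++ n =
            (Entry.enc e).reverse ++ trit (some c) :: n by simp [Entry.enc],
            show m₁ ++ (bits (c :: u) ++ .dot :: α) = m₁ ++ [bitKey c] ++ (bits u ++ .dot :: α) by
              simp [bits]]
          exact (scan_bit_match c).trans h
        · have h := scan_bit_mismatch (dir := dir) (d := d) (L := L) (o := o) (n := n) (Ψ := Ψ)
            (Φ := Φ) (κ := .right) (T := T) (e := e) (m₁ := m₁) (m₂ := bits u ++ .dot :: α) c
            (bitKey b) (fun h => hb (bitKey_inj.1 h).symm) (Or.inr (bitKey_ne_dot b))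
          rw [show rightOuts (o.reverse.map Sym.toKey) (b :: u) α (some c :: e) = [] by
              simp [rightOuts, Entry.leaf, Ne.symm hb],
            List.append_nil, List.append_nil]
          exact h

/-- Here `e₁` is the part of the entry already read; it has to be recovered from `out` for the half
that returns to `tab`. -/
theorem scan_right_colon_eq {T : List Sym} (e : Entry) :
    ∀ (u : List Bool) (e₁ : Entry) (n : List Sym) (m₁ : Move), e.leaf = u →
    Reaches (scanCfg dir (.loop .right) d L ((e₁.map trit).reverse ++ [.key .dot, .key .one])
        (e.enc ++ T) n m₁ (bits u ++ [.colon]) Ψ Φ)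
      (entryCfg dir .right d L (Entry.enc (e₁ ++ e ++ [some true]) ++ T)
        ((Entry.enc (e ++ [some false])).reverse ++ n) (m₁ ++ (bits u ++ [.colon])) Ψ Φ) := by
  induction e with
  | nil =>
    rintro u e₁ n m₁ rfl
    refine (reaches_loop .right _).trans ?_
    refine (scan_exec (l := [.push .new (.key .zero), .push .new sep, .push .tab sep,
      .push .tab (.key .one)]) (q' := .split .right) rfl (by simp) rfl).trans ?_
    refine (reaches_split .right [.key .one] e₁ _).trans ?_
    rw [show Entry.enc (e₁ ++ [] ++ [some true]) ++ T =
      e₁.map trit ++ .key .one :: sep :: T by simp [Entry.enc, trit, bitKey]]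
    exact scan_clear
  | cons x e ih =>
    intro u e₁ n m₁ hu
    cases x with
    | none =>
      have h := ih u (e₁ ++ [none]) (trit none :: n) m₁ (by simpa [Entry.leaf] using hu)
      refine scan_pad_right.trans ?_
      simpa [Entry.enc] using h
    | some c =>
      obtain rfl : u = c :: Entry.leaf e := by rw [← hu]; simp [Entry.leaf]
      have h := ih _ (e₁ ++ [some c]) (trit (some c) :: n) (m₁ ++ [bitKey c]) rfl
      refine (scan_bit_match c).trans ?_
      simpa [Entry.enc, bits] using h

theorem scan_right_colon_ne {T : List Sym} (e : Entry) :
    ∀ (u : List Bool) (o n : List Sym) (m₁ : Move), e.leaf ≠ u →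
    Reaches (scanCfg dir (.loop .right) d L o (e.enc ++ T) n m₁ (bits u ++ [.colon]) Ψ Φ)
      (entryCfg dir .right d L T (e.enc.reverse ++ n) (m₁ ++ (bits u ++ [.colon])) Ψ Φ) := by
  induction e with
  | nil =>
    intro u o n m₁ hu
    refine (reaches_loop .right _).trans ?_
    cases u with
    | nil => exact absurd rfl hu
    | cons b u =>
      refine (scan_exec (l := [.push .new sep]) (q' := .clear (some .right)) ?_ (by simp)
        rfl).trans scan_clear
      cases b <;> rfl
  | cons x e ih =>
    intro u o n m₁ hu
    cases x with
    | none =>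
      have h := ih u (trit none :: o) (trit none :: n) m₁ (by simpa [Entry.leaf] using hu)
      refine scan_pad_right.trans ?_
      simpa [Entry.enc] using h
    | some c =>
      cases u with
      | nil => exact scan_bit_mismatch c .colon (by cases c <;> simp [bitKey]) (Or.inr (by simp))
      | cons b u =>
        by_cases hb : c = b
        · subst hb
          have h := ih u (trit (some c) :: o) (trit (some c) :: n) (m₁ ++ [bitKey c])
            (by simpa [Entry.leaf] using hu)
          refine (scan_bit_match c).trans ?_
          simpa [Entry.enc, bits] using h
        · exact scan_bit_mismatch c (bitKey b) (fun h => hb (bitKey_inj.1 h).symm)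
            (Or.inr (bitKey_ne_dot b))

/-! #### Moves in the right component, when the old recurrence is on the left -/

/-- An entry without padding. -/
def bitEntry (l : List Bool) : Entry := l.map some

/-- The replicative move made in the left component. -/
def replOut (l : List Bool) : Labmove := (.top, .one :: .dot :: replMove l)

theorem scan_expand_prefix {T : List Sym} (α : Move) (b : Bool) (s : List Bool) (l : List Bool) :
    ∀ (l₁ : List Bool) (n : List Sym) (m₁ : Move),
    Reaches (scanCfg dir (.loop .expand) d L
        (((bitEntry l₁).map trit).reverse ++ [.key .dot, .key .one])
        ((bitEntry l).enc ++ T) n m₁ (bits (l ++ b :: s) ++ .dot :: α) Ψ Φ)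
      (entryCfg dir .expand d L ((bitEntry (l₁ ++ l ++ [b])).enc ++ T)
        ((bitEntry (l ++ [!b])).enc.reverse ++ n) (m₁ ++ (bits (l ++ b :: s) ++ .dot :: α))
        (Ψ ++ [replOut (l₁ ++ l)]) (Φ ++ [replOut (l₁ ++ l)])) := by
  induction l with
  | nil =>
    intro l₁ n m₁
    refine (reaches_loop .expand _).trans ?_
    have ho : emitted (.key .colon :: (((bitEntry l₁).map trit).reverse ++ [.key .dot, .key .one]))
        = replOut l₁ := by
      simp only [emitted, replOut, replMove, bits, bitEntry, List.reverse_cons, List.reverse_append,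
        List.reverse_reverse, List.reverse_nil, List.map_append, List.map_map, List.map_cons,
        Function.comp_def, toKey_trit]
      simp [Sym.toKey]
    -- The program has separate lines for 0 and 1; writing the finished child with `!b` treats both
    -- at once.
    refine (reaches_exec (l := [.push .out (.key .colon), .emit, .drop,
      .push .new (.key (bitKey !b)), .push .new sep, .push .tab sep,
      .push .tab (.key (bitKey b))]) (q' := .split .expand) ?_ (by simp) rfl).trans ?_
    · cases b <;> rfl
    refine (reaches_split .expand [.key .one] (bitEntry l₁) _).trans ?_
    have h := scan_clear (dir := dir) (d := d) (L := L) (κ := .expand) (m₁ := m₁)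
      (m₂ := bits (b :: s) ++ .dot :: α) (o := [.key .one]) (t := (bitEntry (l₁ ++ [b])).enc ++ T)
      (n := (bitEntry ([!b])).enc.reverse ++ n) (Ψ := Ψ ++ [replOut l₁]) (Φ := Φ ++ [replOut l₁])
    simp only [scanCfg, spell_append] at h
    simpa [Regs.get, Regs.set, bitEntry, Entry.enc, trit, ← ho] using h
  | cons c l ih =>
    intro l₁ n m₁
    have h := ih (l₁ ++ [c]) (trit (some c) :: n) (m₁ ++ [bitKey c])
    refine (scan_bit_match c).trans ?_
    simpa [Entry.enc, bits, bitEntry] using h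

theorem scan_expand_other {T : List Sym} (α : Move) (l : List Bool) :
    ∀ (w : List Bool) (o n : List Sym) (m₁ : Move), (∀ b s, w ≠ l ++ b :: s) →
    Reaches (scanCfg dir (.loop .expand) d L o ((bitEntry l).enc ++ T) n m₁ (bits w ++ .dot :: α) Ψ Φ)
      (entryCfg dir .expand d L T ((bitEntry l).enc.reverse ++ n) (m₁ ++ (bits w ++ .dot :: α))
        Ψ Φ) := by
  induction l with
  | nil =>
    intro w o n m₁ hw
    cases w with
    | nil =>
      exact (reaches_loop .expand _).trans ((scan_exec (l := [.push .new sep])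
        (q' := .clear (some .expand)) rfl (by simp) rfl).trans scan_clear)
    | cons b s => exact absurd rfl (hw b s)
  | cons c l ih =>
    intro w o n m₁ hw
    cases w with
    | nil => exact scan_bit_mismatch c .dot (bitKey_ne_dot c).symm (Or.inl rfl)
    | cons b w =>
      by_cases hb : c = b
      · subst hb
        have h := ih w (trit (some c) :: o) (trit (some c) :: n) (m₁ ++ [bitKey c])
          fun b s h => hw b s (by rw [h]; rfl)
        refine (scan_bit_match c).trans ?_
        simpa [Entry.enc, bits, bitEntry] using h
      · exact scan_bit_mismatch c (bitKey b) (fun h => hb (bitKey_inj.1 h).symm) (Or.inl rfl)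

end CoL

namespace CoL

open StackMachine

/-! ### Processing the table -/

variable {dir : Bool} {n : List Sym} {L : List RunSym} {d : Key}

theorem encTab_cons (e : Entry) (E : List Entry) : encTab (e :: E) = e.enc ++ encTab E := rfl

theorem encTab_append (E E' : List Entry) : encTab (E ++ E') = encTab E ++ encTab E' := by
  simp [encTab]

theorem table_left (w : List Bool) (α : Move) (E : List Entry) : ∀ (n : List Sym) (Ψ Φ : Position),
    Reaches (entryCfg dir .left d L (encTab E) n (bits w ++ .dot :: α) Ψ Φ)
      (entryCfg dir .left d L [] ((encTab (E.map (padAlong w))).reverse ++ n) (bits w ++ .dot :: α)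
        (Ψ ++ E.flatMap (leftOuts [.two, .dot] w α)) (Φ ++ E.flatMap (leftOuts [.two, .dot] w α))) := by
  induction E with
  | nil => intro n Ψ Φ; simpa [encTab] using Reaches.refl _
  | cons e E ih =>
    intro n Ψ Φ
    rw [encTab_cons]
    refine entryCfg_reaches.trans ((scan_left α e w _ n []).trans ?_)
    have h := ih ((padAlong w e).enc.reverse ++ n) (Ψ ++ leftOuts [.two, .dot] w α e)
      (Φ ++ leftOuts [.two, .dot] w α e)
    simpa [encTab_cons, Kind.digit, Sym.toKey] using h

theorem table_right_dot (u : List Bool) (α : Move) (E : List Entry) :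
    ∀ (n : List Sym) (Ψ Φ : Position),
    Reaches (entryCfg dir .right d L (encTab E) n (bits u ++ .dot :: α) Ψ Φ)
      (entryCfg dir .right d L [] ((encTab E).reverse ++ n) (bits u ++ .dot :: α)
        (Ψ ++ E.flatMap (rightOuts [.one, .dot] u α))
        (Φ ++ E.flatMap (rightOuts [.one, .dot] u α))) := by
  induction E with
  | nil => intro n Ψ Φ; simpa [encTab] using Reaches.refl _
  | cons e E ih =>
    intro n Ψ Φ
    rw [encTab_cons]
    refine entryCfg_reaches.trans ((scan_right_dot α e u _ n []).trans ?_)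
    have h := ih (e.enc.reverse ++ n) (Ψ ++ rightOuts [.one, .dot] u α e)
      (Φ ++ rightOuts [.one, .dot] u α e)
    simpa [encTab_cons, Kind.digit, Sym.toKey] using h

/-- The entries that replace an entry when the leaf `u` is replicated. -/
def splitEntry (u : List Bool) (e : Entry) : List Entry :=
  if e.leaf = u then [e ++ [some false], e ++ [some true]] else [e]

theorem table_right_colon (u : List Bool) (E : List Entry) : ∀ (n : List Sym) (Ψ Φ : Position),
    Reaches (entryCfg dir .right d L (encTab E) n (bits u ++ [.colon]) Ψ Φ)
      (entryCfg dir .right d L [] ((encTab (E.flatMap (splitEntry u))).reverse ++ n)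
        (bits u ++ [.colon]) Ψ Φ) := by
  induction E with
  | nil => intro n Ψ Φ; simpa [encTab] using Reaches.refl _
  | cons e E ih =>
    intro n Ψ Φ
    rw [encTab_cons]
    refine entryCfg_reaches.trans ?_
    by_cases he : e.leaf = u
    · have h1 := scan_right_colon_eq (dir := dir) (d := d) (L := L) (Ψ := Ψ) (Φ := Φ)
        (T := encTab E) e u [] n [] he
      -- The returned half is scanned again, but its leaf is now longer than `u`, so it is not split
      -- a second time.
      have h2 := scan_right_colon_ne (dir := dir) (d := d) (L := L) (Ψ := Ψ) (Φ := Φ)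
        (T := encTab E) (e ++ [some true]) u [.key .dot, .key .one]
        ((Entry.enc (e ++ [some false])).reverse ++ n) [] (by
          intro h
          have := congrArg List.length (h.trans he.symm)
          simp [Entry.leaf] at this)
      refine Reaches.trans h1 (entryCfg_reaches.trans (Reaches.trans h2 ?_))
      have h := ih ((Entry.enc (e ++ [some true])).reverse ++
        ((Entry.enc (e ++ [some false])).reverse ++ n)) Ψ Φ
      simpa [encTab_cons, encTab_append, splitEntry, he] using h
    · refine (scan_right_colon_ne e u _ n [] he).trans ?_
      have h := ih (e.enc.reverse ++ n) Ψ Φ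
      simpa [encTab_cons, encTab_append, splitEntry, he] using h

/-! ### Growing the tree until an address is a node -/

/-- The leaves into which a leaf `l` is split to make `l ++ s` a leaf. -/
def growLeaf : List Bool → List Bool → List (List Bool)
  | l, [] => [l]
  | l, b :: s => (l ++ [!b]) :: growLeaf (l ++ [b]) s

/-- The leaves that are replicated on the way from `l` to `l ++ s`. -/
def growPath : List Bool → List Bool → List (List Bool)
  | _, [] => []
  | l, b :: s => l :: growPath (l ++ [b]) s

open Classical in
/-- The leaves that replace `l` when `w` is to be made a node. -/
def expandLeaf (w l : List Bool) : List (List Bool) :=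
  if l <+: w then growLeaf l (w.drop l.length) else [l]

open Classical in
/-- The leaves that are replicated for `l` when `w` is to be made a node. -/
def expandPath (w l : List Bool) : List (List Bool) :=
  if l <+: w then growPath l (w.drop l.length) else []

/-- After each split the child on the way to the address lies on top of `tab`, so the next scan goes
one level deeper; the siblings pile up on `new`. -/
theorem table_grow (α : Move) (T : List Sym) (s : List Bool) :
    ∀ (l : List Bool) (n : List Sym) (Ψ Φ : Position),
    Reaches (entryCfg dir .expand d L ((bitEntry l).enc ++ T) n (bits (l ++ s) ++ .dot :: α) Ψ Φ)
      (entryCfg dir .expand d L T ((encTab ((growLeaf l s).map bitEntry)).reverse ++ n)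
        (bits (l ++ s) ++ .dot :: α) (Ψ ++ (growPath l s).map replOut)
        (Φ ++ (growPath l s).map replOut)) := by
  induction s with
  | nil =>
    intro l n Ψ Φ
    refine entryCfg_reaches.trans ?_
    have h := scan_expand_other (dir := dir) (d := d) (L := L) (Ψ := Ψ) (Φ := Φ) (T := T) α l
      l [.key .dot, .key .one] n [] (by simp)
    simpa [growLeaf, growPath, encTab, Kind.digit] using h
  | cons b s ih =>
    intro l n Ψ Φ
    refine entryCfg_reaches.trans ?_
    have h1 := scan_expand_prefix (dir := dir) (d := d) (L := L) (Ψ := Ψ) (Φ := Φ) (T := T) α b s l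
      [] n []
    refine Reaches.trans h1 ?_
    have h2 := ih (l ++ [b]) ((bitEntry (l ++ [!b])).enc.reverse ++ n) (Ψ ++ [replOut l])
      (Φ ++ [replOut l])
    simpa [growLeaf, growPath, encTab_cons] using h2

theorem table_expand (w : List Bool) (α : Move) (E : List (List Bool)) :
    ∀ (n : List Sym) (Ψ Φ : Position),
    Reaches (entryCfg dir .expand d L (encTab (E.map bitEntry)) n (bits w ++ .dot :: α) Ψ Φ)
      (entryCfg dir .expand d L [] ((encTab ((E.flatMap (expandLeaf w)).map bitEntry)).reverse ++ n)
        (bits w ++ .dot :: α) (Ψ ++ (E.flatMap (expandPath w)).map replOut)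
        (Φ ++ (E.flatMap (expandPath w)).map replOut)) := by
  induction E with
  | nil => intro n Ψ Φ; simpa [encTab] using Reaches.refl _
  | cons l E ih =>
    intro n Ψ Φ
    rw [List.map_cons, encTab_cons]
    by_cases hl : l <+: w
    · obtain ⟨s, rfl⟩ := hl
      refine (table_grow α _ s l n Ψ Φ).trans ?_
      have h := ih ((encTab ((growLeaf l s).map bitEntry)).reverse ++ n)
        (Ψ ++ (growPath l s).map replOut) (Φ ++ (growPath l s).map replOut)
      simpa [expandLeaf, expandPath, encTab_append] using h
    · refine entryCfg_reaches.trans ((scan_expand_other α l w _ n [] ?_).trans ?_)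
      · rintro b s rfl
        exact hl (List.prefix_append _ _)
      · have h := ih ((bitEntry l).enc.reverse ++ n) Ψ Φ
        simpa [expandLeaf, expandPath, encTab_cons, hl] using h

/-! ### Answering a move of the environment -/

/-- The control state in which permission is granted. -/
def restState : PState := PState.mk ([], .look)

theorem spell_cons (a : Labmove) (Φ : Position) :
    spell (a :: Φ) = .label a.1 :: (keys a.2 ++ spell Φ) := rfl

theorem spell_bot (m : Move) : spell [(Player.bot, m)] = .label .bot :: keys m := by
  simp [spell, keys]

theorem spell_nil : spell [] = [] := rfl

theorem rest_dig (t : List Sym) (Φ : Position) (c : Key) (m : Move) :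
    Reaches ((restCfg dir t Φ).grantNext restState (some (c :: m)))
      (cfg dir ([], .dig) [] t [] (.label .bot :: (spell Φ).reverse) (.key c :: keys m)
        (Φ ++ [(.bot, c :: m)])) := by
  have : (restCfg dir t Φ).grantNext restState (some (c :: m)) =
      cfg dir ([], .look) [] t [] (spell Φ).reverse (.label .bot :: keys (c :: m))
        (Φ ++ [(.bot, c :: m)]) := by
    simp [restCfg, Cfg.grantNext, cfg, spell_bot, restState]
  rw [this]
  exact reaches_exec (l := [.right]) rfl (by simp) rfl

/-- The end of a round: the table was processed. -/
theorem table_done {κ : Kind} (hκ : κ ≠ .expand) (t : List Sym) (m : Move) (Ψ Φ : Position) :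
    Reaches (entryCfg dir κ d (spell Φ).reverse [] t m Ψ (Φ ++ [(.bot, d :: .dot :: m)] ++ Ψ))
      (restCfg dir t.reverse (Φ ++ [(.bot, d :: .dot :: m)] ++ Ψ)) := by
  refine entryCfg_reaches.trans ((reaches_loop_nil κ).trans ?_)
  refine (reaches_popNew (l := []) (q' := .fin) rfl (by simp [hκ]) (by simp) rfl).trans ?_
  refine (reaches_fin _ _).trans ?_
  simpa [restCfg, spell_append, spell_cons, keys, Regs.set] using Reaches.refl _

theorem round_left (E : List Entry) (Φ : Position) (w : List Bool) (α : Move) :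
    Reaches ((restCfg true (encTab E) Φ).grantNext restState
        (some (compPre false ++ addrMove w α)))
      (restCfg true (encTab (E.map (padAlong w))) (Φ ++ [(.bot, compPre false ++ addrMove w α)] ++
        E.flatMap (leftOuts [.two, .dot] w α))) := by
  refine (rest_dig _ Φ .one (.dot :: addrMove w α)).trans ?_
  refine (reaches_exec (l := [.right, .right]) (q' := .entry .left) rfl (by simp) rfl).trans ?_
  have h1 := table_left (dir := true) (d := .one) (L := (spell Φ).reverse) w α E [] []
    (Φ ++ [(.bot, compPre false ++ addrMove w α)])
  have h2 := table_done (dir := true) (d := .one) (κ := .left) (by simp)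
    ((encTab (E.map (padAlong w))).reverse ++ []) (bits w ++ .dot :: α)
    (E.flatMap (leftOuts [.two, .dot] w α)) Φ
  have h := Reaches.trans h1 h2
  simpa [entryCfg, spell_nil, addrMove, keys, compPre] using h

theorem round_right_dot (E : List Entry) (Φ : Position) (u : List Bool) (α : Move) :
    Reaches ((restCfg true (encTab E) Φ).grantNext restState
        (some (compPre true ++ addrMove u α)))
      (restCfg true (encTab E) (Φ ++ [(.bot, compPre true ++ addrMove u α)] ++
        E.flatMap (rightOuts [.one, .dot] u α))) := by
  refine (rest_dig _ Φ .two (.dot :: addrMove u α)).trans ?_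
  refine (reaches_exec (l := [.right, .right]) (q' := .entry .right) rfl (by simp) rfl).trans ?_
  have h1 := table_right_dot (dir := true) (d := .two) (L := (spell Φ).reverse) u α E [] []
    (Φ ++ [(.bot, compPre true ++ addrMove u α)])
  have h2 := table_done (dir := true) (d := .two) (κ := .right) (by simp)
    ((encTab E).reverse ++ []) (bits u ++ .dot :: α)
    (E.flatMap (rightOuts [.one, .dot] u α)) Φ
  have h := Reaches.trans h1 h2
  simpa [entryCfg, spell_nil, addrMove, keys, compPre] using h

theorem round_right_colon (E : List Entry) (Φ : Position) (u : List Bool) :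
    Reaches ((restCfg true (encTab E) Φ).grantNext restState (some (compPre true ++ replMove u)))
      (restCfg true (encTab (E.flatMap (splitEntry u)))
        (Φ ++ [(.bot, compPre true ++ replMove u)])) := by
  refine (rest_dig _ Φ .two (.dot :: replMove u)).trans ?_
  refine (reaches_exec (l := [.right, .right]) (q' := .entry .right) rfl (by simp) rfl).trans ?_
  have h1 := table_right_colon (dir := true) (d := .two) (L := (spell Φ).reverse) u E [] []
    (Φ ++ [(.bot, compPre true ++ replMove u)])
  have h2 := table_done (dir := true) (d := .two) (κ := .right) (by simp)
    ((encTab (E.flatMap (splitEntry u))).reverse ++ []) (bits u ++ [.colon]) [] Φ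
  rw [List.append_nil (Φ ++ _)] at h2
  have h := Reaches.trans h1 h2
  simpa [entryCfg, spell_nil, replMove, keys, compPre] using h

/-- The table is left alone: the environment's move is repeated with only its component digit
changed. -/
theorem round_copy (E : List (List Bool)) (Φ : Position) (w : List Bool) (α : Move) :
    Reaches ((restCfg false (encTab (E.map bitEntry)) Φ).grantNext restState
        (some (compPre false ++ addrMove w α)))
      (restCfg false (encTab (E.map bitEntry)) (Φ ++ [(.bot, compPre false ++ addrMove w α)] ++
        [(.top, compPre true ++ addrMove w α)])) := by
  refine (rest_dig _ Φ .one (.dot :: addrMove w α)).trans ?_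
  refine (reaches_exec (l := [.push .out (.key .two), .right]) (q' := .copy none) rfl (by simp)
    rfl).trans ?_
  have h := reaches_copy (dir := false) (t := encTab (E.map bitEntry)) (n := [])
    (Φ := Φ ++ [(.bot, compPre false ++ addrMove w α)]) none [] (by simp) (.dot :: addrMove w α)
    [.key .two] (.key .one :: .label .bot :: (spell Φ).reverse)
  rw [List.append_nil] at h
  refine Reaches.trans h (reaches_clear_none.trans ?_)
  rw [emitted_append]
  simpa [restCfg, spell_append, spell_cons, spell_nil, keys, compPre, Sym.toKey] using Reaches.refl _

theorem round_expand (E : List (List Bool)) (Φ : Position) (w : List Bool) (α : Move) :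
    Reaches ((restCfg false (encTab (E.map bitEntry)) Φ).grantNext restState
        (some (compPre true ++ addrMove w α)))
      (restCfg false (encTab ((E.flatMap (expandLeaf w)).map bitEntry))
        (Φ ++ [(.bot, compPre true ++ addrMove w α)] ++ (E.flatMap (expandPath w)).map replOut ++
          [(.top, compPre false ++ addrMove w α)])) := by
  refine (rest_dig _ Φ .two (.dot :: addrMove w α)).trans ?_
  refine (reaches_exec (l := [.right, .right]) (q' := .entry .expand) rfl (by simp) rfl).trans ?_
  have h1 := table_expand (dir := false) (d := .two) (L := (spell Φ).reverse) w α E [] []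
    (Φ ++ [(.bot, compPre true ++ addrMove w α)])
  rw [entryCfg, spell_nil, List.append_nil] at h1
  refine Reaches.trans h1 ?_
  refine entryCfg_reaches.trans ((reaches_loop_nil .expand).trans ?_)
  refine (reaches_popNew (l := [.push .out (.key .one), .left]) (q' := .copy none) rfl rfl
    (by simp) rfl).trans ?_
  have h := reaches_copy (dir := false)
    (t := encTab ((E.flatMap (expandLeaf w)).map bitEntry)) (n := [])
    (Φ := Φ ++ [(.bot, compPre true ++ addrMove w α)] ++ (E.flatMap (expandPath w)).map replOut)
    none (spell ((E.flatMap (expandPath w)).map replOut)) (spell_head_ne_key _) (.dot :: addrMove w α)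
    [.key .one] (.key .two :: .label .bot :: (spell Φ).reverse)
  have h' := Reaches.trans h reaches_clear_none
  rw [emitted_append] at h'
  simpa [restCfg, spell_append, spell_cons, spell_nil, keys, compPre, Sym.toKey, Regs.set,
    Regs.get, addrMove]
    using h'

theorem rest_none (t : List Sym) (Φ : Position) :
    Reaches ((restCfg dir t Φ).grantNext restState none) (restCfg dir t Φ) := by
  have : (restCfg dir t Φ).grantNext restState none = restCfg dir t Φ := by
    simp [restCfg, Cfg.grantNext, cfg, restState, spell]
  rw [this]
  exact .refl _

theorem init_rest : Reaches (machine dir).init (restCfg dir (encTab [[]]) []) :=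
  reaches_exec (dir := dir) (q := .start) (R := []) (l := [.push .tab sep]) rfl (by simp) rfl

end CoL

namespace CoL

/-! ### Negation of games and of formulas -/

/-- An initial segment outside `L` of least length is nonempty, and its last labmove names the
culprit. -/
theorem exists_illegalBy {L : Set Run} (hL : PrefixDetermined L) {Γ : Run} (h : Γ ∉ L) :
    ∃ p, IllegalBy L p Γ := by
  classical
  have hex : ∃ k, ∃ Φ : Position, IsInitial Φ Γ ∧ (Φ : Run) ∉ L ∧ Φ.length = k := by
    by_contra hc
    push Not at hc
    exact h ((hL Γ).2 fun Φ hΦ _ => by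
      by_contra hn
      exact hc _ Φ hΦ hn rfl)
  obtain ⟨Φ, h1, h2, h3⟩ := Nat.find_spec hex
  rcases List.eq_nil_or_concat' Φ with rfl | ⟨Ψ, ⟨p, α⟩, rfl⟩
  · exact absurd hL.nil_mem h2
  · refine ⟨p, Ψ, α, h1, fun Θ hΘ => ?_, h2⟩
    by_contra hn
    refine Nat.find_min hex (m := Θ.length) ?_
      ⟨Θ, IsInitial.trans (hΘ.trans (List.prefix_append _ _)) h1, hn, rfl⟩
    rw [← h3, List.length_append, List.length_singleton]
    have := hΘ.length_le
    omega

/-- The legal runs already determine the winner of every illegal run. -/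
theorem Game.ext_of_legal {A B : Game} (h : A.Lr = B.Lr) (hW : ∀ Γ ∈ A.Lr, A.Wn Γ = B.Wn Γ) :
    A = B := by
  refine Game.ext h (funext fun Γ => ?_)
  by_cases hΓ : Γ ∈ A.Lr
  · exact hW Γ hΓ
  · obtain ⟨p, hp⟩ := exists_illegalBy A.prefixDetermined hΓ
    rw [A.wn_of_illegalBy p Γ hp, B.wn_of_illegalBy p Γ (h ▸ hp)]

theorem Game.wn_ofLegal {L : Set Run} (hL : PrefixDetermined L) (W : Run → Prop) {Γ : Run}
    (h : Γ ∈ L) : (Game.ofLegal L hL W).Wn Γ = .top ↔ W Γ := by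
  simp only [Game.ofLegal, if_pos h]
  split_ifs <;> simp_all

theorem Player.neg_eq_top {p : Player} : p.neg = .top ↔ p ≠ .top := by
  cases p <;> simp [Player.neg]

theorem Player.eq_of_top_iff {p q : Player} (h : p = .top ↔ q = .top) : p = q := by
  cases p <;> cases q <;> simp_all

theorem Game.neg_neg (A : Game) : A.neg.neg = A := by
  refine Game.ext ?_ (funext fun Γ => ?_)
  · ext Γ
    change Γ.neg.neg ∈ A.Lr ↔ _
    rw [Run.neg_neg]
  · change (A.Wn Γ.neg.neg).neg.neg = _
    rw [Run.neg_neg, Player.neg_neg]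

theorem Game.neg_ofLegal {L L' : Set Run} (hL : PrefixDetermined L) (hL' : PrefixDetermined L')
    {W W' : Run → Prop} (h : ∀ Γ, Γ ∈ L' ↔ Γ.neg ∈ L) (hW : ∀ Γ, W' Γ ↔ ¬ W Γ.neg) :
    (Game.ofLegal L hL W).neg = Game.ofLegal L' hL' W' := by
  refine Game.ext_of_legal (Set.ext fun Γ => (h Γ).symm) fun Γ hΓ => ?_
  apply Player.eq_of_top_iff
  rw [Game.wn_ofLegal hL' W' ((h Γ).2 hΓ), hW, ← Game.wn_ofLegal hL W hΓ]
  exact Player.neg_eq_top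

theorem limitRun_neg (P : ℕ → Position) :
    (limitRun P).neg = limitRun fun n => Position.neg (P n) := by
  classical
  apply Stream'.Seq.ext
  intro k
  have hlen : ∀ n, (Position.neg (P n)).length = (P n).length := fun n => by simp [Position.neg]
  change Option.map _ (if h : ∃ n, k < (P n).length then (P (Nat.find h))[k]? else none) =
    if h : ∃ n, k < (Position.neg (P n)).length then (Position.neg (P (Nat.find h)))[k]? else none
  -- Negation keeps lengths, so both limits look up the same member of the sequence.
  simp only [hlen]
  split_ifs with h
  · simp [Position.neg]
  · rfl

theorem Run.take_neg (Γ : Run) (n : ℕ) : Γ.neg.take n = Position.neg (Γ.take n) := by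
  apply List.ext_getElem?
  intro i
  rw [Stream'.Seq.getElem?_take, Position.neg, List.getElem?_map, Stream'.Seq.getElem?_take,
    Run.neg, Stream'.Seq.map_get?]
  split_ifs <;> rfl

/-- Labels play no role in the selection of the labmoves. -/
def NegEquivariant (g : Labmove → Option Labmove) : Prop :=
  ∀ a, g (a.1.neg, a.2) = (g a).map fun b => (b.1.neg, b.2)

theorem NegEquivariant.filterMap_neg {g : Labmove → Option Labmove} (hg : NegEquivariant g)
    (Φ : Position) : (Position.neg Φ).filterMap g = Position.neg (Φ.filterMap g) := by
  simp only [Position.neg, List.filterMap_map, List.map_filterMap]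
  congr 1
  funext a
  exact hg a

theorem NegEquivariant.run_filterMap_neg {g : Labmove → Option Labmove} (hg : NegEquivariant g)
    (Γ : Run) : Run.filterMap g Γ.neg = (Run.filterMap g Γ).neg := by
  unfold Run.filterMap
  rw [limitRun_neg]
  simp only [Run.take_neg, hg.filterMap_neg]

/-- Keep the labmoves with the prefix `p`, and delete that prefix. -/
def subMap (p : Move) (a : Labmove) : Option Labmove := (dropPre p a.2).map fun β => (a.1, β)

theorem negEquivariant_subMap (p : Move) : NegEquivariant (subMap p) := fun a => by
  simp [subMap, Function.comp_def]

theorem negEquivariant_threadMap (x : Bitstream) : NegEquivariant (threadMap x) := fun a => by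
  unfold threadMap
  rcases parseAddr a.2 with _ | ⟨u, β⟩
  · rfl
  · simp only
    split_ifs <;> rfl

theorem Run.sub_neg (p : Move) (Γ : Run) : Γ.neg.sub p = (Γ.sub p).neg :=
  (negEquivariant_subMap p).run_filterMap_neg Γ

theorem Run.thread_neg (x : Bitstream) (Γ : Run) : Γ.neg.thread x = (Γ.thread x).neg :=
  (negEquivariant_threadMap x).run_filterMap_neg Γ

theorem Run.forall_mem_neg (p : Move → Prop) (Γ : Run) :
    (∀ a ∈ Γ.neg, p a.2) ↔ ∀ a ∈ Γ, p a.2 := by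
  simp only [Stream'.Seq.mem_iff_exists_get?, Run.neg, Stream'.Seq.map_get?]
  constructor
  · rintro h a ⟨i, hi⟩
    exact h (a.1.neg, a.2) ⟨i, by rw [← hi]; rfl⟩
  · rintro h a ⟨i, hi⟩
    obtain ⟨b, hb, rfl⟩ := Option.map_eq_some_iff.1 hi.symm
    exact h b ⟨i, hb.symm⟩

theorem parLr_neg (A B : Game) (Γ : Run) :
    Γ ∈ parLr (fun i => if i then B.neg else A.neg) ↔
      Γ.neg ∈ parLr (fun i => if i then B else A) := by
  have h := Run.forall_mem_neg (fun m => ∃ i α, m = compPre i ++ α) Γ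
  refine and_congr h.symm (forall_congr' fun i => ?_)
  cases i <;> simp only [Run.sub_neg] <;> rfl

theorem branchLr_neg (A : Game) (Γ : Run) : Γ ∈ branchLr A.neg ↔ Γ.neg ∈ branchLr A := by
  have h := Run.forall_mem_neg (fun m => ∃ w α, m = addrMove w α) Γ
  refine and_congr h.symm (forall_congr' fun x => ?_)
  rw [Run.thread_neg]
  rfl

theorem Game.wn_neg_eq_top (A : Game) (Γ : Run) : A.neg.Wn Γ = .top ↔ A.Wn Γ.neg ≠ .top :=
  Player.neg_eq_top

theorem Game.and_neg (A B : Game) : (A.and B).neg = A.neg.or B.neg :=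
  Game.neg_ofLegal _ _ (parLr_neg A B) fun Γ => by
    rw [Run.sub_neg, Run.sub_neg, wn_neg_eq_top, wn_neg_eq_top, not_and_or]

theorem Game.or_neg (A B : Game) : (A.or B).neg = A.neg.and B.neg :=
  Game.neg_ofLegal _ _ (parLr_neg A B) fun Γ => by
    rw [Run.sub_neg, Run.sub_neg, wn_neg_eq_top, wn_neg_eq_top, not_or]

theorem Game.st_neg (A : Game) : A.st.neg = A.neg.cost :=
  Game.neg_ofLegal _ _ (branchLr_neg A) fun Γ => by
    simp only [Run.thread_neg, wn_neg_eq_top, not_forall]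

theorem Game.cost_neg (A : Game) : A.cost.neg = A.neg.st :=
  Game.neg_ofLegal _ _ (branchLr_neg A) fun Γ => by
    simp only [Run.thread_neg, wn_neg_eq_top, not_exists]

theorem Game.cstL_neg (A : Game) : A.cstL.neg = A.neg.ccostL :=
  Game.neg_ofLegal _ _ (branchLr_neg A) fun Γ => by
    simp only [Run.thread_neg, wn_neg_eq_top, not_forall, exists_prop]

theorem Game.ccostL_neg (A : Game) : A.ccostL.neg = A.neg.cstL :=
  Game.neg_ofLegal _ _ (branchLr_neg A) fun Γ => by
    simp only [Run.thread_neg, wn_neg_eq_top, not_exists, not_and]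

/-- Justifies treating `F → G` as a disjunction with the negated game of `F`. The cases of the old
recurrence need only double negation, because its corecurrence is defined as a dual. -/
theorem Formula.interp_neg {Atom : Type*} (I : Atom → Game) (F : Formula Atom) :
    F.neg.interp I = (F.interp I).neg := by
  induction F with
  | atom P => rfl
  | natom P => exact (Game.neg_neg _).symm
  | and F G hF hG => simp only [Formula.neg, Formula.interp, hF, hG, Game.and_neg]
  | or F G hF hG => simp only [Formula.neg, Formula.interp, hF, hG, Game.or_neg]
  | st F hF => simp only [Formula.neg, Formula.interp, hF, Game.st_neg]
  | cost F hF => simp only [Formula.neg, Formula.interp, hF, Game.cost_neg]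
  | cstT F hF => simp only [Formula.neg, Formula.interp, hF, Game.ccostT, Game.neg_neg]
  | ccostT F hF => simp only [Formula.neg, Formula.interp, hF, Game.ccostT, Game.neg_neg]
  | cstL F hF => simp only [Formula.neg, Formula.interp, hF, Game.cstL_neg]
  | ccostL F hF => simp only [Formula.neg, Formula.interp, hF, Game.ccostL_neg]

/-! ### Positions of an implication -/

/-- The position in the antecedent, from the point of view of its environment. -/
def lpos (Φ : Position) : Position := Position.neg (Φ.filterMap (subMap (compPre false)))

/-- The position in the consequent. -/
def rpos (Φ : Position) : Position := Φ.filterMap (subMap (compPre true))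

/-- The position in the thread `x`. -/
def tpos (x : Bitstream) (Φ : Position) : Position := Φ.filterMap (threadMap x)

theorem subMap_same (i : Bool) (p : Player) (m : Move) :
    subMap (compPre i) (p, compPre i ++ m) = some (p, m) := by
  simp [subMap, dropPre]

theorem subMap_other (i : Bool) (p : Player) (m : Move) :
    subMap (compPre i) (p, compPre (!i) ++ m) = none := by
  cases i <;> simp [subMap, dropPre, compPre]

theorem lpos_append (Φ Ψ : Position) : lpos (Φ ++ Ψ) = lpos Φ ++ lpos Ψ := by
  simp [lpos, Position.neg]

theorem rpos_append (Φ Ψ : Position) : rpos (Φ ++ Ψ) = rpos Φ ++ rpos Ψ := by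
  simp [rpos]

theorem tpos_append (x : Bitstream) (Φ Ψ : Position) : tpos x (Φ ++ Ψ) = tpos x Φ ++ tpos x Ψ := by
  simp [tpos]

theorem lpos_map_left {ι : Type*} (S : List ι) (p : Player) (m : ι → Move) :
    lpos (S.map fun e => (p, compPre false ++ m e)) = S.map fun e => (p.neg, m e) := by
  simp [lpos, Position.neg, List.filterMap_map, Function.comp_def, subMap_same]

theorem lpos_map_right {ι : Type*} (S : List ι) (p : Player) (m : ι → Move) :
    lpos (S.map fun e => (p, compPre true ++ m e)) = [] := by
  simp only [lpos, Position.neg, List.filterMap_map, List.map_eq_nil_iff, List.filterMap_eq_nil_iff]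
  exact fun a _ => subMap_other false p (m a)

theorem rpos_map_left {ι : Type*} (S : List ι) (p : Player) (m : ι → Move) :
    rpos (S.map fun e => (p, compPre false ++ m e)) = [] := by
  simp only [rpos, List.filterMap_map, List.filterMap_eq_nil_iff]
  exact fun a _ => subMap_other true p (m a)

theorem rpos_map_right {ι : Type*} (S : List ι) (p : Player) (m : ι → Move) :
    rpos (S.map fun e => (p, compPre true ++ m e)) = S.map fun e => (p, m e) := by
  simp [rpos, List.filterMap_map, subMap_same]

theorem lpos_left (p : Player) (m : Move) : lpos [(p, compPre false ++ m)] = [(p.neg, m)] :=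
  lpos_map_left [()] p fun _ => m

theorem lpos_right (p : Player) (m : Move) : lpos [(p, compPre true ++ m)] = [] :=
  lpos_map_right [()] p fun _ => m

theorem rpos_left (p : Player) (m : Move) : rpos [(p, compPre false ++ m)] = [] :=
  rpos_map_left [()] p fun _ => m

theorem rpos_right (p : Player) (m : Move) : rpos [(p, compPre true ++ m)] = [(p, m)] :=
  rpos_map_right [()] p fun _ => m

open Classical in
theorem tpos_addr (x : Bitstream) (p : Player) (w : List Bool) (α : Move) :
    tpos x [(p, addrMove w α)] = if IsPre w x then [(p, α)] else [] := by
  by_cases h : IsPre w x <;> simp [tpos, threadMap, parseAddr_addrMove, h]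

theorem parseAddr_replMove (w : List Bool) : parseAddr (replMove w) = none := by
  induction w with
  | nil => rfl
  | cons b w ih => cases b <;> simpa [replMove, bits, bitKey, parseAddr] using ih

theorem tpos_repl (x : Bitstream) (S : List (List Bool)) (p : Player) :
    tpos x (S.map fun l => (p, replMove l)) = [] := by
  simp [tpos, threadMap, parseAddr_replMove]

/-! ### Legal positions -/

theorem mem_imp_Lr {C D : Game} {Φ : Position} :
    (Φ : Run) ∈ (C.neg.or D).Lr ↔ (∀ a ∈ Φ, ∃ i α, a.2 = compPre i ++ α) ∧
      (lpos Φ : Run) ∈ C.Lr ∧ (rpos Φ : Run) ∈ D.Lr := by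
  change ((∀ a ∈ (Φ : Run), ∃ i α, a.2 = compPre i ++ α) ∧
    ∀ i, Run.filterMap (subMap (compPre i)) (Φ : Run) ∈ (if i then D else C.neg).Lr) ↔ _
  refine and_congr (by simp [Stream'.Seq.mem_iff_exists_get?, List.mem_iff_getElem?, eq_comm]) ?_
  simp only [Run.filterMap_ofList, Bool.forall_bool, if_true, Bool.false_eq_true, if_false]
  refine and_congr ?_ Iff.rfl
  change Run.neg _ ∈ C.Lr ↔ _
  rw [Run.neg_ofList]
  rfl

theorem mem_cstL_Lr {A : Game} {Φ : Position} :
    (Φ : Run) ∈ A.cstL.Lr ↔ (∀ a ∈ Φ, ∃ w α, a.2 = addrMove w α) ∧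
      ∀ x, (tpos x Φ : Run) ∈ A.Lr := by
  change ((∀ a ∈ (Φ : Run), ∃ w α, a.2 = addrMove w α) ∧
    ∀ x, Run.filterMap (threadMap x) (Φ : Run) ∈ A.Lr) ↔ _
  simp only [Run.filterMap_ofList]
  exact and_congr (by simp [Stream'.Seq.mem_iff_exists_get?, List.mem_iff_getElem?, eq_comm]) Iff.rfl

theorem mem_cstT_Lr_append {A : Game} {Φ : Position} {a : Labmove} :
    ((Φ ++ [a] : Position) : Run) ∈ A.cstT.Lr ↔ (Φ : Run) ∈ A.cstT.Lr ∧ OldLegalMove A Φ a := by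
  change (∀ Ψ b, IsInitial (Ψ ++ [b]) ((Φ ++ [a] : Position) : Run) → OldLegalMove A Ψ b) ↔
    (∀ Ψ b, IsInitial (Ψ ++ [b]) (Φ : Run) → OldLegalMove A Ψ b) ∧ _
  simp only [isInitial_ofList]
  constructor
  · exact fun h => ⟨fun Ψ b hb => h Ψ b (hb.trans (List.prefix_append _ _)), h _ _ List.prefix_rfl⟩
  · rintro ⟨h1, h2⟩ Ψ b hb
    rcases List.prefix_concat_iff.1 hb with h | h
    · obtain ⟨rfl, h⟩ := List.append_inj' h rfl
      obtain rfl : b = a := by simpa using h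
      exact h2
    · exact h1 Ψ b h

/-- Old legality, though given move by move, yields the threadwise condition of the new recurrence;
this is how legality is transferred when moves are copied. -/
theorem tpos_mem_of_cstT {A : Game} {Φ : Position} (h : (Φ : Run) ∈ A.cstT.Lr) (x : Bitstream) :
    (tpos x Φ : Run) ∈ A.Lr := by
  induction Φ using List.reverseRecOn with
  | nil => exact A.prefixDetermined.nil_mem
  | append_singleton Φ a ih =>
    obtain ⟨h1, h2⟩ := mem_cstT_Lr_append.1 h
    obtain ⟨p, m⟩ := a
    rw [tpos_append]
    rcases h2 with ⟨-, w, -, hw⟩ | ⟨w, α, hw, -, hv⟩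
    · obtain rfl : m = replMove w := hw
      have := tpos_repl x [w] p
      simp only [List.map_cons, List.map_nil] at this
      rw [this, List.append_nil]
      exact ih h1
    · obtain rfl : m = addrMove w α := hw
      rw [tpos_addr]
      split_ifs with hx
      · exact hv x hx
      · rw [List.append_nil]
        exact ih h1

/-! ### Won runs -/

/-- Selecting labmoves commutes with limits, so the threads of an infinite play can be compared
position by position. -/
theorem filterMap_limitRun {P : ℕ → Position} (hP : ∀ m n, m ≤ n → P m <+: P n)
    (g : Labmove → Option Labmove) :
    Run.filterMap g (limitRun P) = limitRun fun n => (P n).filterMap g := by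
  refine limitRun_ext (filterMap_take_mono g _) (fun m n h => (hP m n h).filterMap g)
    (fun n => ?_) fun n => ?_
  · obtain ⟨m, hm⟩ := prefix_of_isInitial_limitRun hP (isInitial_take (limitRun P) n)
    exact ⟨m, hm.filterMap g⟩
  · obtain ⟨m, hm⟩ := isInitial_limitRun hP n
    exact ⟨m, by rw [hm]⟩

theorem limitRun_mem {L : Set Run} (hL : PrefixDetermined L) {P : ℕ → Position}
    (hP : ∀ m n, m ≤ n → P m <+: P n) (h : ∀ n, (P n : Run) ∈ L) : limitRun P ∈ L :=
  (hL _).2 fun _ hΦ _ =>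
    let ⟨n, hn⟩ := prefix_of_isInitial_limitRun hP hΦ
    hL.of_prefix hn (h n)

/-- An implication between two countable recurrences of `A` is won if every essentially finite
thread of the consequent proceeds like some essentially finite thread of the antecedent. -/
theorem wn_imp_limitRun {A C D : Game}
    (hC : ∀ Γ ∈ C.Lr, C.Wn Γ = .top ↔ ∀ v, EssFin v → A.Wn (Γ.thread v) = .top)
    (hD : ∀ Γ ∈ D.Lr, D.Wn Γ = .top ↔ ∀ v, EssFin v → A.Wn (Γ.thread v) = .top)
    {P : ℕ → Position} (hP : ∀ m n, m ≤ n → P m <+: P n)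
    (hleg : ∀ n, (P n : Run) ∈ (C.neg.or D).Lr)
    (h : ∀ v, EssFin v → ∃ v', EssFin v' ∧ ∀ n, tpos v' (lpos (P n)) = tpos v (rpos (P n))) :
    (C.neg.or D).Wn (limitRun P) = .top := by
  have hΓ : limitRun P ∈ (C.neg.or D).Lr :=
    limitRun_mem (C.neg.or D).prefixDetermined hP hleg
  refine (Game.wn_ofLegal _ _ hΓ).2 ?_
  have h1 : ((limitRun P).sub (compPre false)).neg ∈ C.Lr := hΓ.2 false
  have h2 : (limitRun P).sub (compPre true) ∈ D.Lr := hΓ.2 true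
  rw [Game.wn_neg_eq_top, Ne, hC _ h1, hD _ h2, or_iff_not_imp_left, not_not]
  intro hwin v hv
  obtain ⟨v', hv', he⟩ := h v hv
  have h3 : ((limitRun P).sub (compPre false)).neg = limitRun fun n => lpos (P n) := by
    rw [Run.sub, filterMap_limitRun hP, limitRun_neg]
    rfl
  have h4 : (limitRun P).sub (compPre true) = limitRun fun n => rpos (P n) :=
    filterMap_limitRun hP _
  have hl : ∀ m n, m ≤ n → lpos (P m) <+: lpos (P n) := fun m n h =>
    ((hP m n h).filterMap _).map _
  have hr : ∀ m n, m ≤ n → rpos (P m) <+: rpos (P n) := fun m n h => (hP m n h).filterMap _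
  have h5 := hwin v' hv'
  rw [h3, Run.thread, filterMap_limitRun hl] at h5
  rw [h4, Run.thread, filterMap_limitRun hr, ← h5]
  congr 2
  funext n
  exact (he n).symm

theorem wn_cstL {A : Game} (Γ : Run) (h : Γ ∈ A.cstL.Lr) :
    A.cstL.Wn Γ = .top ↔ ∀ v, EssFin v → A.Wn (Γ.thread v) = .top := Game.wn_ofLegal _ _ h

theorem wn_cstT {A : Game} (Γ : Run) (h : Γ ∈ A.cstT.Lr) :
    A.cstT.Wn Γ = .top ↔ ∀ v, EssFin v → A.Wn (Γ.thread v) = .top := Game.wn_ofLegal _ _ h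

end CoL

namespace CoL

/-! ### Initial segments of infinite bitstrings -/

theorem IsPre.of_prefix {u w : List Bool} {x : Bitstream} (h : u <+: w) (hw : IsPre w x) :
    IsPre u x := fun i hi => by
  rw [h.getElem hi]
  exact hw i _

theorem IsPre.total {u w : List Bool} {x : Bitstream} (hu : IsPre u x) (hw : IsPre w x) :
    u <+: w ∨ w <+: u := by
  have key : ∀ {u w : List Bool}, IsPre u x → IsPre w x → u.length ≤ w.length → u <+: w := by
    intro u w hu hw h
    rw [List.prefix_iff_getElem]
    exact ⟨h, fun i hi => (hu i hi).trans (hw i _).symm⟩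
  exact (le_total u.length w.length).imp (key hu hw) (key hw hu)

theorem exists_isPre (w : List Bool) : ∃ x, IsPre w x :=
  ⟨fun i => w.getD i false, fun i hi => by simp [hi]⟩

theorem IsPre.concat {w : List Bool} {x : Bitstream} (h : IsPre w x) :
    IsPre (w ++ [x w.length]) x := by
  intro i hi
  rw [List.getElem_append]
  split_ifs with hi'
  · exact h i hi'
  · rw [List.length_append, List.length_singleton] at hi
    obtain rfl : i = w.length := by omega
    simp

theorem isPre_nil (x : Bitstream) : IsPre [] x := fun i hi => by simp at hi

/-- Neither of two bitstrings is a prefix of the other. -/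
def Incomp (u w : List Bool) : Prop := ¬ u <+: w ∧ ¬ w <+: u

theorem Incomp.symm {u w : List Bool} (h : Incomp u w) : Incomp w u := And.symm h

instance : Std.Symm Incomp := ⟨fun _ _ h => h.symm⟩

theorem Incomp.not_isPre {u w : List Bool} {x : Bitstream} (h : Incomp u w) (hu : IsPre u x) :
    ¬ IsPre w x := fun hw => (hu.total hw).elim h.1 h.2

/-- If the extensions were comparable, an infinite bitstring through the longer one would pass
through both original strings. -/
theorem Incomp.of_prefix {u u' w w' : List Bool} (h : Incomp u w) (hu : u <+: u')
    (hw : w <+: w') : Incomp u' w' := by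
  obtain ⟨x, hx⟩ := exists_isPre u'
  obtain ⟨y, hy⟩ := exists_isPre w'
  exact ⟨fun hc => (h.not_isPre (hy.of_prefix hc |>.of_prefix hu)) (hy.of_prefix hw),
    fun hc => (h.not_isPre (hx.of_prefix hu)) (hx.of_prefix hc |>.of_prefix hw)⟩

theorem incomp_concat (l : List Bool) (b : Bool) : Incomp (l ++ [b]) (l ++ [!b]) := by
  constructor <;> intro h <;> have := h.eq_of_length (by simp) <;> simp at this

/-! ### The tree of a position of the old recurrence -/

theorem addrMove_ne_replMove (w u : List Bool) (α : Move) : addrMove w α ≠ replMove u := fun h => by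
  have := parseAddr_addrMove w α
  rw [h, parseAddr_replMove] at this
  simp at this

theorem replMove_inj {u w : List Bool} (h : replMove u = replMove w) : u = w := by
  have h1 : bits u = bits w := List.append_cancel_right h
  exact List.map_injective_iff.2 (fun a b h => bitKey_inj.1 h) h1

/-- The bitstrings in the list `E` are the leaves of the tree of the position `T`. -/
structure Tree (T : Position) (E : List (List Bool)) : Prop where
  isNode_iff : ∀ w, IsNode T w ↔ ∃ l ∈ E, w <+: l
  incomp : E.Pairwise Incomp
  cover : ∀ x, ∃ l ∈ E, IsPre l x

theorem tree_nil : Tree [] [[]] where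
  isNode_iff w := by simp [IsNode]
  incomp := List.pairwise_singleton _ _
  cover x := ⟨[], by simp, isPre_nil x⟩

variable {T : Position} {E E' : List (List Bool)}

theorem Tree.perm (h : Tree T E) (hE : E.Perm E') : Tree T E' where
  isNode_iff w := by simp only [h.isNode_iff, hE.mem_iff]
  incomp := h.incomp.perm hE fun h => h.symm
  cover x := by simpa only [hE.mem_iff] using h.cover x

theorem Tree.eq_of_isPre (h : Tree T E) {x : Bitstream} {l l' : List Bool} (hl : l ∈ E)
    (hl' : l' ∈ E) (hx : IsPre l x) (hx' : IsPre l' x) : l = l' := by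
  by_contra hne
  exact (h.incomp.forall hl hl' hne).not_isPre hx hx'

theorem Tree.isLeaf_iff (h : Tree T E) {w : List Bool} : IsLeaf T w ↔ w ∈ E := by
  constructor
  · rintro ⟨h1, h2⟩
    obtain ⟨l, hl, hwl⟩ := (h.isNode_iff w).1 h1
    rwa [← h2 l ((h.isNode_iff l).2 ⟨l, hl, List.prefix_rfl⟩) hwl]
  · intro hw
    refine ⟨(h.isNode_iff w).2 ⟨w, hw, List.prefix_rfl⟩, fun w' hw' hp => ?_⟩
    obtain ⟨l, hl, hl'⟩ := (h.isNode_iff w').1 hw'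
    obtain ⟨x, hx⟩ := exists_isPre l
    obtain rfl := h.eq_of_isPre hw hl (hx.of_prefix (hp.trans hl')) hx
    exact hl'.eq_of_length (le_antisymm hl'.length_le hp.length_le)

theorem isNode_append {Ψ : Position} {w : List Bool} :
    IsNode (T ++ Ψ) w ↔ IsNode T w ∨ IsNode Ψ w := by
  constructor
  · rintro (h | ⟨u, b, rfl, a, ha, h⟩)
    · exact Or.inl (Or.inl h)
    · exact (List.mem_append.1 ha).imp (fun ha => Or.inr ⟨u, b, rfl, a, ha, h⟩)
        fun ha => Or.inr ⟨u, b, rfl, a, ha, h⟩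
  · rintro ((h | ⟨u, b, rfl, a, ha, h⟩) | (h | ⟨u, b, rfl, a, ha, h⟩))
    · exact Or.inl h
    · exact Or.inr ⟨u, b, rfl, a, List.mem_append_left _ ha, h⟩
    · exact Or.inl h
    · exact Or.inr ⟨u, b, rfl, a, List.mem_append_right _ ha, h⟩

theorem Tree.append_of_forall (h : Tree T E) {Ψ : Position}
    (hΨ : ∀ a ∈ Ψ, ∃ w α, a.2 = addrMove w α) : Tree (T ++ Ψ) E where
  isNode_iff w := by
    rw [← h.isNode_iff, isNode_append, or_iff_left_iff_imp]
    rintro (hw | ⟨u, b, rfl, a, ha, hu⟩)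
    · exact Or.inl hw
    · obtain ⟨w, α, hw⟩ := hΨ a ha
      exact absurd (hw.symm.trans hu) (addrMove_ne_replMove w u α)
  incomp := h.incomp
  cover := h.cover

/-- Either child may be listed first, so that growth can continue at the head of the list. -/
theorem Tree.split {l : List Bool} (h : Tree T (l :: E)) (p : Player) (b : Bool) :
    Tree (T ++ [(p, replMove l)]) ((l ++ [b]) :: (l ++ [!b]) :: E) where
  isNode_iff w := by
    have h1 : IsNode [(p, replMove l)] w ↔ w = [] ∨ w = l ++ [b] ∨ w = l ++ [!b] := by
      refine or_congr Iff.rfl ⟨?_, ?_⟩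
      · rintro ⟨u, c, rfl, a, ha, hu⟩
        obtain rfl := List.mem_singleton.1 ha
        obtain rfl := replMove_inj hu
        cases b <;> cases c <;> simp
      · rintro (rfl | rfl)
        · exact ⟨l, b, rfl, _, List.mem_singleton_self _, rfl⟩
        · exact ⟨l, !b, rfl, _, List.mem_singleton_self _, rfl⟩
    rw [isNode_append, h.isNode_iff, h1]
    simp only [List.mem_cons, exists_eq_or_imp, List.prefix_concat_iff]
    constructor
    · rintro ((h | h) | rfl | rfl | rfl)
      · exact Or.inl (Or.inr h)
      · exact Or.inr (Or.inr h)
      · exact Or.inl (Or.inr List.nil_prefix)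
      · exact Or.inl (Or.inl rfl)
      · exact Or.inr (Or.inl (Or.inl rfl))
    · rintro ((h | h) | (h | h) | h)
      · exact Or.inr (Or.inr (Or.inl h))
      · exact Or.inl (Or.inl h)
      · exact Or.inr (Or.inr (Or.inr h))
      · exact Or.inl (Or.inl h)
      · exact Or.inl (Or.inr h)
  incomp := by
    have h1 := List.pairwise_cons.1 h.incomp
    refine List.pairwise_cons.2 ⟨fun l' hl' => ?_, List.pairwise_cons.2 ⟨fun l' hl' => ?_, h1.2⟩⟩
    · rcases List.mem_cons.1 hl' with rfl | hl'
      · exact incomp_concat l b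
      · exact (h1.1 l' hl').of_prefix (List.prefix_append _ _) List.prefix_rfl
    · exact (h1.1 l' hl').of_prefix (List.prefix_append _ _) List.prefix_rfl
  cover x := by
    obtain ⟨l', hl', hx⟩ := h.cover x
    rcases List.mem_cons.1 hl' with rfl | hl'
    · refine ⟨_, ?_, hx.concat⟩
      rcases Bool.eq_or_eq_not (x l'.length) b with h | h <;> simp [h]
    · exact ⟨l', by simp [hl'], hx⟩

/-- Each replicated string is a leaf at the moment of its replication, because the previous split
has just created it; this makes the move legal. -/
theorem Tree.grow {A : Game} (s : List Bool) :
    ∀ {l : List Bool} {T : Position} {E : List (List Bool)}, Tree T (l :: E) →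
      (T : Run) ∈ A.cstT.Lr →
      Tree (T ++ (growPath l s).map fun u => (.bot, replMove u)) (growLeaf l s ++ E) ∧
      ((T ++ (growPath l s).map fun u => (.bot, replMove u) : Position) : Run) ∈ A.cstT.Lr := by
  induction s with
  | nil => intro l T E h hT; simpa [growPath, growLeaf] using ⟨h, hT⟩
  | cons b s ih =>
    intro l T E h hT
    have h1 := ih (h.split .bot b) (mem_cstT_Lr_append.2
      ⟨hT, Or.inl ⟨rfl, l, h.isLeaf_iff.2 (by simp), rfl⟩⟩)
    simp only [growPath, growLeaf, List.map_cons]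
    rw [List.append_assoc] at h1
    exact ⟨h1.1.perm (List.perm_middle), h1.2⟩

/-- `E₀` stands for leaves that are not to be processed; in the induction it receives those already
expanded. -/
theorem Tree.expand {A : Game} (w : List Bool) (E : List (List Bool)) :
    ∀ {E₀ : List (List Bool)} {T : Position}, Tree T (E ++ E₀) → (T : Run) ∈ A.cstT.Lr →
      Tree (T ++ (E.flatMap (expandPath w)).map fun u => (.bot, replMove u))
        (E.flatMap (expandLeaf w) ++ E₀) ∧
      ((T ++ (E.flatMap (expandPath w)).map fun u => (.bot, replMove u) : Position) : Run) ∈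
        A.cstT.Lr := by
  induction E with
  | nil => intro E₀ T h hT; simpa using ⟨h, hT⟩
  | cons l E ih =>
    intro E₀ T h hT
    have h1 : Tree (T ++ (expandPath w l).map fun u => (.bot, replMove u))
        (expandLeaf w l ++ (E ++ E₀)) ∧
        ((T ++ (expandPath w l).map fun u => (.bot, replMove u) : Position) : Run) ∈ A.cstT.Lr := by
      unfold expandPath expandLeaf
      split_ifs
      · exact Tree.grow _ h hT
      · simpa using ⟨h, hT⟩
    have h2 := ih (h1.1.perm (E' := E ++ (expandLeaf w l ++ E₀)) (by
      rw [← List.append_assoc, ← List.append_assoc]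
      exact List.perm_append_comm.append_right _)) h1.2
    rw [List.flatMap_cons, List.flatMap_cons, List.map_append, ← List.append_assoc]
    refine ⟨h2.1.perm ?_, h2.2⟩
    rw [← List.append_assoc]
    exact List.perm_append_comm.append_right _

theorem append_mem_growLeaf (s : List Bool) : ∀ l, l ++ s ∈ growLeaf l s := by
  induction s with
  | nil => intro l; simp [growLeaf]
  | cons b s ih =>
    intro l
    have := ih (l ++ [b])
    rw [List.append_assoc] at this
    exact List.mem_cons_of_mem _ this

/-- Some leaf lies on an infinite path through `w`, hence is comparable with `w`: either it is grown
to `w` itself, or it is kept and extends `w`. -/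
theorem Tree.exists_expand (h : Tree T E) (w : List Bool) :
    ∃ l ∈ E.flatMap (expandLeaf w), w <+: l := by
  obtain ⟨x, hx⟩ := exists_isPre w
  obtain ⟨l, hl, hlx⟩ := h.cover x
  by_cases hlw : l <+: w
  · refine ⟨w, List.mem_flatMap.2 ⟨l, hl, ?_⟩, List.prefix_rfl⟩
    obtain ⟨s, rfl⟩ := hlw
    simpa [expandLeaf] using append_mem_growLeaf s l
  · exact ⟨l, List.mem_flatMap.2 ⟨l, hl, by simp [expandLeaf, hlw]⟩,
      (hx.total hlx).resolve_right hlw⟩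

/-! ### From the old recurrence to the new one -/

/-- What holds whenever the machine for the implication from the old recurrence to the new one
grants permission. -/
structure OldToNewInv (A : Game) (E : List (List Bool)) (Φ : Position) : Prop where
  legal : (Φ : Run) ∈ (A.cstT.neg.or A.cstL).Lr
  tree : Tree (lpos Φ) E
  sync : ∀ x, tpos x (lpos Φ) = tpos x (rpos Φ)

theorem compPre_cases {Φ : Position} {C D : Game} {p : Player} {m : Move}
    (h : ((Φ ++ [(p, m)] : Position) : Run) ∈ (C.neg.or D).Lr) :
    (∃ μ, m = compPre false ++ μ ∧ ((lpos Φ ++ [(p.neg, μ)] : Position) : Run) ∈ C.Lr) ∨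
      ∃ μ, m = compPre true ++ μ ∧ ((rpos Φ ++ [(p, μ)] : Position) : Run) ∈ D.Lr := by
  obtain ⟨h1, h2, h3⟩ := mem_imp_Lr.1 h
  obtain ⟨i, μ, hm⟩ := h1 (p, m) (by simp)
  obtain rfl : m = _ := hm
  cases i
  · exact Or.inl ⟨μ, rfl, by rwa [lpos_append, lpos_left] at h2⟩
  · exact Or.inr ⟨μ, rfl, by rwa [rpos_append, rpos_right] at h3⟩

/-- The threads on both sides are equal and receive the same labmove, so legality in the new
recurrence follows from that in the old one. -/
theorem OldToNewInv.copy {A : Game} {Φ : Position} (h : OldToNewInv A E Φ) {w : List Bool}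
    {α : Move} (hl : ((lpos Φ ++ [(.top, addrMove w α)] : Position) : Run) ∈ A.cstT.Lr) :
    OldToNewInv A E (Φ ++ [(.bot, compPre false ++ addrMove w α)] ++
      [(.top, compPre true ++ addrMove w α)]) := by
  have el : lpos (Φ ++ [(.bot, compPre false ++ addrMove w α)] ++
      [(.top, compPre true ++ addrMove w α)]) = lpos Φ ++ [(.top, addrMove w α)] := by
    simp only [lpos_append, lpos_left, lpos_right, List.append_nil]
    rfl
  have er : rpos (Φ ++ [(.bot, compPre false ++ addrMove w α)] ++
      [(.top, compPre true ++ addrMove w α)]) = rpos Φ ++ [(.top, addrMove w α)] := by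
    simp only [rpos_append, rpos_left, rpos_right, List.append_nil]
  have hs : ∀ x, tpos x (lpos Φ ++ [(.top, addrMove w α)]) =
      tpos x (rpos Φ ++ [(.top, addrMove w α)]) := fun x => by
    rw [tpos_append, tpos_append, h.sync]
  obtain ⟨h1, h2, h3⟩ := mem_imp_Lr.1 h.legal
  refine ⟨mem_imp_Lr.2 ⟨?_, ?_, ?_⟩, ?_, ?_⟩
  · simp only [List.forall_mem_append, List.forall_mem_singleton]
    exact ⟨⟨h1, false, _, rfl⟩, true, _, rfl⟩
  · rwa [el]
  · rw [er, mem_cstL_Lr, List.forall_mem_append, List.forall_mem_singleton]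
    exact ⟨⟨(mem_cstL_Lr.1 h3).1, w, α, rfl⟩, fun x => hs x ▸ tpos_mem_of_cstT hl x⟩
  · rw [el]
    exact h.tree.append_of_forall (by simp)
  · rwa [el, er]

theorem OldToNewInv.expand {A : Game} {Φ : Position} (h : OldToNewInv A E Φ) {w : List Bool}
    {α : Move} (hr : ((rpos Φ ++ [(.bot, addrMove w α)] : Position) : Run) ∈ A.cstL.Lr) :
    OldToNewInv A (E.flatMap (expandLeaf w)) (Φ ++ [(.bot, compPre true ++ addrMove w α)] ++
      (E.flatMap (expandPath w)).map replOut ++ [(.top, compPre false ++ addrMove w α)]) := by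
  have e0 : replOut = fun l => (.top, compPre false ++ replMove l) := rfl
  have el : lpos (Φ ++ [(.bot, compPre true ++ addrMove w α)] ++
      (E.flatMap (expandPath w)).map replOut ++ [(.top, compPre false ++ addrMove w α)]) =
      lpos Φ ++ ((E.flatMap (expandPath w)).map fun u => (.bot, replMove u)) ++
        [(.bot, addrMove w α)] := by
    rw [e0]
    simp only [lpos_append, lpos_left, lpos_right, lpos_map_left, List.append_nil]
    rfl
  have er : rpos (Φ ++ [(.bot, compPre true ++ addrMove w α)] ++
      (E.flatMap (expandPath w)).map replOut ++ [(.top, compPre false ++ addrMove w α)]) =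
      rpos Φ ++ [(.bot, addrMove w α)] := by
    rw [e0]
    simp only [rpos_append, rpos_left, rpos_right, rpos_map_left, List.append_nil]
  obtain ⟨h1, h2, h3⟩ := mem_imp_Lr.1 h.legal
  have hs : ∀ x, tpos x (lpos Φ ++ (E.flatMap (expandPath w)).map fun u => (.bot, replMove u)) =
      tpos x (rpos Φ) := fun x => by
    rw [tpos_append, tpos_repl, List.append_nil, h.sync]
  obtain ⟨h4, h5⟩ := Tree.expand (A := A) w E (E₀ := []) (by simpa using h.tree) h2
  rw [List.append_nil] at h4
  refine ⟨mem_imp_Lr.2 ⟨?_, ?_, ?_⟩, ?_, fun x => ?_⟩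
  · simp only [List.forall_mem_append, List.forall_mem_singleton, List.forall_mem_map]
    exact ⟨⟨⟨h1, true, _, rfl⟩, fun u _ => ⟨false, replMove u, rfl⟩⟩, false, _, rfl⟩
  · rw [el, mem_cstT_Lr_append]
    -- After the expansion `w` is a node, and the replications have not altered any thread, so `α`
    -- is legal there because it was legal in the consequent.
    refine ⟨h5, Or.inr ⟨w, α, rfl, (h4.isNode_iff w).2 (h.tree.exists_expand w), fun x hx => ?_⟩⟩
    have h6 := (mem_cstL_Lr.1 hr).2 x
    rw [tpos_append, tpos_addr, if_pos hx, ← hs] at h6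
    exact h6
  · rwa [er]
  · rw [el]
    exact h4.append_of_forall (by simp)
  · rw [el, er, tpos_append, hs, tpos_append]

theorem wins_oldToNew (A : Game) : (machine false).toEPM.Wins (A.cstT.neg.or A.cstL) := by
  refine StackMachine.wins_of_invariant (machine false) _
    (fun E Φ => restCfg false (encTab (E.map bitEntry)) Φ) restState (fun _ _ => rfl)
    (fun _ _ => rfl) (fun _ _ => rest_none _ _) (OldToNewInv A) (fun _ _ => True)
    (fun _ => trivial) [[]] init_rest ?_ (fun _ _ h => h.legal) ?_ ?_
  · exact ⟨(A.cstT.neg.or A.cstL).prefixDetermined.nil_mem, tree_nil, fun _ => rfl⟩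
  · intro E Φ h m hm
    rcases compPre_cases hm with ⟨μ, rfl, hμ⟩ | ⟨μ, rfl, hμ⟩
    · rcases (mem_cstT_Lr_append.1 hμ).2 with ⟨hc, -⟩ | ⟨w, α, hw, -⟩
      -- In the antecedent the environment acts as `top`, which may not replicate.
      · exact absurd hc (by simp [Player.neg])
      · obtain rfl : μ = _ := hw
        exact ⟨E, _, round_copy E Φ w α, h.copy hμ, trivial⟩
    · obtain ⟨w, α, hw⟩ := (mem_cstL_Lr.1 hμ).1 (.bot, μ) (by simp)
      obtain rfl : μ = _ := hw
      exact ⟨_, _, round_expand E Φ w α, h.expand hμ, trivial⟩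
  · intro E P h _ hP
    -- Every thread is its own counterpart, so no limit argument is needed.
    exact wn_imp_limitRun wn_cstT wn_cstL hP (fun n => (h n).legal) fun v hv =>
      ⟨v, hv, fun n => (h n).sync v⟩

end CoL

namespace CoL

/-! ### Entries of the table -/

theorem Entry.leaf_prefix {e e' : Entry} (h : e <+: e') : e.leaf <+: e'.leaf := h.filterMap _

theorem Entry.addr_prefix {e e' : Entry} (h : e <+: e') : e.addr <+: e'.addr := h.map _

theorem prefix_padAlong (w : List Bool) (e : Entry) : e <+: padAlong w e := by
  induction w generalizing e with
  | nil => simp [padAlong]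
  | cons b w ih =>
    rcases e with _ | ⟨x, e⟩
    · exact List.nil_prefix
    · rw [padAlong]
      split_ifs
      · exact (List.prefix_cons_inj x).2 (ih e)
      · exact List.prefix_rfl

theorem leaf_padAlong (w : List Bool) (e : Entry) : (padAlong w e).leaf = e.leaf := by
  induction w generalizing e with
  | nil => simp [padAlong]
  | cons b w ih =>
    rcases e with _ | ⟨x, e⟩
    · cases b
      · simpa [padAlong, Entry.leaf] using ih []
      · simp [padAlong, Entry.leaf]
    · rw [padAlong]
      split_ifs
      · have := ih e
        rcases x with _ | x <;> simpa [Entry.leaf] using this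
      · rfl

theorem prefix_or_incomp_padAlong (w : List Bool) (e : Entry) :
    w <+: (padAlong w e).addr ∨ Incomp w (padAlong w e).addr := by
  induction w generalizing e with
  | nil => exact Or.inl List.nil_prefix
  | cons b w ih =>
    rcases e with _ | ⟨x, e⟩
    · cases b
      · simpa [padAlong, Entry.addr, Incomp] using ih []
      · simp [padAlong, Entry.addr, Incomp]
    · rw [padAlong]
      split_ifs with h
      · simpa [Entry.addr, Incomp, h] using ih e
      · exact Or.inr (by simp [Entry.addr, Incomp, h, Ne.symm h])

/-- The purpose of padding: whether a thread through the address receives a move at `w` no longer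
depends on the thread. -/
theorem prefix_padAlong_iff {w : List Bool} {e : Entry} {x : Bitstream}
    (hx : IsPre (padAlong w e).addr x) : w <+: (padAlong w e).addr ↔ IsPre w x :=
  ⟨fun h => hx.of_prefix h, fun h =>
    (prefix_or_incomp_padAlong w e).resolve_right fun hi => hi.not_isPre h hx⟩

theorem flatMap_ite {ι κ : Type*} (p : ι → Prop) [DecidablePred p] (f : ι → κ) (S : List ι) :
    S.flatMap (fun e => if p e then [f e] else []) = (S.filter p).map f := by
  induction S with
  | nil => rfl
  | cons e S ih => by_cases h : p e <;> simp [h, ih]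

open Classical in
theorem flatMap_leftOuts (w : List Bool) (α : Move) (E : List Entry) :
    E.flatMap (leftOuts [.two, .dot] w α) =
      ((E.filter fun e => w <+: (padAlong w e).addr).map Entry.leaf).map
        fun l => (.top, compPre true ++ addrMove l α) := by
  unfold leftOuts
  rw [flatMap_ite, List.map_map]
  rfl

open Classical in
theorem flatMap_rightOuts (u : List Bool) (α : Move) (E : List Entry) :
    E.flatMap (rightOuts [.one, .dot] u α) =
      ((E.filter fun e => u <+: e.leaf).map Entry.addr).map
        fun l => (.top, compPre false ++ addrMove l α) := by
  unfold rightOuts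
  rw [flatMap_ite, List.map_map]
  rfl

/-! ### Moves in several incompatible nodes -/

theorem eq_of_isPre_map {ι : Type*} {S : List ι} {g : ι → List Bool}
    (h : (S.map g).Pairwise Incomp) {a b : ι} (ha : a ∈ S) (hb : b ∈ S) {x : Bitstream}
    (hxa : IsPre (g a) x) (hxb : IsPre (g b) x) : a = b := by
  by_contra hne
  have : Std.Symm fun a b : ι => Incomp (g a) (g b) := ⟨fun _ _ h => h.symm⟩
  exact ((List.pairwise_map.1 h).forall ha hb hne).not_isPre hxa hxb

open Classical in
-- Incompatible addresses lie on no common thread, so a batch of equal moves reaches each thread at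
-- most once.
theorem tpos_map_addr (x : Bitstream) (p : Player) (α : Move) {S : List (List Bool)}
    (hS : S.Pairwise Incomp) : tpos x (S.map fun l => (p, addrMove l α)) =
      if ∃ l ∈ S, IsPre l x then [(p, α)] else [] := by
  induction S with
  | nil => simp [tpos]
  | cons l S ih =>
    obtain ⟨h1, h2⟩ := List.pairwise_cons.1 hS
    rw [List.map_cons, ← List.singleton_append, tpos_append, ih h2, tpos_addr]
    by_cases hl : IsPre l x
    · have : ¬ ∃ l ∈ S, IsPre l x := fun ⟨l', hl', hx⟩ => (h1 l' hl').not_isPre hl hx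
      simp [hl, this]
    · simp [hl]

/-- By incompatibility, the earlier moves of the batch are invisible in the threads of the later
ones, so all of them can be judged in the original position. -/
theorem mem_cstT_Lr_append_map {A : Game} {p : Player} {α : Move} {S : List (List Bool)} :
    ∀ {T : Position}, (T : Run) ∈ A.cstT.Lr → S.Pairwise Incomp → (∀ l ∈ S, IsNode T l) →
      (∀ l ∈ S, ∀ v, IsPre l v → ((tpos v T ++ [(p, α)] : Position) : Run) ∈ A.Lr) →
      ((T ++ S.map fun l => (p, addrMove l α) : Position) : Run) ∈ A.cstT.Lr := by
  induction S with
  | nil => intro T hT _ _ _; simpa using hT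
  | cons l S ih =>
    intro T hT hS hn hv
    obtain ⟨h1, h2⟩ := List.pairwise_cons.1 hS
    rw [List.map_cons, ← List.singleton_append, ← List.append_assoc]
    refine ih (mem_cstT_Lr_append.2 ⟨hT, Or.inr ⟨l, α, rfl, hn l (by simp), hv l (by simp)⟩⟩) h2
      (fun l' hl' => isNode_append.2 (Or.inl (hn l' (by simp [hl'])))) fun l' hl' v hlv => ?_
    rw [tpos_append, tpos_addr, if_neg fun h => (h1 l' hl').not_isPre h hlv, List.append_nil]
    exact hv l' (by simp [hl']) v hlv

/-! ### From the new recurrence to the old one -/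

/-- What holds whenever the machine for the implication from the new recurrence to the old one
grants permission. -/
structure NewToOldInv (A : Game) (E : List Entry) (Φ : Position) : Prop where
  legal : (Φ : Run) ∈ (A.cstL.neg.or A.cstT).Lr
  tree : Tree (rpos Φ) (E.map Entry.leaf)
  incomp : (E.map Entry.addr).Pairwise Incomp
  -- Threads of the antecedent that pass through no address are unconstrained; padding may abandon
  -- threads.
  sync : ∀ e ∈ E, ∀ v x, IsPre e.leaf v → IsPre e.addr x → tpos x (lpos Φ) = tpos v (rpos Φ)

variable {A : Game} {E : List Entry} {Φ : Position}

/-- Padding extends addresses and keeps leaves, so the tree and the old synchronization remain; the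
move then reaches corresponding threads on both sides. -/
theorem NewToOldInv.left (h : NewToOldInv A E Φ) {w : List Bool} {α : Move}
    (hl : ((lpos Φ ++ [(.top, addrMove w α)] : Position) : Run) ∈ A.cstL.Lr) :
    NewToOldInv A (E.map (padAlong w)) (Φ ++ [(.bot, compPre false ++ addrMove w α)] ++
      E.flatMap (leftOuts [.two, .dot] w α)) := by
  classical
  rw [flatMap_leftOuts]
  set S := (E.filter fun e => w <+: (padAlong w e).addr).map Entry.leaf with hS
  have el : lpos (Φ ++ [(.bot, compPre false ++ addrMove w α)] ++
      S.map fun l => (.top, compPre true ++ addrMove l α)) = lpos Φ ++ [(.top, addrMove w α)] := by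
    simp only [lpos_append, lpos_left, lpos_map_right, List.append_nil]
    rfl
  have er : rpos (Φ ++ [(.bot, compPre false ++ addrMove w α)] ++
      S.map fun l => (.top, compPre true ++ addrMove l α)) =
      rpos Φ ++ S.map fun l => (.top, addrMove l α) := by
    simp only [rpos_append, rpos_left, rpos_map_right, List.append_nil]
  obtain ⟨h1, h2, h3⟩ := mem_imp_Lr.1 h.legal
  have hSi : S.Pairwise Incomp :=
    h.tree.incomp.sublist (List.filter_sublist.map _)
  have hsync : ∀ e ∈ E, ∀ v x, IsPre e.leaf v → IsPre (padAlong w e).addr x →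
      tpos x (lpos Φ) = tpos v (rpos Φ) := fun e he v x hv hx =>
    h.sync e he v x hv (hx.of_prefix (Entry.addr_prefix (prefix_padAlong w e)))
  refine ⟨mem_imp_Lr.2 ⟨?_, ?_, ?_⟩, ?_, ?_, ?_⟩
  · simp only [List.forall_mem_append, List.forall_mem_singleton, List.forall_mem_map]
    exact ⟨⟨h1, false, _, rfl⟩, fun l _ => ⟨true, addrMove l α, rfl⟩⟩
  · rwa [el]
  · rw [er]
    refine mem_cstT_Lr_append_map h3 hSi (fun l hl' => ?_) fun l hl' v hv => ?_
    · obtain ⟨e, he, rfl⟩ := List.mem_map.1 hl'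
      exact (h.tree.isNode_iff _).2
        ⟨_, List.mem_map_of_mem (List.mem_filter.1 he).1, List.prefix_rfl⟩
    · obtain ⟨e, he, rfl⟩ := List.mem_map.1 hl'
      rw [List.mem_filter, decide_eq_true_eq] at he
      -- Any thread through the padded address contains `w`, so `α` is legal in it, and
      -- synchronization carries this over to the thread `v` of the leaf.
      obtain ⟨x, hx⟩ := exists_isPre (padAlong w e).addr
      have := (mem_cstL_Lr.1 hl).2 x
      rwa [tpos_append, tpos_addr, if_pos ((prefix_padAlong_iff hx).1 he.2),
        hsync e he.1 v x hv hx] at this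
  · have hE : (E.map (padAlong w)).map Entry.leaf = E.map Entry.leaf := by
      rw [List.map_map]
      exact List.map_congr_left fun e _ => leaf_padAlong w e
    rw [er, hE]
    exact h.tree.append_of_forall (by simp)
  · rw [List.map_map, List.pairwise_map]
    exact (List.pairwise_map.1 h.incomp).imp fun h =>
      h.of_prefix (Entry.addr_prefix (prefix_padAlong w _)) (Entry.addr_prefix (prefix_padAlong w _))
  · simp only [List.forall_mem_map]
    intro e he v x hv hx
    rw [leaf_padAlong] at hv
    rw [el, er, tpos_append, tpos_append, hsync e he v x hv hx, tpos_addr, tpos_map_addr _ _ _ hSi]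
    congr 1
    refine if_congr ?_ rfl rfl
    rw [← prefix_padAlong_iff hx]
    constructor
    · exact fun hw => ⟨e.leaf, List.mem_map_of_mem (by simp [he, hw]), hv⟩
    · rintro ⟨l, hl', hlv⟩
      obtain ⟨e', he', rfl⟩ := List.mem_map.1 hl'
      rw [List.mem_filter, decide_eq_true_eq] at he'
      obtain rfl := eq_of_isPre_map h.tree.incomp he he'.1 hv hlv
      exact he'.2

theorem NewToOldInv.right (h : NewToOldInv A E Φ) {u : List Bool} {α : Move}
    (hr : ((rpos Φ ++ [(.bot, addrMove u α)] : Position) : Run) ∈ A.cstT.Lr)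
    (hu : IsNode (rpos Φ) u) :
    NewToOldInv A E (Φ ++ [(.bot, compPre true ++ addrMove u α)] ++
      E.flatMap (rightOuts [.one, .dot] u α)) := by
  classical
  rw [flatMap_rightOuts]
  set S := (E.filter fun e => u <+: e.leaf).map Entry.addr with hS
  have el : lpos (Φ ++ [(.bot, compPre true ++ addrMove u α)] ++
      S.map fun l => (.top, compPre false ++ addrMove l α)) =
      lpos Φ ++ S.map fun l => (.bot, addrMove l α) := by
    simp only [lpos_append, lpos_right, lpos_map_left, List.append_nil]
    rfl
  have er : rpos (Φ ++ [(.bot, compPre true ++ addrMove u α)] ++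
      S.map fun l => (.top, compPre false ++ addrMove l α)) = rpos Φ ++ [(.bot, addrMove u α)] := by
    simp only [rpos_append, rpos_right, rpos_map_left, List.append_nil]
  obtain ⟨h1, h2, h3⟩ := mem_imp_Lr.1 h.legal
  have hSi : S.Pairwise Incomp := h.incomp.sublist (List.filter_sublist.map _)
  -- A node cannot properly extend a leaf, so `u` lies on a thread of a leaf exactly when it is a
  -- prefix of that leaf.
  have hpre : ∀ e ∈ E, ∀ v, IsPre e.leaf v → (IsPre u v ↔ u <+: e.leaf) := by
    refine fun e he v hv => ⟨fun huv => ?_, hv.of_prefix⟩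
    refine (huv.total hv).elim id fun hc => ?_
    obtain ⟨l, hl, hul⟩ := (h.tree.isNode_iff u).1 hu
    obtain ⟨y, hy⟩ := exists_isPre l
    obtain rfl := h.tree.eq_of_isPre hl (List.mem_map_of_mem he) hy (hy.of_prefix (hc.trans hul))
    exact hul
  have hsync : ∀ e ∈ E, ∀ v x, IsPre e.leaf v → IsPre e.addr x →
      tpos x (lpos Φ ++ S.map fun l => (.bot, addrMove l α)) =
        tpos v (rpos Φ ++ [(.bot, addrMove u α)]) := by
    intro e he v x hv hx
    rw [tpos_append, tpos_append, h.sync e he v x hv hx, tpos_addr, tpos_map_addr _ _ _ hSi]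
    congr 1
    refine if_congr ?_ rfl rfl
    rw [hpre e he v hv]
    constructor
    · rintro ⟨l, hl', hlv⟩
      obtain ⟨e', he', rfl⟩ := List.mem_map.1 hl'
      rw [List.mem_filter, decide_eq_true_eq] at he'
      obtain rfl := eq_of_isPre_map h.incomp he he'.1 hx hlv
      exact he'.2
    · exact fun hw => ⟨e.addr, List.mem_map_of_mem (by simp [he, hw]), hx⟩
  refine ⟨mem_imp_Lr.2 ⟨?_, ?_, ?_⟩, ?_, h.incomp, ?_⟩
  · simp only [List.forall_mem_append, List.forall_mem_singleton, List.forall_mem_map]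
    exact ⟨⟨h1, true, _, rfl⟩, fun l _ => ⟨false, addrMove l α, rfl⟩⟩
  · rw [el, mem_cstL_Lr, List.forall_mem_append, List.forall_mem_map]
    refine ⟨⟨(mem_cstL_Lr.1 h2).1, fun l _ => ⟨l, α, rfl⟩⟩, fun x => ?_⟩
    -- A thread through a selected address proceeds like a legal thread of the consequent; any other
    -- thread is unchanged.
    by_cases hx : ∃ l ∈ S, IsPre l x
    · obtain ⟨l, hl, hlx⟩ := hx
      obtain ⟨e, he, rfl⟩ := List.mem_map.1 hl
      obtain ⟨v, hv⟩ := exists_isPre e.leaf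
      rw [hsync e (List.mem_filter.1 he).1 v x hv hlx]
      exact tpos_mem_of_cstT hr v
    · rw [tpos_append, tpos_map_addr _ _ _ hSi, if_neg hx, List.append_nil]
      exact (mem_cstL_Lr.1 h2).2 x
  · rwa [er]
  · rw [er]
    exact h.tree.append_of_forall (by simp)
  · rwa [el, er]

theorem prefix_of_mem_splitEntry {u : List Bool} {e e' : Entry} (h : e' ∈ splitEntry u e) :
    e <+: e' := by
  unfold splitEntry at h
  split_ifs at h
  · simp only [List.mem_cons, List.not_mem_nil, or_false] at h
    rcases h with rfl | rfl <;> exact List.prefix_append _ _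
  · rw [List.mem_singleton.1 h]

theorem flatMap_splitEntry {u : List Bool} {E : List Entry} (h : ∀ e ∈ E, e.leaf ≠ u) :
    E.flatMap (splitEntry u) = E := by
  induction E with
  | nil => rfl
  | cons e E ih =>
    rw [List.flatMap_cons, ih fun e he => h e (by simp [he]), splitEntry, if_neg (h e (by simp))]
    rfl

/-- Leaf and address are extended by the same bit, and a replicative move alters no thread, so both
halves inherit the synchronization. -/
theorem NewToOldInv.split (h : NewToOldInv A E Φ) {u : List Bool}
    (hr : ((rpos Φ ++ [(.bot, replMove u)] : Position) : Run) ∈ A.cstT.Lr)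
    (hu : IsLeaf (rpos Φ) u) :
    NewToOldInv A (E.flatMap (splitEntry u)) (Φ ++ [(.bot, compPre true ++ replMove u)]) := by
  have el : lpos (Φ ++ [(.bot, compPre true ++ replMove u)]) = lpos Φ := by
    simp only [lpos_append, lpos_right, List.append_nil]
  have er : rpos (Φ ++ [(.bot, compPre true ++ replMove u)]) =
      rpos Φ ++ [(.bot, replMove u)] := by
    simp only [rpos_append, rpos_right]
  have et : ∀ v, tpos v (rpos Φ ++ [(.bot, replMove u)]) = tpos v (rpos Φ) := fun v => by
    have := tpos_repl v [u] .bot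
    rw [List.map_cons, List.map_nil] at this
    rw [tpos_append, this, List.append_nil]
  obtain ⟨h1, h2, h3⟩ := mem_imp_Lr.1 h.legal
  obtain ⟨e, he, rfl⟩ := List.mem_map.1 (h.tree.isLeaf_iff.1 hu)
  -- The entry of the split leaf is moved to the front; since leaves are pairwise incompatible, no
  -- other entry is affected.
  obtain ⟨E₁, E₂, rfl⟩ := List.append_of_mem he
  have hperm : (E₁ ++ e :: E₂).Perm (e :: (E₁ ++ E₂)) := List.perm_middle
  have ht := h.tree.perm (hperm.map _)
  have hi : ((e :: (E₁ ++ E₂)).map Entry.addr).Pairwise Incomp :=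
    h.incomp.perm (hperm.map _) fun h => h.symm
  rw [List.map_cons] at ht hi
  have hne : ∀ e' ∈ E₁ ++ E₂, e'.leaf ≠ e.leaf := fun e' he' hc =>
    ((List.pairwise_cons.1 ht.incomp).1 _ (List.mem_map_of_mem he')).1 (by rw [hc])
  have hE : ((E₁ ++ e :: E₂).flatMap (splitEntry e.leaf)).Perm
      ((e ++ [some false]) :: (e ++ [some true]) :: (E₁ ++ E₂)) := by
    refine (hperm.flatMap_right _).trans ?_
    rw [List.flatMap_cons, flatMap_splitEntry hne, splitEntry, if_pos rfl]
    rfl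
  have hleaf : ∀ b, Entry.leaf (e ++ [some b]) = e.leaf ++ [b] := fun b => by simp [Entry.leaf]
  have haddr : ∀ b, Entry.addr (e ++ [some b]) = e.addr ++ [b] := fun b => by simp [Entry.addr]
  refine ⟨mem_imp_Lr.2 ⟨?_, ?_, ?_⟩, ?_, ?_, ?_⟩
  · simp only [List.forall_mem_append, List.forall_mem_singleton]
    exact ⟨h1, true, _, rfl⟩
  · rwa [el]
  · rwa [er]
  · rw [er]
    refine Tree.perm ?_ (hE.map _).symm
    rw [List.map_cons, List.map_cons, hleaf, hleaf]
    exact ht.split .bot false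
  · refine List.Pairwise.perm ?_ (hE.map _).symm fun h => h.symm
    rw [List.map_cons, List.map_cons, haddr, haddr]
    obtain ⟨h4, h5⟩ := List.pairwise_cons.1 hi
    refine List.pairwise_cons.2 ⟨fun l hl => ?_, List.pairwise_cons.2 ⟨fun l hl => ?_, h5⟩⟩
    · rcases List.mem_cons.1 hl with rfl | hl
      · exact incomp_concat e.addr false
      · exact (h4 l hl).of_prefix (List.prefix_append _ _) List.prefix_rfl
    · exact (h4 l hl).of_prefix (List.prefix_append _ _) List.prefix_rfl
  · intro e' he' v x hv hx
    obtain ⟨e'', he'', hp⟩ := List.mem_flatMap.1 he'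
    have hp := prefix_of_mem_splitEntry hp
    rw [el, er, et]
    exact h.sync e'' he'' v x (hv.of_prefix (Entry.leaf_prefix hp))
      (hx.of_prefix (Entry.addr_prefix hp))

/-! ### Essentially finite limits -/

/-- Padding is dropped from the leaf and read as 0 in the address, so it contributes no 1 to either.
-/
theorem Entry.count_addr (e : Entry) : e.addr.count true = e.leaf.count true := by
  induction e with
  | nil => rfl
  | cons x e ih =>
    rcases x with _ | _ | _ <;> simpa [Entry.addr, Entry.leaf, List.count_cons] using ih

theorem EssFin.exists_count_le {v : Bitstream} (hv : EssFin v) :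
    ∃ K, ∀ l, IsPre l v → l.count true ≤ K := by
  obtain ⟨K, hK⟩ := hv.bddAbove
  -- All 1s occur at positions 0 to `K`, that is, among the first `K + 1` bits.
  refine ⟨K + 1, fun l hl => ?_⟩
  rw [← List.take_append_drop (K + 1) l, List.count_append, List.count_eq_zero (l := l.drop _) |>.2, add_zero]
  · exact List.count_le_length.trans (List.length_take_le _ _)
  · intro hc
    obtain ⟨i, hi, h⟩ := List.getElem_of_mem hc
    rw [List.getElem_drop, hl] at h
    have := hK h
    omega

theorem exists_essFin {a : ℕ → List Bool} (ha : ∀ m n, m ≤ n → a m <+: a n) {K : ℕ}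
    (hK : ∀ n, (a n).count true ≤ K) : ∃ x, EssFin x ∧ ∀ n, IsPre (a n) x := by
  classical
  have hget : ∀ {m n i : ℕ} (hm : i < (a m).length) (hn : i < (a n).length),
      (a m)[i] = (a n)[i] := by
    intro m n i hm hn
    rcases le_total m n with h | h
    · exact (ha m n h).getElem hm
    · exact ((ha n m h).getElem hn).symm
  refine ⟨fun i => decide (∃ n, ∃ h : i < (a n).length, (a n)[i] = true), ?_, fun n i hi => ?_⟩
  · have hb : BddAbove (Set.range fun n => (a n).count true) :=
      ⟨K, by rintro _ ⟨n, rfl⟩; exact hK n⟩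
    -- Take a member with the greatest number of 1s: a 1 beyond its end would give a later member
    -- one more.
    obtain ⟨N, hN⟩ := Nat.sSup_mem (Set.range_nonempty fun n => (a n).count true) hb
    refine (Set.finite_lt_nat (a N).length).subset fun i hi => ?_
    obtain ⟨n, hn, ht⟩ := of_decide_eq_true hi
    by_contra hc
    have hc : (a N).length ≤ i := not_lt.1 hc
    have hM := le_csSup hb ⟨max n N, rfl⟩
    rw [← hN] at hM
    obtain ⟨r, hr⟩ := ha N (max n N) (le_max_right _ _)
    have hi' : i < (a (max n N)).length := hn.trans_le (ha _ _ (le_max_left _ _)).length_le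
    have h1 := (hget hn hi').symm.trans ht
    have h2 : true ∈ r := by
      simp only [← hr] at h1 hi'
      rw [List.getElem_append_right hc] at h1
      exact h1 ▸ List.getElem_mem _
    have h3 := List.count_pos_iff.2 h2
    simp only [← hr, List.count_append] at hM
    omega
  · rw [Bool.eq_iff_iff, decide_eq_true_iff]
    exact ⟨fun h => ⟨n, hi, h⟩, fun ⟨m, hm, h⟩ => (hget hi hm).trans h⟩

/-- For each moment take the entry whose leaf lies on `v`. These entries grow, and the number of 1s
in their addresses is that in initial segments of `v`, hence bounded; the limit of the addresses is
the desired thread. -/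
theorem exists_essFin_thread {E : ℕ → List Entry} {P : ℕ → Position}
    (h : ∀ n, NewToOldInv A (E n) (P n))
    (hnext : ∀ n, ∀ e' ∈ E (n + 1), ∃ e ∈ E n, e <+: e') {v : Bitstream} (hv : EssFin v) :
    ∃ v', EssFin v' ∧ ∀ n, tpos v' (lpos (P n)) = tpos v (rpos (P n)) := by
  have hex : ∀ n, ∃ e ∈ E n, IsPre e.leaf v := fun n => by
    simpa using (h n).tree.cover v
  choose e he hev using hex
  -- The ancestor of the next entry also has its leaf on `v`, and only one leaf of the current tree
  -- lies on `v`.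
  have hstep : ∀ n, e n <+: e (n + 1) := fun n => by
    obtain ⟨a, ha, hp⟩ := hnext n _ (he (n + 1))
    rwa [eq_of_isPre_map (h n).tree.incomp (he n) ha (hev n)
      ((hev (n + 1)).of_prefix (Entry.leaf_prefix hp))]
  have hmono : ∀ m n, m ≤ n → e m <+: e n := fun m n hmn =>
    Nat.le_induction List.prefix_rfl (fun n _ ih => ih.trans (hstep n)) n hmn
  obtain ⟨K, hK⟩ := hv.exists_count_le
  obtain ⟨v', hv', hp⟩ := exists_essFin (a := fun n => (e n).addr)
    (fun m n hmn => Entry.addr_prefix (hmono m n hmn))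
    (fun n => (e n).count_addr.trans_le (hK _ (hev n)))
  exact ⟨v', hv', fun n => (h n).sync (e n) (he n) v v' (hev n) (hp n)⟩

theorem wins_newToOld (A : Game) : (machine true).toEPM.Wins (A.cstL.neg.or A.cstT) := by
  refine StackMachine.wins_of_invariant (machine true) _
    (fun E Φ => restCfg true (encTab E) Φ) restState (fun _ _ => rfl)
    (fun _ _ => rfl) (fun _ _ => rest_none _ _) (NewToOldInv A)
    -- Every new entry must extend an old one; this is what makes the entries along a thread
    -- converge.
    (fun E E' => ∀ e' ∈ E', ∃ e ∈ E, e <+: e') (fun _ e he => ⟨e, he, List.prefix_rfl⟩)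
    [[]] init_rest ?_ (fun _ _ h => h.legal) ?_ ?_
  · refine ⟨(A.cstL.neg.or A.cstT).prefixDetermined.nil_mem, tree_nil,
      List.pairwise_singleton _ _, fun _ _ _ _ _ _ => rfl⟩
  · intro E Φ h m hm
    rcases compPre_cases hm with ⟨μ, rfl, hμ⟩ | ⟨μ, rfl, hμ⟩
    · obtain ⟨w, α, hw⟩ := (mem_cstL_Lr.1 hμ).1 (.top, μ) (by simp [Player.neg])
      obtain rfl : μ = _ := hw
      refine ⟨_, _, round_left E Φ w α, h.left hμ, fun e' he' => ?_⟩
      obtain ⟨e, he, rfl⟩ := List.mem_map.1 he'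
      exact ⟨e, he, prefix_padAlong w e⟩
    · rcases (mem_cstT_Lr_append.1 hμ).2 with ⟨-, u, hu, hm⟩ | ⟨u, α, hm, hu, -⟩
      · obtain rfl : μ = _ := hm
        refine ⟨_, _, round_right_colon E Φ u, h.split hμ hu, fun e' he' => ?_⟩
        obtain ⟨e, he, hp⟩ := List.mem_flatMap.1 he'
        exact ⟨e, he, prefix_of_mem_splitEntry hp⟩
      · obtain rfl : μ = _ := hm
        exact ⟨_, _, round_right_dot E Φ u α, h.right hμ hu,
          fun e he => ⟨e, he, List.prefix_rfl⟩⟩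
  · intro E P h hnext hP
    exact wn_imp_limitRun wn_cstL wn_cstT hP (fun n => (h n).legal) fun v hv =>
      exists_essFin_thread h hnext hv

end CoL

end

theorem theorem3p4 {Atom : Type*} (F : CoL.Formula Atom) :
    (CoL.Formula.imp (.cstT F) (.cstL F)).UniformlyValid ∧
      (CoL.Formula.imp (.cstL F) (.cstT F)).UniformlyValid := by
  -- The machines are fixed before the interpretation, and do not even depend on `F`.
  refine ⟨⟨(CoL.machine false).toEPM, fun I _ => ?_⟩, ⟨(CoL.machine true).toEPM, fun I _ => ?_⟩⟩
  · have h := CoL.wins_oldToNew (F.interp I)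
    simpa only [CoL.Formula.imp, CoL.Formula.neg, CoL.Formula.interp, CoL.Formula.interp_neg,
      CoL.Game.ccostT, CoL.Game.neg_neg] using h
  · have h := CoL.wins_newToOld (F.interp I)
    simpa only [CoL.Formula.imp, CoL.Formula.neg, CoL.Formula.interp, CoL.Formula.interp_neg,
      CoL.Game.cstL_neg] using h
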